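/- The model of computation is the real RAM: a program is a fixed finite program, every arithmetic operation on indices, every operation $+,-,\times,\div$ and comparison of reals, every memory access and every output of an index costs one step, and there is no floor function. The input is a list of $n\ge 1$ distinct points $P=\{p_1,\dots,p_n\}$ in the plane, given by their real coordinates. The convex layers of $P$ are obtained by repeatedly removing from the current set all of its points that lie on the boundary of its convex hull (whether they are vertices of the hull or not), until no point is left; the number $m\ge 1$ of layers is the convex hull peeling depth of $P$. (1) There are a real RAM program and a constant $C$ such that, for all $n\ge1$ and all inputs $P$ of $n$ points, the program halts after at most $C\,n^2\log(m+1)$ steps and has then reported each maximal collinear subset of $P$ of size at least three exactly once, as a list of its points without repetitions, and nothing else. In particular its running time is $O(n^2\log m)$ for $m\ge 2$. (2) There are a real RAM program and a constant $C$ such that, for all $n\ge1$ and all inputs $P$ of $n$ points, the program halts after at most $C\,m\,n\log(n+1)$ steps and has then reported the $m$ convex layers of $P$ from the outside to the inside, each as a list of its points without repetitions such that any three points, taken in the order of the list, form a counterclockwise oriented or degenerate triangle (so that a layer that is not collinear is listed in counterclockwise order along its convex polygon). (3) There is a constant $C$ such that $m\log n\le C\,n\log m$ for all integers $2\le m\le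 n$. -/

import Mathlib

/-! ### The real RAM

Programs are finite pieces of syntax, fixed once and for all inputs. The memory consists of arrays
of natural numbers (indices, counters) and of arrays of reals; a scalar variable is one cell of an
array. Reals can be added, subtracted, multiplied, divided and compared exactly; there is no floor
function and no other conversion from reals to integers. Every operation costs one step. -/

namespace RealRAM

/-- Memory contents: cell `i` of array `a` is `nat a i`, resp. `real a i`. The third component is
a write-only output tape. -/
structure State where
  nat : ℕ → ℕ → ℕ
  real : ℕ → ℕ → ℝ
  out : List ℕ

/-- Integer (index) expressions. Only addition and truncated subtraction are available. -/
inductive NatExpr where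
  | lit (k : ℕ)
  | load (a : ℕ) (i : NatExpr)
  | add (e f : NatExpr)
  | sub (e f : NatExpr)

/-- Real expressions: rational constants, indirect memory access, arithmetic. -/
inductive RealExpr where
  | lit (q : ℚ)
  | load (a : ℕ) (i : NatExpr)
  | add (e f : RealExpr)
  | sub (e f : RealExpr)
  | mul (e f : RealExpr)
  | div (e f : RealExpr)

/-- Tests: comparisons of integers and of reals, and Boolean combinations. -/
inductive Test where
  | natLe (e f : NatExpr)
  | realLe (e f : RealExpr)
  | neg (b : Test)
  | and (b c : Test)

/-- Programs. `natStore a i e` writes the value of `e` into cell `i` of the integer array `a`,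
`realStore` does the same for reals, and `emit e` appends the value of `e` to the output. -/
inductive Prog where
  | skip
  | natStore (a : ℕ) (i e : NatExpr)
  | realStore (a : ℕ) (i : NatExpr) (e : RealExpr)
  | emit (e : NatExpr)
  | seq (c d : Prog)
  | cond (b : Test) (c d : Prog)
  | loop (b : Test) (c : Prog)

def NatExpr.eval (s : State) : NatExpr → ℕ
  | .lit k => k
  | .load a i => s.nat a (i.eval s)
  | .add e f => e.eval s + f.eval s
  | .sub e f => e.eval s - f.eval s

def NatExpr.cost : NatExpr → ℕ
  | .lit _ => 1
  | .load _ i => i.cost + 1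
  | .add e f => e.cost + f.cost + 1
  | .sub e f => e.cost + f.cost + 1

/-- Division by zero gives zero; a program can test for it with one comparison. -/
noncomputable def RealExpr.eval (s : State) : RealExpr → ℝ
  | .lit q => (q : ℝ)
  | .load a i => s.real a (i.eval s)
  | .add e f => e.eval s + f.eval s
  | .sub e f => e.eval s - f.eval s
  | .mul e f => e.eval s * f.eval s
  | .div e f => e.eval s / f.eval s

def RealExpr.cost : RealExpr → ℕ
  | .lit _ => 1
  | .load _ i => i.cost + 1
  | .add e f => e.cost + f.cost + 1
  | .sub e f => e.cost + f.cost + 1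
  | .mul e f => e.cost + f.cost + 1
  | .div e f => e.cost + f.cost + 1

def Test.Holds (s : State) : Test → Prop
  | .natLe e f => e.eval s ≤ f.eval s
  | .realLe e f => e.eval s ≤ f.eval s
  | .neg b => ¬ b.Holds s
  | .and b c => b.Holds s ∧ c.Holds s

def Test.cost : Test → ℕ
  | .natLe e f => e.cost + f.cost + 1
  | .realLe e f => e.cost + f.cost + 1
  | .neg b => b.cost + 1
  | .and b c => b.cost + c.cost + 1

def State.setNat (s : State) (a i v : ℕ) : State :=
  { s with nat := Function.update s.nat a (Function.update (s.nat a) i v) }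

def State.setReal (s : State) (a i : ℕ) (v : ℝ) : State :=
  { s with real := Function.update s.real a (Function.update (s.real a) i v) }

def State.write (s : State) (v : ℕ) : State :=
  { s with out := s.out ++ [v] }

/-- `Exec c s t s'`: started in `s`, the program `c` halts in `s'` after `t` steps. -/
inductive Exec : Prog → State → ℕ → State → Prop
  | skip (s : State) : Exec .skip s 1 s
  | natStore (s : State) (a : ℕ) (i e : NatExpr) :
      Exec (.natStore a i e) s (i.cost + e.cost + 1) (s.setNat a (i.eval s) (e.eval s))
  | realStore (s : State) (a : ℕ) (i : NatExpr) (e : RealExpr) :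
      Exec (.realStore a i e) s (i.cost + e.cost + 1) (s.setReal a (i.eval s) (e.eval s))
  | emit (s : State) (e : NatExpr) :
      Exec (.emit e) s (e.cost + 1) (s.write (e.eval s))
  | seq {c d : Prog} {s s' s'' : State} {t t' : ℕ} :
      Exec c s t s' → Exec d s' t' s'' → Exec (.seq c d) s (t + t') s''
  | condTrue {b : Test} {c d : Prog} {s s' : State} {t : ℕ} :
      b.Holds s → Exec c s t s' → Exec (.cond b c d) s (b.cost + 1 + t) s'
  | condFalse {b : Test} {c d : Prog} {s s' : State} {t : ℕ} :
      ¬ b.Holds s → Exec d s t s' → Exec (.cond b c d) s (b.cost + 1 + t) s'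
  | loopTrue {b : Test} {c : Prog} {s s' s'' : State} {t t' : ℕ} :
      b.Holds s → Exec c s t s' → Exec (.loop b c) s' t' s'' →
      Exec (.loop b c) s (b.cost + 1 + t + t') s''
  | loopFalse {b : Test} {c : Prog} {s : State} :
      ¬ b.Holds s → Exec (.loop b c) s (b.cost + 1) s

end RealRAM

/-! ### Point sets in the plane -/

namespace CollinearPoints

abbrev Plane := EuclideanSpace ℝ (Fin 2)

/-- The input convention: `n` in cell `0` of the integer array `0`, the abscissas in cells
`0, …, n - 1` of the real array `0`, the ordinates in those of the real array `1`; all other cells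
are `0`, and the output tape is empty. -/
noncomputable def input {n : ℕ} (p : Fin n → Plane) : RealRAM.State where
  nat a i := if a = 0 ∧ i = 0 then n else 0
  real a i := if h : i < n then
      (if a = 0 then p ⟨i, h⟩ 0 else if a = 1 then p ⟨i, h⟩ 1 else 0) else 0
  out := []

/-- The output format for a sequence of lists of points, given by their indices: for each list its
length, followed by its entries. -/
def encode {n : ℕ} (L : List (List (Fin n))) : List ℕ :=
  L.flatMap fun l => l.length :: l.map Fin.val

/-- `S` is (the index set of) a maximal collinear subset of the points `p`. -/
def IsMaximalCollinear {n : ℕ} (p : Fin n → Plane) (S : Finset (Fin n)) : Prop :=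
  Maximal (fun T : Finset (Fin n) => Collinear ℝ (p '' (T : Set (Fin n)))) S

/-- The output lists every maximal collinear subset of size at least three exactly once, without
repeating a point within a subset, and lists nothing else. -/
def ReportsMaximalCollinear {n : ℕ} (p : Fin n → Plane) (out : List ℕ) : Prop :=
  ∃ L : List (List (Fin n)), out = encode L ∧ (∀ l ∈ L, l.Nodup) ∧
    (L.map List.toFinset).Nodup ∧
    ∀ S : Finset (Fin n), S ∈ L.map List.toFinset ↔ IsMaximalCollinear p S ∧ 3 ≤ S.card

/-- The points of `A` on the boundary of the convex hull of `A` (vertices or not). If `A` is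
collinear, the hull has empty interior and these are all points of `A`. -/
def hullLayer (A : Set Plane) : Set Plane := A ∩ frontier (convexHull ℝ A)

def peel (A : Set Plane) : Set Plane := A \ hullLayer A

/-- The `j`-th convex layer (counted from `0`). -/
def convexLayer (A : Set Plane) (j : ℕ) : Set Plane := hullLayer (peel^[j] A)

/-- The number of times the hull has to be peeled off until no point of `A` is left. -/
noncomputable def peelingDepth (A : Set Plane) : ℕ := sInf {k : ℕ | peel^[k] A = ∅}

/-- Twice the signed area of the triangle `a b c`. -/
noncomputable def orient (a b c : Plane) : ℝ :=
  (b 0 - a 0) * (c 1 - a 1) - (b 1 - a 1) * (c 0 - a 0)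

/-- The points with the listed indices are the consecutive points, in counterclockwise order, of
the boundary of a convex polygon (three consecutive points may be collinear; if all points are
collinear, the polygon is degenerate and the order is arbitrary). -/
def IsConvexPolygon {n : ℕ} (p : Fin n → Plane) (l : List (Fin n)) : Prop :=
  l.Nodup ∧ ∀ i j k : Fin l.length, i < j → j < k →
    0 ≤ orient (p (l.get i)) (p (l.get j)) (p (l.get k))

/-- The output lists the convex layers of the points from the outside to the inside, each one as a
convex polygon. -/
def ReportsConvexLayers {n : ℕ} (p : Fin n → Plane) (out : List ℕ) : Prop :=
  ∃ L : List (List (Fin n)), out = encode L ∧ (∀ l ∈ L, IsConvexPolygon p l) ∧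
    L.length = peelingDepth (Set.range p) ∧
    ∀ j : Fin L.length, p '' {i | i ∈ L.get j} = convexLayer (Set.range p) j

end CollinearPoints

/-! Collinear subsets. Fix a pivot `p` and sort the other points by the slope of their line through
`p`; the points on one line through `p` then form a block of equal slopes. Reporting a block with at
least two entries only if `p` has the smallest index on that line yields each maximal collinear
subset of size at least three exactly once. With a general sorting algorithm this costs order `n log
n` per pivot; the point is to replace `log n` by `log m`.

To this end the points are listed once along the `m` convex layers. A layer is a lower chain
followed by the remaining points of the upper chain, and the pivot's lexicographic position cuts
each chain into a left and a right piece. Seen from the pivot, the slopes along such a piece change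
their direction of monotonicity at most once (`ConvexChain.unimodal_left`,
`ConvexChain.unimodal_right`). Hence the layer order consists of `4 * m` unimodal pieces for every
pivot (`layers_exists_unimodal`). Separating the rising from the falling entries turns it into at
most `16 * m + 2` increasing runs (`descents_rearrange_le`), and balanced merging of the runs takes
order `n log m` steps (`queueCost_le`, `sortProg_runs`). Over `n` pivots this gives the first claim;
the time for the layers is of order `n log n + m n` and is absorbed by the `n ^ 2` term.

Layers. After one lexicographic sort, every layer is found by two linear monotone chain scans that
discard a point only at a strict right turn, so that collinear boundary points survive
(`chain_spec`). A point is on the hull boundary exactly if a line through it supports the set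
(`mem_frontier_convexHull_iff`), and the sign of the direction of the line decides between the lower
and the upper chain (`exists_supporting_iff`).

The logarithmic inequality follows from `log t ≤ t - 1` at `t = n / m`. Running times are tracked by
a program logic whose assertions mention the remaining time credits. -/

/-! ### A logic of total correctness with time credits -/

namespace RealRAM

/-- `block [c₁, …, cₖ]` runs `c₁, …, cₖ` in this order. -/
def block : List Prog → Prog
  | [] => .skip
  | c :: cs => .seq c (block cs)

/-- The scalar integer variable `a`. -/
def nvar (a : ℕ) : NatExpr := .load a (.lit 0)

/-- The assignment to the scalar integer variable `a`. -/
def set (a : ℕ) (e : NatExpr) : Prog := .natStore a (.lit 0) e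

/-- The incrementation of the scalar integer variable `a`. -/
def incr (a : ℕ) : Prog := set a (.add (nvar a) (.lit 1))

/-- The test `e < f`. -/
def ltTest (e f : NatExpr) : Test := .natLe (.add e (.lit 1)) f

/-- The test `b ∨ c`. -/
def orTest (b c : Test) : Test := .neg (.and (.neg b) (.neg c))

/-- The integer arrays to which a program may write. -/
def Prog.natVars : Prog → List ℕ
  | .skip => []
  | .natStore a _ _ => [a]
  | .realStore _ _ _ => []
  | .emit _ => []
  | .seq c d => c.natVars ++ d.natVars
  | .cond _ c d => c.natVars ++ d.natVars
  | .loop _ c => c.natVars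

/-- The real arrays to which a program may write. -/
def Prog.realVars : Prog → List ℕ
  | .skip => []
  | .natStore _ _ _ => []
  | .realStore a _ _ => [a]
  | .emit _ => []
  | .seq c d => c.realVars ++ d.realVars
  | .cond _ c d => c.realVars ++ d.realVars
  | .loop _ c => c.realVars

/-- Whether a program contains no output command. -/
def Prog.silent : Prog → Bool
  | .skip => true
  | .natStore _ _ _ => true
  | .realStore _ _ _ => true
  | .emit _ => false
  | .seq c d => c.silent && d.silent
  | .cond _ c d => c.silent && d.silent
  | .loop _ c => c.silent

/-- `s'` agrees with `s` on everything that `c` cannot change. -/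
structure Frame (c : Prog) (s s' : State) : Prop where
  nat : ∀ a, a ∉ c.natVars → s'.nat a = s.nat a
  real : ∀ a, a ∉ c.realVars → s'.real a = s.real a
  out : c.silent = true → s'.out = s.out

theorem Frame.refl (c : Prog) (s : State) : Frame c s s :=
  ⟨fun _ _ => rfl, fun _ _ => rfl, fun _ => rfl⟩

theorem Frame.trans {c : Prog} {s s' s'' : State} (h : Frame c s s') (h' : Frame c s' s'') :
    Frame c s s'' :=
  ⟨fun a ha => (h'.nat a ha).trans (h.nat a ha), fun a ha => (h'.real a ha).trans (h.real a ha),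
    fun hc => (h'.out hc).trans (h.out hc)⟩

theorem Frame.mono {c d : Prog} {s s' : State} (h : Frame c s s')
    (hn : ∀ a, a ∉ d.natVars → a ∉ c.natVars) (hr : ∀ a, a ∉ d.realVars → a ∉ c.realVars)
    (ho : d.silent = true → c.silent = true) : Frame d s s' :=
  ⟨fun a ha => h.nat a (hn a ha), fun a ha => h.real a (hr a ha), fun hc => h.out (ho hc)⟩

/-- The write sets are syntactic, so for a fixed program it is decidable which arrays survive. Loop
invariants therefore need not mention the arrays that a loop leaves alone. -/
theorem Exec.frame {c : Prog} {s s' : State} {t : ℕ} (h : Exec c s t s') : Frame c s s' := by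
  induction h with
  | skip s => exact .refl _ _
  | natStore s a i e =>
    refine ⟨fun b hb => ?_, fun _ _ => rfl, fun _ => rfl⟩
    simp only [Prog.natVars, List.mem_singleton] at hb
    simp [State.setNat, Function.update_of_ne hb]
  | realStore s a i e =>
    refine ⟨fun _ _ => rfl, fun b hb => ?_, fun _ => rfl⟩
    simp only [Prog.realVars, List.mem_singleton] at hb
    simp [State.setReal, Function.update_of_ne hb]
  | emit s e => exact ⟨fun _ _ => rfl, fun _ _ => rfl, fun h => by simp [Prog.silent] at h⟩
  | seq _ _ ih₁ ih₂ =>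
    refine Frame.trans (ih₁.mono ?_ ?_ ?_) (ih₂.mono ?_ ?_ ?_) <;>
      simp +contextual [Prog.natVars, Prog.realVars, Prog.silent]
  | condTrue _ _ ih =>
    exact ih.mono (by simp +contextual [Prog.natVars]) (by simp +contextual [Prog.realVars])
      (by simp +contextual [Prog.silent])
  | condFalse _ _ ih =>
    exact ih.mono (by simp +contextual [Prog.natVars]) (by simp +contextual [Prog.realVars])
      (by simp +contextual [Prog.silent])
  | loopTrue _ _ _ ih₁ ih₂ =>
    exact Frame.trans (ih₁.mono (fun _ h => h) (fun _ h => h) (fun h => h)) ih₂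
  | loopFalse _ => exact .refl _ _

/-- Started in `s` with `k` time credits, `c` halts, and `Q` holds of the final state and the number
of remaining credits. -/
def Runs (c : Prog) (s : State) (k : ℕ) (Q : State → ℕ → Prop) : Prop :=
  ∃ t s', Exec c s t s' ∧ t ≤ k ∧ Q s' (k - t)

/-- The consequence rule, combined with the frame rule: whoever uses the postcondition of a
subprogram also learns what the subprogram left unchanged. -/
theorem Runs.mono {c : Prog} {s : State} {k : ℕ} {Q Q' : State → ℕ → Prop} (h : Runs c s k Q)
    (hq : ∀ s' k', Frame c s s' → Q s' k' → Q' s' k') : Runs c s k Q' := by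
  obtain ⟨t, s', he, ht, hQ⟩ := h
  exact ⟨t, s', he, ht, hq _ _ he.frame hQ⟩

@[simp] theorem runs_skip {s : State} {k : ℕ} {Q : State → ℕ → Prop} :
    Runs .skip s k Q ↔ 1 ≤ k ∧ Q s (k - 1) := by
  constructor
  · rintro ⟨t, s', he, ht, hQ⟩
    cases he
    exact ⟨ht, hQ⟩
  · rintro ⟨ht, hQ⟩
    exact ⟨_, _, .skip s, ht, hQ⟩

@[simp] theorem runs_natStore {a : ℕ} {i e : NatExpr} {s : State} {k : ℕ}
    {Q : State → ℕ → Prop} : Runs (.natStore a i e) s k Q ↔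
      i.cost + e.cost + 1 ≤ k ∧ Q (s.setNat a (i.eval s) (e.eval s)) (k - (i.cost + e.cost + 1)) := by
  constructor
  · rintro ⟨t, s', he, ht, hQ⟩
    cases he
    exact ⟨ht, hQ⟩
  · rintro ⟨ht, hQ⟩
    exact ⟨_, _, .natStore s a i e, ht, hQ⟩

@[simp] theorem runs_realStore {a : ℕ} {i : NatExpr} {e : RealExpr} {s : State} {k : ℕ}
    {Q : State → ℕ → Prop} : Runs (.realStore a i e) s k Q ↔
      i.cost + e.cost + 1 ≤ k ∧
        Q (s.setReal a (i.eval s) (e.eval s)) (k - (i.cost + e.cost + 1)) := by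
  constructor
  · rintro ⟨t, s', he, ht, hQ⟩
    cases he
    exact ⟨ht, hQ⟩
  · rintro ⟨ht, hQ⟩
    exact ⟨_, _, .realStore s a i e, ht, hQ⟩

@[simp] theorem runs_emit {e : NatExpr} {s : State} {k : ℕ} {Q : State → ℕ → Prop} :
    Runs (.emit e) s k Q ↔ e.cost + 1 ≤ k ∧ Q (s.write (e.eval s)) (k - (e.cost + 1)) := by
  constructor
  · rintro ⟨t, s', he, ht, hQ⟩
    cases he
    exact ⟨ht, hQ⟩
  · rintro ⟨ht, hQ⟩
    exact ⟨_, _, .emit s e, ht, hQ⟩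

@[simp] theorem runs_seq {c d : Prog} {s : State} {k : ℕ} {Q : State → ℕ → Prop} :
    Runs (.seq c d) s k Q ↔ Runs c s k fun s' k' => Runs d s' k' Q := by
  constructor
  · rintro ⟨t, s', he, ht, hQ⟩
    cases he with
    | seq h₁ h₂ => exact ⟨_, _, h₁, by omega, _, _, h₂, by omega, by rwa [Nat.sub_sub]⟩
  · rintro ⟨t, s', he, ht, t', s'', he', ht', hQ⟩
    exact ⟨_, _, .seq he he', by omega, by rwa [← Nat.sub_sub]⟩

@[simp] theorem runs_cond {b : Test} {c d : Prog} {s : State} {k : ℕ} {Q : State → ℕ → Prop} :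
    Runs (.cond b c d) s k Q ↔ b.cost + 1 ≤ k ∧ (b.Holds s → Runs c s (k - (b.cost + 1)) Q) ∧
      (¬ b.Holds s → Runs d s (k - (b.cost + 1)) Q) := by
  constructor
  · rintro ⟨t, s', he, ht, hQ⟩
    cases he with
    | condTrue hb h =>
      exact ⟨by omega, fun _ => ⟨_, _, h, by omega, by rwa [Nat.sub_sub]⟩, fun hb' => absurd hb hb'⟩
    | condFalse hb h =>
      exact ⟨by omega, fun hb' => absurd hb' hb, fun _ => ⟨_, _, h, by omega, by rwa [Nat.sub_sub]⟩⟩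
  · rintro ⟨hk, h₁, h₂⟩
    by_cases hb : b.Holds s
    · obtain ⟨t, s', he, ht, hQ⟩ := h₁ hb
      exact ⟨_, _, .condTrue hb he, by omega, by rwa [← Nat.sub_sub]⟩
    · obtain ⟨t, s', he, ht, hQ⟩ := h₂ hb
      exact ⟨_, _, .condFalse hb he, by omega, by rwa [← Nat.sub_sub]⟩

@[simp] theorem runs_block_nil {s : State} {k : ℕ} {Q : State → ℕ → Prop} :
    Runs (block []) s k Q ↔ 1 ≤ k ∧ Q s (k - 1) := runs_skip

@[simp] theorem runs_block_cons {c : Prog} {cs : List Prog} {s : State} {k : ℕ}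
    {Q : State → ℕ → Prop} :
    Runs (block (c :: cs)) s k Q ↔ Runs c s k fun s' k' => Runs (block cs) s' k' Q := runs_seq

/-- Loops: an invariant that mentions the remaining credits. Termination comes for free, as each
iteration uses up at least one credit. -/
theorem Runs.loop {b : Test} {c : Prog} {Q : State → ℕ → Prop} {s₀ : State} {k₀ : ℕ}
    (I : State → ℕ → Prop) (h₀ : I s₀ k₀)
    (step : ∀ s k, Frame (.loop b c) s₀ s → I s k → b.Holds s →
      b.cost + 1 ≤ k ∧ Runs c s (k - (b.cost + 1)) I)
    (done : ∀ s k, Frame (.loop b c) s₀ s → I s k → ¬ b.Holds s →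
      b.cost + 1 ≤ k ∧ Q s (k - (b.cost + 1))) :
    Runs (.loop b c) s₀ k₀ Q := by
  suffices H : ∀ k s, Frame (.loop b c) s₀ s → I s k → Runs (.loop b c) s k Q from
    H k₀ s₀ (.refl _ _) h₀
  intro k
  induction k using Nat.strong_induction_on with
  | _ k ih =>
    intro s hf hI
    by_cases hb : b.Holds s
    · obtain ⟨hk, t, s', he, ht, hI'⟩ := step s k hf hI hb
      have hf' : Frame (.loop b c) s₀ s' :=
        hf.trans (he.frame.mono (fun _ h => h) (fun _ h => h) (fun h => h))
      obtain ⟨t', s'', he', ht', hQ⟩ := ih _ (by omega) s' hf' hI'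
      refine ⟨_, _, .loopTrue hb he he', by omega, ?_⟩
      rwa [← Nat.sub_sub, ← Nat.sub_sub]
    · obtain ⟨hk, hQ⟩ := done s k hf hI hb
      exact ⟨_, _, .loopFalse hb, hk, hQ⟩

/-! Symbolic execution -/

@[simp] theorem nat_setNat_self (s : State) (a i v : ℕ) :
    (s.setNat a i v).nat a = Function.update (s.nat a) i v := by
  simp [State.setNat]

@[simp] theorem nat_setNat_of_ne (s : State) {a b : ℕ} (i v : ℕ) (h : b ≠ a) :
    (s.setNat a i v).nat b = s.nat b := by
  simp [State.setNat, h]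

@[simp] theorem real_setNat (s : State) (a i v : ℕ) : (s.setNat a i v).real = s.real := rfl

@[simp] theorem out_setNat (s : State) (a i v : ℕ) : (s.setNat a i v).out = s.out := rfl

@[simp] theorem real_setReal_self (s : State) (a i : ℕ) (v : ℝ) :
    (s.setReal a i v).real a = Function.update (s.real a) i v := by
  simp [State.setReal]

@[simp] theorem real_setReal_of_ne (s : State) {a b : ℕ} (i : ℕ) (v : ℝ) (h : b ≠ a) :
    (s.setReal a i v).real b = s.real b := by
  simp [State.setReal, h]

@[simp] theorem nat_setReal (s : State) (a i : ℕ) (v : ℝ) : (s.setReal a i v).nat = s.nat := rfl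

@[simp] theorem nat_write (s : State) (v : ℕ) : (s.write v).nat = s.nat := rfl

@[simp] theorem out_write (s : State) (v : ℕ) : (s.write v).out = s.out ++ [v] := rfl

attribute [simp] NatExpr.eval NatExpr.cost RealExpr.eval RealExpr.cost Test.Holds Test.cost

@[simp] theorem nvar_eval (a : ℕ) (s : State) : (nvar a).eval s = s.nat a 0 := rfl

@[simp] theorem nvar_cost (a : ℕ) : (nvar a).cost = 2 := rfl

@[simp] theorem runs_set {a : ℕ} {e : NatExpr} {s : State} {k : ℕ} {Q : State → ℕ → Prop} :
    Runs (set a e) s k Q ↔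
      e.cost + 2 ≤ k ∧ Q (s.setNat a 0 (e.eval s)) (k - (e.cost + 2)) := by
  simp [set, show 1 + e.cost + 1 = e.cost + 2 by omega]

@[simp] theorem runs_incr {a : ℕ} {s : State} {k : ℕ} {Q : State → ℕ → Prop} :
    Runs (incr a) s k Q ↔ 6 ≤ k ∧ Q (s.setNat a 0 (s.nat a 0 + 1)) (k - 6) := by
  simp [incr]

@[simp] theorem ltTest_holds (e f : NatExpr) (s : State) :
    (ltTest e f).Holds s ↔ e.eval s < f.eval s := Iff.rfl

@[simp] theorem ltTest_cost (e f : NatExpr) : (ltTest e f).cost = e.cost + f.cost + 3 := by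
  simp [ltTest]; omega

@[simp] theorem orTest_holds (b c : Test) (s : State) :
    (orTest b c).Holds s ↔ b.Holds s ∨ c.Holds s := by
  simp [orTest]; tauto

@[simp] theorem orTest_cost (b c : Test) : (orTest b c).cost = b.cost + c.cost + 4 := by
  simp [orTest]; omega

/-! ### Segments of arrays -/

/-- The `len` entries of the array `f` that start at position `lo`. -/
def seg (f : ℕ → ℕ) (lo len : ℕ) : List ℕ := (List.range' lo len).map f

@[simp] theorem length_seg (f : ℕ → ℕ) (lo len : ℕ) : (seg f lo len).length = len := by
  simp [seg]

@[simp] theorem seg_zero (f : ℕ → ℕ) (lo : ℕ) : seg f lo 0 = [] := rfl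

theorem seg_succ (f : ℕ → ℕ) (lo len : ℕ) : seg f lo (len + 1) = seg f lo len ++ [f (lo + len)] := by
  simp [seg, List.range'_concat]

theorem seg_succ' (f : ℕ → ℕ) (lo len : ℕ) : seg f lo (len + 1) = f lo :: seg f (lo + 1) len := by
  simp [seg, List.range'_succ]

theorem seg_add (f : ℕ → ℕ) (lo m n : ℕ) : seg f lo (m + n) = seg f lo m ++ seg f (lo + m) n := by
  simp [seg, ← List.map_append]

theorem seg_congr {f g : ℕ → ℕ} {lo len : ℕ} (h : ∀ i, lo ≤ i → i < lo + len → f i = g i) :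
    seg f lo len = seg g lo len := by
  refine List.map_congr_left fun i hi => ?_
  simp only [List.mem_range'_1] at hi
  exact h i hi.1 hi.2

@[simp] theorem seg_update_of_le {f : ℕ → ℕ} {lo len i v : ℕ} (h : lo + len ≤ i) :
    seg (Function.update f i v) lo len = seg f lo len :=
  seg_congr fun j _ _ => Function.update_of_ne (by omega) _ _

@[simp] theorem seg_update_of_lt {f : ℕ → ℕ} {lo len i v : ℕ} (h : i < lo) :
    seg (Function.update f i v) lo len = seg f lo len :=
  seg_congr fun j _ _ => Function.update_of_ne (by omega) _ _

theorem mem_seg {f : ℕ → ℕ} {lo len v : ℕ} :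
    v ∈ seg f lo len ↔ ∃ i, lo ≤ i ∧ i < lo + len ∧ f i = v := by
  simp [seg, and_assoc]

theorem getElem_seg {f : ℕ → ℕ} {lo len i : ℕ} (h : i < (seg f lo len).length) :
    (seg f lo len)[i] = f (lo + i) := by
  simp [seg]

end RealRAM

/-! ### Adaptive merge sort: the combinatorics -/

namespace RealRAM

section AdaptiveSort

variable {α K : Type*} [LinearOrder K] (κ : α → K)

/-- The elements of a list whose key is at least that of their predecessor. -/
def ups (a : α) : List α → List α
  | [] => []
  | x :: l => if κ a ≤ κ x then x :: ups x l else ups x l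

/-- The elements of a list whose key is less than that of their predecessor. -/
def downs (a : α) : List α → List α
  | [] => []
  | x :: l => if κ a ≤ κ x then downs x l else x :: downs x l

/-- The number of descents of a list. -/
def descents : List α → ℕ
  | a :: b :: l => (if κ a ≤ κ b then 0 else 1) + descents (b :: l)
  | _ => 0

theorem ups_append (a : α) (l l' : List α) :
    ups κ a (l ++ l') = ups κ a l ++ ups κ ((a :: l).getLast (by simp)) l' := by
  induction l generalizing a with
  | nil => simp [ups]
  | cons x l ih =>
    simp only [List.cons_append, ups, ih]
    split <;> simp

theorem downs_append (a : α) (l l' : List α) :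
    downs κ a (l ++ l') = downs κ a l ++ downs κ ((a :: l).getLast (by simp)) l' := by
  induction l generalizing a with
  | nil => simp [downs]
  | cons x l ih =>
    simp only [List.cons_append, downs, ih]
    split <;> simp

theorem ups_append_downs_perm (a : α) (l : List α) : (ups κ a l ++ downs κ a l).Perm l := by
  induction l generalizing a with
  | nil => simp [ups, downs]
  | cons x l ih =>
    simp only [ups, downs]
    split
    · simpa using ih x
    · exact List.perm_middle.trans ((ih x).cons x)

theorem length_ups_add_length_downs (a : α) (l : List α) :
    (ups κ a l).length + (downs κ a l).length = l.length := by
  rw [← List.length_append, (ups_append_downs_perm κ a l).length_eq]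

/-- A rearrangement in which decreasing runs are turned into increasing ones. -/
def rearrange (a : α) (l : List α) : List α := ups κ a l ++ (downs κ a l).reverse

theorem rearrange_perm (a : α) (l : List α) : (rearrange κ a l).Perm l :=
  (List.Perm.append_left _ (List.reverse_perm _)).trans (ups_append_downs_perm κ a l)

@[simp] theorem descents_nil : descents κ [] = 0 := rfl

@[simp] theorem descents_singleton (a : α) : descents κ [a] = 0 := rfl

theorem descents_cons_le (a : α) (l : List α) : descents κ (a :: l) ≤ descents κ l + 1 := by
  cases l with
  | nil => simp
  | cons b l => simp only [descents]; split <;> omega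

theorem descents_append_le (l l' : List α) :
    descents κ (l ++ l') ≤ descents κ l + descents κ l' + 1 := by
  induction l with
  | nil => simp
  | cons a l ih =>
    cases l with
    | nil => simpa using (descents_cons_le κ a l')
    | cons b l =>
      simp only [List.cons_append, descents] at ih ⊢
      omega

theorem descents_concat (l : List α) (a b : α) :
    descents κ (l ++ [a] ++ [b]) = descents κ (l ++ [a]) + if κ a ≤ κ b then 0 else 1 := by
  induction l with
  | nil => simp [descents]
  | cons c l ih =>
    cases l with
    | nil => simp [descents]
    | cons d l =>
      simp only [List.cons_append, descents] at ih ⊢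
      omega

theorem descents_le_length (l : List α) : descents κ l ≤ l.length := by
  induction l with
  | nil => simp
  | cons a l ih => exact (descents_cons_le κ a l).trans (by simpa using ih)

theorem descents_eq_zero {l : List α} (h : l.Pairwise fun a b => κ a ≤ κ b) :
    descents κ l = 0 := by
  induction l with
  | nil => rfl
  | cons a l ih =>
    cases l with
    | nil => rfl
    | cons b l =>
      rw [List.pairwise_cons] at h
      simp [descents, h.1 b (by simp), ih h.2]

/-- The two-way merge of lists. -/
def mergeBy : List α → List α → List α
  | [], l' => l'
  | a :: l, [] => a :: l
  | a :: l, b :: l' =>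
    if κ a ≤ κ b then a :: mergeBy l (b :: l') else b :: mergeBy (a :: l) l'
termination_by l l' => l.length + l'.length

theorem mergeBy_perm (l l' : List α) : (mergeBy κ l l').Perm (l ++ l') := by
  fun_induction mergeBy κ l l' with
  | case1 l' => simp
  | case2 a l => simp
  | case3 a l b l' h ih => simpa using ih
  | case4 a l b l' h ih => exact (ih.cons b).trans List.perm_middle.symm

theorem length_mergeBy (l l' : List α) : (mergeBy κ l l').length = l.length + l'.length := by
  rw [(mergeBy_perm κ l l').length_eq, List.length_append]

theorem mergeBy_sorted {l l' : List α} (h : l.Pairwise fun a b => κ a ≤ κ b)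
    (h' : l'.Pairwise fun a b => κ a ≤ κ b) :
    (mergeBy κ l l').Pairwise fun a b => κ a ≤ κ b := by
  fun_induction mergeBy κ l l' with
  | case1 l' => exact h'
  | case2 a l => exact h
  | case3 a l b l' hab ih =>
    rw [List.pairwise_cons] at h
    refine List.pairwise_cons.2 ⟨fun c hc => ?_, ih h.2 h'⟩
    rw [(mergeBy_perm κ _ _).mem_iff, List.mem_append] at hc
    rcases hc with hc | hc
    · exact h.1 c hc
    · rcases List.mem_cons.1 hc with rfl | hc
      · exact hab
      · exact hab.trans ((List.pairwise_cons.1 h').1 c hc)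
  | case4 a l b l' hab ih =>
    rw [List.pairwise_cons] at h'
    refine List.pairwise_cons.2 ⟨fun c hc => ?_, ih h h'.2⟩
    rw [(mergeBy_perm κ _ _).mem_iff, List.mem_append] at hc
    have hba := (not_le.1 hab).le
    rcases hc with hc | hc
    · rcases List.mem_cons.1 hc with rfl | hc
      · exact hba
      · exact hba.trans ((List.pairwise_cons.1 h).1 c hc)
    · exact h'.1 c hc

theorem mergeBy_nil_right (l : List α) : mergeBy κ l [] = l := by
  cases l <;> simp [mergeBy]

end AdaptiveSort

/-! The cost of merging a queue of runs of given lengths -/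

/-- The cost of repeatedly replacing the two runs at the head of a queue by their merge at the
tail. -/
def queueCost : List ℕ → ℕ
  | a :: b :: l => a + b + 1 + queueCost (l ++ [a + b])
  | _ => 0
termination_by l => l.length

/-- One pass of balanced merging: the `2 * j` runs at the head are merged in pairs and reappear as
`j` runs at the tail. Each entry is paid for once, and each merge costs one unit more. -/
theorem exists_queueCost_pass (j : ℕ) : ∀ xs ys : List ℕ, xs.length = 2 * j →
    ∃ zs : List ℕ, zs.length = j ∧ zs.sum = xs.sum ∧
      queueCost (xs ++ ys) = xs.sum + j + queueCost (ys ++ zs) := by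
  induction j with
  | zero =>
    intro xs ys h
    obtain rfl : xs = [] := List.length_eq_zero_iff.1 (by omega)
    exact ⟨[], by simp⟩
  | succ j ih =>
    intro xs ys h
    match xs, h with
    | a :: b :: xs, h =>
      obtain ⟨zs, h₁, h₂, h₃⟩ := ih xs (ys ++ [a + b]) (by simp at h; omega)
      refine ⟨(a + b) :: zs, by simp [h₁], by simp [h₂]; omega, ?_⟩
      rw [List.cons_append, List.cons_append, queueCost, List.append_assoc, h₃]
      simp
      omega

/-- A pass halves the number of runs, up to rounding, and costs at most the total length plus the
number of runs. The number of passes is the binary logarithm, rounded up. -/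
theorem queueCost_le (l : List ℕ) : queueCost l ≤ (l.sum + l.length) * Nat.clog 2 l.length := by
  induction hn : l.length using Nat.strong_induction_on generalizing l with
  | _ n ih =>
    rcases lt_or_ge n 2 with h | h
    · match l, hn with
      | [], _ => simp [queueCost]
      | [a], _ => simp [queueCost]
      | a :: b :: l, hn => simp at hn; omega
    -- If the number of runs is odd, the last one sits out this pass and heads the next queue, which
    -- has `(n + 1) / 2` runs.
    · obtain ⟨zs, h₁, h₂, h₃⟩ := exists_queueCost_pass (n / 2) (l.take (2 * (n / 2)))
        (l.drop (2 * (n / 2))) (by simp; omega)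
      rw [List.take_append_drop] at h₃
      have hsum : (l.take (2 * (n / 2))).sum + (l.drop (2 * (n / 2))).sum = l.sum := by
        rw [← List.sum_append, List.take_append_drop]
      have hlen : (l.drop (2 * (n / 2)) ++ zs).length = (n + 1) / 2 := by
        simp [h₁]; omega
      have := ih ((n + 1) / 2) (by omega) _ hlen
      rw [List.sum_append, h₂, add_comm (l.drop _).sum, hsum] at this
      rw [h₃, Nat.clog_of_two_le (by norm_num) h, show n + 2 - 1 = n + 1 by omega, mul_add, mul_one]
      have hmono : (l.sum + (n + 1) / 2) * Nat.clog 2 ((n + 1) / 2) ≤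
          (l.sum + n) * Nat.clog 2 ((n + 1) / 2) := Nat.mul_le_mul_right _ (by omega)
      omega

end RealRAM

/-! ### Adaptive merge sort: the program -/

namespace RealRAM

/-- The key of `u`: the pair of the `u`-th entries of the real arrays `2` and `3`, ordered
lexicographically. -/
noncomputable def key (r : ℕ → ℕ → ℝ) (u : ℕ) : ℝ ×ₗ ℝ := toLex (r 2 u, r 3 u)

/-- The comparison of the keys of two integers. -/
def keyLe (u v : NatExpr) : Test :=
  .and (.realLe (.load 2 u) (.load 2 v))
    (.neg (.and (.realLe (.load 2 v) (.load 2 u)) (.neg (.realLe (.load 3 u) (.load 3 v)))))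

@[simp] theorem keyLe_holds (u v : NatExpr) (s : State) :
    (keyLe u v).Holds s ↔ key s.real (u.eval s) ≤ key s.real (v.eval s) := by
  simp only [keyLe, Test.Holds, RealExpr.eval, key, Prod.Lex.toLex_le_toLex]
  constructor
  · rintro ⟨h₁, h₂⟩
    rcases h₁.lt_or_eq with h | h
    · exact Or.inl h
    · exact Or.inr ⟨h, not_not.1 fun h' => h₂ ⟨h.ge, h'⟩⟩
  · rintro (h | ⟨h, h'⟩)
    · exact ⟨h.le, fun h' => absurd h'.1 (not_le.2 h)⟩
    · exact ⟨h.le, fun h'' => h''.2 h'⟩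

@[simp] theorem keyLe_cost (u v : NatExpr) :
    (keyLe u v).cost = 3 * u.cost + 3 * v.cost + 13 := by
  simp [keyLe]; omega

/-- Rearranges the sequence in array `2`, of length given by variable `1`, into array `3`. -/
def splitProg : Prog :=
  block [set 7 (.lit 0), set 8 (.lit 0), set 9 (nvar 1),
    .loop (ltTest (nvar 7) (nvar 1)) (block [
      .cond (keyLe (.load 2 (.sub (nvar 7) (.lit 1))) (.load 2 (nvar 7)))
        (block [.natStore 3 (nvar 8) (.load 2 (nvar 7)), incr 8])
        (block [set 9 (.sub (nvar 9) (.lit 1)), .natStore 3 (nvar 9) (.load 2 (nvar 7))]),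
      incr 7])]

/-- Truncated subtraction makes the entry at position `0` its own predecessor. This is why `ups` and
`downs` are started with `f 0` in the analysis of `splitProg`, and the first entry counts as rising.
-/
theorem getLast_cons_seg (f : ℕ → ℕ) (i : ℕ) :
    (f 0 :: seg f 0 i).getLast (by simp) = f (i - 1) := by
  cases i with
  | zero => simp
  | succ i => simp [seg_succ]

theorem splitProg_runs (s : State) (k : ℕ) (hk : 100 * (s.nat 1 0 + 1) ≤ k) :
    Runs splitProg s k fun s' k' =>
      seg (s'.nat 3) 0 (s.nat 1 0) =
        rearrange (key s.real) (s.nat 2 0) (seg (s.nat 2) 0 (s.nat 1 0)) ∧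
      k ≤ k' + 100 * (s.nat 1 0 + 1) := by
  simp only [splitProg, runs_block_cons, runs_set, NatExpr.cost, NatExpr.eval, nvar_cost]
  refine ⟨by omega, by omega, by omega, ?_⟩
  set f := s.nat 2
  set N := s.nat 1 0
  set κ := key s.real
  -- Rising entries fill array `3` from the left, falling ones from the right end towards the left.
  -- The latter thus appear in reversed order, and the two parts meet exactly when all entries are
  -- placed.
  refine Runs.loop (fun s' k' => ∃ i, s'.nat 7 0 = i ∧ i ≤ N ∧
    s'.nat 8 0 = (ups κ (f 0) (seg f 0 i)).length ∧
    s'.nat 9 0 + (downs κ (f 0) (seg f 0 i)).length = N ∧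
    seg (s'.nat 3) 0 (ups κ (f 0) (seg f 0 i)).length = ups κ (f 0) (seg f 0 i) ∧
    seg (s'.nat 3) (s'.nat 9 0) (downs κ (f 0) (seg f 0 i)).length =
      (downs κ (f 0) (seg f 0 i)).reverse ∧
    k ≤ k' + 100 * i + 20) ⟨0, ?_⟩ ?_ ?_
  · simp [ups, downs, N]
    omega
  · rintro s' k' hf ⟨i, hi, hiN, hu, hd, hsu, hsd, hk'⟩ hb
    have h2 : s'.nat 2 = f := by simpa using hf.nat 2 (by decide)
    have h1 : s'.nat 1 0 = N := by simpa using congrFun (hf.nat 1 (by decide)) 0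
    have hr : s'.real = s.real := by
      funext a; simpa using hf.real a (by simp [Prog.realVars, block, incr, set])
    have hlen := length_ups_add_length_downs κ (f 0) (seg f 0 i)
    simp only [length_seg] at hlen
    simp [h1, hi] at hb
    have hU : ups κ (f 0) (seg f 0 (i + 1)) = ups κ (f 0) (seg f 0 i) ++
        if κ (f (i - 1)) ≤ κ (f i) then [f i] else [] := by
      rw [seg_succ, ups_append, getLast_cons_seg]
      simp [ups]
    have hD : downs κ (f 0) (seg f 0 (i + 1)) = downs κ (f 0) (seg f 0 i) ++
        if κ (f (i - 1)) ≤ κ (f i) then [] else [f i] := by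
      rw [seg_succ, downs_append, getLast_cons_seg]
      simp [downs]
    simp [hi, h2, hr]
    refine ⟨by omega, by omega, fun hle => ?_, fun hle => ?_⟩
    · rw [if_pos hle] at hU hD
      rw [List.append_nil] at hD
      rw [hU, hD, hu]
      and_intros <;> try omega
      · simp
      · simp [seg_succ, hsu]
      · rw [seg_update_of_lt (by omega), hsd]
    · rw [if_neg (not_le.2 hle)] at hU hD
      rw [List.append_nil] at hU
      rw [hU, hD]
      and_intros <;> try omega
      · simp; omega
      · rw [seg_update_of_le (by omega), hsu]
      · rw [List.length_append, List.length_singleton, seg_succ', Function.update_self,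
          seg_update_of_lt (by omega), Nat.sub_add_cancel (by omega), hsd]
        simp
  · rintro s' k' hf ⟨i, hi, hiN, hu, hd, hsu, hsd, hk'⟩ hb
    have h1 : s'.nat 1 0 = N := by simpa using congrFun (hf.nat 1 (by decide)) 0
    simp [h1, hi] at hb ⊢
    have hlen := length_ups_add_length_downs κ (f 0) (seg f 0 i)
    simp only [length_seg] at hlen
    refine ⟨by omega, by omega, ?_, by omega⟩
    rw [show N = i by omega, rearrange, ← hsu, ← hsd, ← hu,
      show s'.nat 9 0 = 0 + s'.nat 8 0 by omega, ← seg_add,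
      show s'.nat 8 0 + (downs κ (f 0) (seg f 0 i)).length = i by omega]

end RealRAM

/-! ### Cutting a sequence into a queue of increasing runs. -/

namespace RealRAM

/-- The runs `R` are stored consecutively in `Q`, with boundaries `B h, B (h + 1), …`. -/
def QRep (B Q : ℕ → ℕ) : ℕ → List (List ℕ) → Prop
  | _, [] => True
  | h, r :: R => B (h + 1) = B h + r.length ∧ seg Q (B h) r.length = r ∧ QRep B Q (h + 1) R

theorem QRep.end_eq {B Q : ℕ → ℕ} {h : ℕ} {R : List (List ℕ)} (H : QRep B Q h R) :
    B (h + R.length) = B h + R.flatten.length := by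
  induction R generalizing h with
  | nil => simp
  | cons r R ih =>
    have := ih H.2.2
    rw [List.length_cons, ← add_assoc, add_right_comm, this, H.1]
    simp [add_assoc]

theorem qRep_concat {B Q : ℕ → ℕ} {h : ℕ} {R : List (List ℕ)} {r : List ℕ} :
    QRep B Q h (R ++ [r]) ↔ QRep B Q h R ∧ B (h + R.length + 1) = B (h + R.length) + r.length ∧
      seg Q (B (h + R.length)) r.length = r := by
  induction R generalizing h with
  | nil => simp [QRep]
  | cons r' R ih =>
    simp only [List.cons_append, QRep, ih, List.length_cons, and_assoc]
    rw [show h + 1 + R.length = h + (R.length + 1) by omega]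

/-- Writing behind the end of the queue does not disturb it. -/
theorem QRep.congr {B Q B' Q' : ℕ → ℕ} {h : ℕ} {R : List (List ℕ)} (H : QRep B Q h R)
    (hB : ∀ i, i ≤ h + R.length → B' i = B i) (hQ : ∀ i, i < B (h + R.length) → Q' i = Q i) :
    QRep B' Q' h R := by
  induction R generalizing h with
  | nil => trivial
  | cons r R ih =>
    have hend := H.2.2.end_eq
    rw [List.length_cons, show h + (R.length + 1) = h + 1 + R.length by omega] at hB hQ
    refine ⟨?_, ?_, ih H.2.2 hB hQ⟩
    · rw [hB _ (by omega), hB _ (by omega), H.1]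
    · rw [hB _ (by omega)]
      refine Eq.trans (seg_congr fun i _ hi => hQ i ?_) H.2.1
      have := H.1
      omega

/-- Cuts the sequence in array `3` into increasing runs, with boundaries in array `4`. -/
def boundsProg : Prog :=
  block [.natStore 4 (.lit 0) (.lit 0), set 5 (.lit 0), set 6 (.lit 0), set 7 (.lit 0),
    .loop (ltTest (nvar 7) (nvar 1)) (block [
      .cond (.and (ltTest (.lit 0) (nvar 7))
          (keyLe (.load 3 (.sub (nvar 7) (.lit 1))) (.load 3 (nvar 7))))
        .skip (incr 6),
      incr 7, .natStore 4 (nvar 6) (nvar 7)])]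

theorem boundsProg_runs (s : State) (k : ℕ) (hk : 100 * (s.nat 1 0 + 1) ≤ k) :
    Runs boundsProg s k fun s' k' => ∃ R : List (List ℕ),
      QRep (s'.nat 4) (s'.nat 3) 0 R ∧ R.flatten = seg (s.nat 3) 0 (s.nat 1 0) ∧
      (∀ r ∈ R, r.Pairwise fun a b => key s.real a ≤ key s.real b) ∧
      R.length ≤ descents (key s.real) (seg (s.nat 3) 0 (s.nat 1 0)) + 1 ∧
      s'.nat 5 0 = 0 ∧ s'.nat 6 0 = R.length ∧ s'.nat 4 0 = 0 ∧ k ≤ k' + 100 * (s.nat 1 0 + 1) := by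
  simp only [boundsProg, runs_block_cons, runs_set, NatExpr.cost, NatExpr.eval, runs_natStore]
  refine ⟨by omega, by omega, by omega, by omega, ?_⟩
  set Q := s.nat 3
  set N := s.nat 1 0
  set κ := key s.real
  -- Nonempty runs guarantee that the entry before the current one is the last entry of the last
  -- run, so a single comparison decides whether that run can be extended.
  refine Runs.loop (fun s' k' => s'.nat 7 0 ≤ N ∧ k ≤ k' + 100 * s'.nat 7 0 + 20 ∧
    s'.nat 5 0 = 0 ∧ ∃ R : List (List ℕ), s'.nat 6 0 = R.length ∧ QRep (s'.nat 4) Q 0 R ∧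
      R.flatten = seg Q 0 (s'.nat 7 0) ∧ (∀ r ∈ R, r.Pairwise fun a b => κ a ≤ κ b) ∧
      R.length ≤ descents κ (seg Q 0 (s'.nat 7 0)) + 1 ∧ (s'.nat 7 0 = 0 → R = []) ∧
      s'.nat 4 0 = 0 ∧ ∀ r ∈ R, r ≠ []) ?_ ?_ ?_
  · simp [QRep]
    omega
  · rintro s' k' hf ⟨hiN, hk', h5, R, h6, hR, hfl, hsort, hlen, hz, h40, hne⟩ hb
    have h3 : s'.nat 3 = Q := by simpa using hf.nat 3 (by decide)
    have h1 : s'.nat 1 0 = N := by simpa using congrFun (hf.nat 1 (by decide)) 0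
    have hr : s'.real = s.real := by
      funext a; simpa using hf.real a (by simp [Prog.realVars, block, incr, set])
    generalize hi : s'.nat 7 0 = i at *
    simp [h1, hi] at hb
    have hend := hR.end_eq
    rw [hfl, length_seg, h40, Nat.zero_add, Nat.zero_add] at hend
    simp [hi, h3, hr, h5, h6, h40]
    refine ⟨by omega, by omega, fun hi0 hle => ?_, fun hlt => ?_⟩
    -- No descent: the last run grows by one entry, and only its end boundary is overwritten.
    · obtain ⟨i, rfl⟩ := Nat.exists_eq_succ_of_ne_zero hi0.ne'
      obtain ⟨R, O, rfl⟩ : ∃ R' O, R = R' ++ [O] := by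
        rcases List.eq_nil_or_concat R with rfl | ⟨R', O, rfl⟩
        · simp [seg_succ] at hfl
        · exact ⟨R', O, by simp⟩
      obtain ⟨O, y, rfl⟩ : ∃ O' y, O = O' ++ [y] := by
        rcases List.eq_nil_or_concat O with rfl | ⟨R', O, rfl⟩
        · exact absurd rfl (hne [] (by simp))
        · exact ⟨R', O, by simp⟩
      have hy : y = Q i := by
        rw [seg_succ, List.flatten_append, List.flatten_singleton, ← List.append_assoc] at hfl
        simpa using (List.append_inj' hfl rfl).2
      and_intros <;> try omega
      refine ⟨R ++ [O ++ [y] ++ [Q (i + 1)]], ?_⟩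
      rw [qRep_concat] at hR ⊢
      have hBR := hR.1.end_eq
      have hB1 := hR.2.1
      have hB2 := hR.2.2
      simp only [h40, Nat.zero_add, List.length_append, List.length_singleton] at hBR hend hB1 hB2
      and_intros
      · simp
      · refine hR.1.congr (fun j hj => Function.update_of_ne ?_ _ _) fun _ _ => rfl
        simp; omega
      · simp
        omega
      · simp [Function.update_of_ne]
        rw [show O.length + 1 + 1 = (O.length + 1) + 1 by rfl, seg_succ, hB2,
          show s'.nat 4 R.length + (O.length + 1) = i + 1 by omega]
        simp
      · rw [seg_succ, ← hfl]
        simp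
      · intro r hr
        rcases List.mem_append.1 hr with hr | hr
        · exact hsort r (by simp [hr])
        · obtain rfl := List.mem_singleton.1 hr
          have hO := hsort (O ++ [y]) (by simp)
          refine List.pairwise_append.2 ⟨hO, by simp, fun a ha b hb => ?_⟩
          obtain rfl := List.mem_singleton.1 hb
          rcases List.mem_append.1 ha with ha | ha
          · refine le_trans ((List.pairwise_append.1 hO).2.2 a ha y (by simp)) ?_
            rw [hy]
            exact hle
          · obtain rfl := List.mem_singleton.1 ha
            rw [hy]
            exact hle
      · rw [seg_succ, seg_succ, Nat.zero_add, Nat.zero_add, descents_concat]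
        simp [seg_succ] at hlen ⊢
        omega
      · simpa using h40
      · intro r hr
        rcases List.mem_append.1 hr with hr | hr
        · exact hne r (by simp [hr])
        · simp_all
    -- A descent, or the very first entry: a new run is opened. The first entry is covered by the `+
    -- 1` in the bound on the number of runs.
    · and_intros <;> try omega
      refine ⟨R ++ [[Q i]], ?_⟩
      rw [qRep_concat]
      and_intros
      · simp
      · exact hR.congr (fun j hj => Function.update_of_ne (by omega) _ _) fun _ _ => rfl
      · simp [hend]
      · simp [seg_succ, hend]
      · simp [seg_succ, hfl]
      · intro r hr
        rcases List.mem_append.1 hr with hr | hr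
        · exact hsort r hr
        · obtain rfl := List.mem_singleton.1 hr
          simp
      · cases i with
        | zero => simp [hz rfl, seg_succ]
        | succ i =>
          rw [seg_succ, seg_succ, Nat.zero_add, Nat.zero_add, descents_concat, if_neg]
          · simp [seg_succ] at hlen ⊢
            omega
          · simpa using hlt
      · intro r hr
        rcases List.mem_append.1 hr with hr | hr
        · exact hne r hr
        · simp_all
  · rintro s' k' hf ⟨hiN, hk', h5, R, h6, hR, hfl, hsort, hlen, hz, h40, hne⟩ hb
    have h3 : s'.nat 3 = Q := by simpa using hf.nat 3 (by decide)
    have h1 : s'.nat 1 0 = N := by simpa using congrFun (hf.nat 1 (by decide)) 0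
    simp [h1] at hb ⊢
    have hi : s'.nat 7 0 = N := by omega
    rw [hi] at hfl hlen
    exact ⟨by omega, by omega, R, h3 ▸ hR, hfl, hsort, hlen, h5, h6, h40, by omega⟩

end RealRAM

/-! ### Merging the queue of runs and the complete sorting program. -/

namespace RealRAM

/-- Merges the increasing runs of array `3` at positions from variable `7` to variable `10` and from
variable `8` to variable `11`; the result is stored from the position in variable `9` on. -/
def mergeProg : Prog :=
  .loop (orTest (ltTest (nvar 7) (nvar 10)) (ltTest (nvar 8) (nvar 11))) (block [
    .cond (.and (ltTest (nvar 7) (nvar 10)) (orTest (.neg (ltTest (nvar 8) (nvar 11)))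
        (keyLe (.load 3 (nvar 7)) (.load 3 (nvar 8)))))
      (block [.natStore 3 (nvar 9) (.load 3 (nvar 7)), incr 7])
      (block [.natStore 3 (nvar 9) (.load 3 (nvar 8)), incr 8]),
    incr 9])

/-- The result goes to fresh cells from `e` on, beyond both input runs, so nothing that is still to
be read is overwritten. Space is not bounded, and array `3` may grow during all merges. -/
theorem mergeProg_runs (s : State) (k : ℕ) {a b : List ℕ} {e : ℕ}
    (ha : seg (s.nat 3) (s.nat 7 0) a.length = a) (ha' : s.nat 7 0 + a.length = s.nat 10 0)
    (hb : seg (s.nat 3) (s.nat 8 0) b.length = b) (hb' : s.nat 8 0 + b.length = s.nat 11 0)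
    (h₁ : s.nat 10 0 ≤ e) (h₂ : s.nat 11 0 ≤ e) (he : s.nat 9 0 = e)
    (hk : 100 * (a.length + b.length + 1) ≤ k) :
    Runs mergeProg s k fun s' k' =>
      seg (s'.nat 3) e (a.length + b.length) = mergeBy (key s.real) a b ∧
      (∀ i < e, s'.nat 3 i = s.nat 3 i) ∧ s'.nat 9 0 = e + (a.length + b.length) ∧
      k ≤ k' + 100 * (a.length + b.length + 1) := by
  set κ := key s.real
  -- Here `d` is the part already written, and `a'`, `b'` are the unread rests; prefixing `d` to
  -- their merge always gives the full merge.
  refine Runs.loop (fun s' k' => ∃ a' b' d : List ℕ,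
    seg (s'.nat 3) (s'.nat 7 0) a'.length = a' ∧ s'.nat 7 0 + a'.length = s.nat 10 0 ∧
    seg (s'.nat 3) (s'.nat 8 0) b'.length = b' ∧ s'.nat 8 0 + b'.length = s.nat 11 0 ∧
    seg (s'.nat 3) e d.length = d ∧ s'.nat 9 0 = e + d.length ∧
    d ++ mergeBy κ a' b' = mergeBy κ a b ∧ (∀ i < e, s'.nat 3 i = s.nat 3 i) ∧
    k ≤ k' + 100 * d.length) ?_ ?_ ?_
  · exact ⟨a, b, [], ha, ha', hb, hb', rfl, by simp [he], rfl, fun _ _ => rfl, by simp⟩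
  · rintro s' k' hf ⟨a', b', d, ha, ha', hb, hb', hd, h9, hm, hQ, hk'⟩ hc
    have h10 : s'.nat 10 = s.nat 10 := hf.nat 10 (by decide)
    have h11 : s'.nat 11 = s.nat 11 := hf.nat 11 (by decide)
    have hr : s'.real = s.real := by
      funext a; exact hf.real a (by simp [Prog.realVars, block, incr, set])
    have hlen : d.length + (a'.length + b'.length) = a.length + b.length := by
      rw [← length_mergeBy κ a b, ← hm, List.length_append, length_mergeBy]
    simp [h10, h11] at hc
    simp [h10, h11, hr, h9]
    refine ⟨by omega, by omega, fun h7 hle => ?_, fun hgt => ?_⟩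
    · obtain ⟨x, a', rfl⟩ : ∃ x a'', a' = x :: a'' := by
        cases a' with
        | nil => simp at ha'; omega
        | cons x a' => exact ⟨x, a', rfl⟩
      simp only [List.length_cons] at ha ha' hlen
      rw [seg_succ', List.cons.injEq] at ha
      and_intros <;> try omega
      refine ⟨a', ?_, by omega, b', ?_, by omega, d ++ [x], ?_, by simp; omega, ?_, ?_, ?_⟩
      · rw [seg_update_of_le (by omega), ha.2]
      · rw [seg_update_of_le (by omega), hb]
      · rw [List.length_append, List.length_singleton, seg_succ, seg_update_of_le (by omega), hd,
          Function.update_self, ha.1]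
      · rw [← hm, List.append_assoc]
        congr 1
        cases b' with
        | nil => simp [mergeBy_nil_right]
        | cons y b' =>
          simp only [List.length_cons] at hb hb'
          rw [seg_succ', List.cons.injEq] at hb
          rw [mergeBy, if_pos]
          · rfl
          · rw [← ha.1, ← hb.1]
            exact hle.resolve_left (by omega)
      · intro i hi
        rw [Function.update_of_ne (by omega), hQ i hi]
      · simp; omega
    · obtain ⟨y, b', rfl⟩ : ∃ y b'', b' = y :: b'' := by
        cases b' with
        | nil =>
          simp at hb'
          have := (hgt (by omega)).1
          omega
        | cons x a' => exact ⟨x, a', rfl⟩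
      simp only [List.length_cons] at hb hb' hlen
      rw [seg_succ', List.cons.injEq] at hb
      and_intros <;> try omega
      refine ⟨a', ?_, by omega, b', ?_, by omega, d ++ [y], ?_, by simp; omega, ?_, ?_, ?_⟩
      · rw [seg_update_of_le (by omega), ha]
      · rw [seg_update_of_le (by omega), hb.2]
      · rw [List.length_append, List.length_singleton, seg_succ, seg_update_of_le (by omega), hd,
          Function.update_self, hb.1]
      · rw [← hm, List.append_assoc]
        congr 1
        cases a' with
        | nil => simp [mergeBy]
        | cons x a' =>
          simp only [List.length_cons] at ha ha'
          rw [seg_succ', List.cons.injEq] at ha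
          rw [mergeBy, if_neg]
          · rfl
          · rw [← ha.1, ← hb.1, not_le]
            exact (hgt (by omega)).2
      · intro i hi
        rw [Function.update_of_ne (by omega), hQ i hi]
      · simp; omega
  · rintro s' k' hf ⟨a', b', d, ha, ha', hb, hb', hd, h9, hm, hQ, hk'⟩ hc
    have h10 : s'.nat 10 = s.nat 10 := hf.nat 10 (by decide)
    have h11 : s'.nat 11 = s.nat 11 := hf.nat 11 (by decide)
    have hlen : d.length + (a'.length + b'.length) = a.length + b.length := by
      rw [← length_mergeBy κ a b, ← hm, List.length_append, length_mergeBy]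
    simp [h10, h11] at hc ⊢
    obtain rfl : a' = [] := List.length_eq_zero_iff.1 (by omega)
    obtain rfl : b' = [] := List.length_eq_zero_iff.1 (by omega)
    simp [mergeBy] at hm hlen
    rw [← hlen, ← hm]
    exact ⟨by omega, hd, hQ, h9, by omega⟩

/-- Merges the queue of runs from the number in variable `5` to that in variable `6`. -/
def queueProg : Prog :=
  .loop (ltTest (.add (nvar 5) (.lit 1)) (nvar 6)) (block [
    set 7 (.load 4 (nvar 5)), set 10 (.load 4 (.add (nvar 5) (.lit 1))), set 8 (nvar 10),
    set 11 (.load 4 (.add (nvar 5) (.lit 2))), set 9 (.load 4 (nvar 6)),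
    mergeProg, incr 6, .natStore 4 (nvar 6) (nvar 9), set 5 (.add (nvar 5) (.lit 2))])

theorem queueProg_runs (s : State) (k : ℕ) {R : List (List ℕ)}
    (hR : QRep (s.nat 4) (s.nat 3) (s.nat 5 0) R) (h6 : s.nat 6 0 = s.nat 5 0 + R.length)
    (hs : ∀ r ∈ R, r.Pairwise fun a b => key s.real a ≤ key s.real b)
    (hk : 300 * queueCost (R.map List.length) + 20 ≤ k) :
    Runs queueProg s k fun s' k' =>
      (seg (s'.nat 3) (s'.nat 4 (s'.nat 5 0)) R.flatten.length).Perm R.flatten ∧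
      ((seg (s'.nat 3) (s'.nat 4 (s'.nat 5 0)) R.flatten.length).Pairwise
        fun a b => key s.real a ≤ key s.real b) ∧
      k ≤ k' + (300 * queueCost (R.map List.length) + 20) := by
  -- The potential is `queueCost` of the current queue: merging the two front runs lowers it by
  -- exactly their total length plus one, which pays for the merge.
  refine Runs.loop (fun s' k' => ∃ R' : List (List ℕ), R'.flatten.Perm R.flatten ∧
    QRep (s'.nat 4) (s'.nat 3) (s'.nat 5 0) R' ∧ s'.nat 6 0 = s'.nat 5 0 + R'.length ∧
    (∀ r ∈ R', r.Pairwise fun a b => key s.real a ≤ key s.real b) ∧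
    300 * queueCost (R'.map List.length) + 20 ≤ k' ∧
    k + 300 * queueCost (R'.map List.length) ≤ k' + 300 * queueCost (R.map List.length)) ?_ ?_ ?_
  · exact ⟨R, .refl _, hR, h6, hs, hk, le_rfl⟩
  · rintro s' k' hf ⟨R', hp, hR', h6', hs', hk', hkk⟩ hc
    have hr : s'.real = s.real := by
      funext a; exact hf.real a (by simp [Prog.realVars, block, incr, set, mergeProg])
    simp [h6'] at hc
    match R', hc with
    | a :: b :: R', hc =>
      simp only [List.map_cons, queueCost] at hk' hkk
      obtain ⟨hB1, ha, hB2, hb, hrest⟩ := hR'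
      rw [add_assoc, one_add_one_eq_two] at hB2 hrest
      have hend := hrest.end_eq
      simp only [List.length_cons] at h6'
      rw [add_assoc, show 2 + R'.length = R'.length + 1 + 1 by omega, ← h6'] at hend
      simp only [runs_block_cons, runs_set, runs_incr, runs_natStore, NatExpr.cost, nvar_cost,
        ltTest_cost]
      and_intros <;> try omega
      refine (mergeProg_runs _ _ (a := a) (b := b) (e := s'.nat 4 (s'.nat 6 0)) ?_ ?_ ?_ ?_ ?_ ?_ ?_
        ?_).mono ?_
      · simpa using ha
      · simpa using hB1.symm
      · simpa using hb
      · simpa using hB2.symm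
      · simp; omega
      · simp; omega
      · simp
      · omega
      · rintro s'' k'' hf' ⟨hseg, hQ, h9, hk''⟩
        have h4 : s''.nat 4 = s'.nat 4 := by simpa using hf'.nat 4 (by decide)
        have h5 : s''.nat 5 = s'.nat 5 := by simpa using hf'.nat 5 (by decide)
        have h6 : s''.nat 6 = s'.nat 6 := by simpa using hf'.nat 6 (by decide)
        simp at hseg hQ
        rw [hr] at hseg
        simp [h4, h5, h6, h9]
        and_intros <;> try omega
        refine ⟨R' ++ [mergeBy (key s.real) a b], ?_, ?_, by simp; omega, ?_, ?_, ?_⟩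
        · refine List.Perm.trans ?_ hp
          simp only [List.flatten_append, List.flatten_cons, List.flatten_nil, List.append_nil]
          refine List.perm_append_comm.trans ?_
          rw [← List.append_assoc a b]
          exact (mergeBy_perm _ a b).append_right _
        · have h6'' : s'.nat 5 0 + 2 + R'.length = s'.nat 6 0 := by omega
          rw [qRep_concat, h6'']
          refine ⟨hrest.congr ?_ ?_, ?_, ?_⟩
          · intro i hi
            rw [Function.update_of_ne (by omega)]
          · intro i hi
            rw [h6''] at hi
            exact hQ i hi
          · simp [length_mergeBy]
          · rw [Function.update_of_ne (by omega), length_mergeBy, hseg]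
        · intro r hr
          rcases List.mem_append.1 hr with hr | hr
          · exact hs' r (by simp [hr])
          · obtain rfl := List.mem_singleton.1 hr
            exact mergeBy_sorted _ (hs' a (by simp)) (hs' b (by simp))
        · simp only [List.map_append, List.map_cons, List.map_nil, length_mergeBy]
          omega
        · simp only [List.map_append, List.map_cons, List.map_nil, length_mergeBy]
          omega
  · rintro s' k' hf ⟨R', hp, hR', h6', hs', hk', hkk⟩ hc
    simp [h6', -List.length_flatten] at hc ⊢
    match R', hc with
    | [], hc =>
      have : R.flatten = [] := by simpa using hp.symm
      simp [queueCost] at hkk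
      simp [this]
      omega
    | [r], hc =>
      simp [queueCost] at hkk
      simp only [List.flatten_singleton] at hp
      rw [← hp.length_eq, hR'.2.1]
      exact ⟨by omega, hp, hs' r (by simp), by omega⟩

/-- Copies the first run of the queue back to array `2`. -/
def copyProg : Prog :=
  block [set 7 (.lit 0), set 8 (.load 4 (nvar 5)),
    .loop (ltTest (nvar 7) (nvar 1)) (block [
      .natStore 2 (nvar 7) (.load 3 (.add (nvar 8) (nvar 7))), incr 7])]

theorem copyProg_runs (s : State) (k : ℕ) (hk : 100 * (s.nat 1 0 + 1) ≤ k) :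
    Runs copyProg s k fun s' k' =>
      seg (s'.nat 2) 0 (s.nat 1 0) = seg (s.nat 3) (s.nat 4 (s.nat 5 0)) (s.nat 1 0) ∧
      k ≤ k' + 100 * (s.nat 1 0 + 1) := by
  simp only [copyProg, runs_block_cons, runs_set, NatExpr.cost, NatExpr.eval]
  and_intros <;> try simp
  · omega
  · omega
  refine Runs.loop (fun s' k' => s'.nat 7 0 ≤ s.nat 1 0 ∧
    seg (s'.nat 2) 0 (s'.nat 7 0) = seg (s.nat 3) (s.nat 4 (s.nat 5 0)) (s'.nat 7 0) ∧
    k ≤ k' + 50 * (s'.nat 7 0) + 20) ?_ ?_ ?_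
  · simp
    omega
  · rintro s' k' hf ⟨hi, hs, hk'⟩ hc
    have h1 : s'.nat 1 = s.nat 1 := by simpa using hf.nat 1 (by decide)
    have h3 : s'.nat 3 = s.nat 3 := by simpa using hf.nat 3 (by decide)
    have h8 : s'.nat 8 0 = s.nat 4 (s.nat 5 0) := by
      simpa using congrFun (hf.nat 8 (by decide)) 0
    simp [h1] at hc
    simp [h3, h8]
    and_intros <;> try omega
    simp [seg_succ, hs]
  · rintro s' k' hf ⟨hi, hs, hk'⟩ hc
    have h1 : s'.nat 1 = s.nat 1 := by simpa using hf.nat 1 (by decide)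
    simp [h1] at hc ⊢
    rw [show s'.nat 7 0 = s.nat 1 0 by omega] at hs
    exact ⟨by omega, by omega, hs, by omega⟩

/-- Sorts the sequence in array `2`, of length given by variable `1`, by the keys. -/
def sortProg : Prog := block [splitProg, boundsProg, queueProg, copyProg]

/-- A bound for the running time of `sortProg` for sequences of length `n` with `d` descents after
rearrangement. -/
def sortCost (n d : ℕ) : ℕ := 300 * ((n + d + 1) * Nat.clog 2 (d + 1)) + 300 * n + 400

/-- A rearranged sequence with at most `d` descents is cut into at most `d + 1` runs, so the queue
needs about `log (d + 1)` passes. Splitting, cutting and copying back are linear. -/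
theorem sortProg_runs (s : State) (k d : ℕ)
    (hd : descents (key s.real)
      (rearrange (key s.real) (s.nat 2 0) (seg (s.nat 2) 0 (s.nat 1 0))) ≤ d)
    (hk : sortCost (s.nat 1 0) d ≤ k) :
    Runs sortProg s k fun s' k' =>
      (seg (s'.nat 2) 0 (s.nat 1 0)).Perm (seg (s.nat 2) 0 (s.nat 1 0)) ∧
      ((seg (s'.nat 2) 0 (s.nat 1 0)).Pairwise fun a b => key s.real a ≤ key s.real b) ∧
      k ≤ k' + sortCost (s.nat 1 0) d := by
  unfold sortCost at hk
  simp only [sortProg, runs_block_cons]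
  refine (splitProg_runs s k (by omega)).mono ?_
  rintro s₁ k₁ hf₁ ⟨h₁, hk₁⟩
  have hN₁ : s₁.nat 1 = s.nat 1 := hf₁.nat 1 (by decide)
  have hr₁ : s₁.real = s.real := by
    funext a; exact hf₁.real a (by simp [Prog.realVars, block, incr, set, splitProg])
  refine (boundsProg_runs s₁ k₁ (by rw [hN₁]; omega)).mono ?_
  rintro s₂ k₂ hf₂ ⟨R, hR, hfl, hsort, hlen, h5, h6, h4, hk₂⟩
  have hN₂ : s₂.nat 1 = s.nat 1 := (hf₂.nat 1 (by decide)).trans hN₁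
  have hr₂ : s₂.real = s.real := by
    rw [← hr₁]
    funext a; exact hf₂.real a (by simp [Prog.realVars, block, incr, set, boundsProg])
  rw [hN₁, hr₁, h₁] at hlen
  rw [hr₁] at hsort
  rw [hN₁] at hfl hk₂
  rw [h₁] at hfl
  have hflen : R.flatten.length = s.nat 1 0 := by
    rw [hfl, (rearrange_perm _ _ _).length_eq, length_seg]
  have hq : queueCost (R.map List.length) ≤ (s.nat 1 0 + d + 1) * Nat.clog 2 (d + 1) := by
    refine (queueCost_le _).trans (Nat.mul_le_mul ?_ (Nat.clog_mono_right 2 ?_))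
    · rw [← List.length_flatten, hflen, List.length_map]
      omega
    · rw [List.length_map]
      omega
  refine (queueProg_runs s₂ k₂ (R := R) (by rwa [h5]) (by omega) (by rwa [hr₂]) ?_).mono ?_
  · omega
  rintro s₃ k₃ hf₃ ⟨hp, hs, hk₃⟩
  have hN₃ : s₃.nat 1 = s.nat 1 := (hf₃.nat 1 (by decide)).trans hN₂
  refine (copyProg_runs s₃ k₃ (by rw [hN₃]; omega)).mono ?_
  rintro s₄ k₄ hf₄ ⟨h₄, hk₄⟩
  rw [hN₃] at h₄ hk₄
  rw [hflen] at hp hs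
  rw [hr₂] at hs
  simp only [runs_block_nil]
  rw [h₄]
  refine ⟨by omega, hp.trans ?_, hs, by unfold sortCost; omega⟩
  rw [hfl]
  exact rearrange_perm _ _ _

end RealRAM

/-! ### Slopes, orientations and convex chains -/

namespace RealRAM

/-- The direction of the vector `(a, b)` up to sign, as an element of a linear order. -/
noncomputable def dirKey (a b : ℝ) : ℝ ×ₗ ℝ := toLex (if a = 0 then 1 else 0, b / a)

/-- The lexicographically positive vectors. -/
def LexPos (a b : ℝ) : Prop := 0 < a ∨ a = 0 ∧ 0 < b

theorem dirKey_neg (a b : ℝ) : dirKey (-a) (-b) = dirKey a b := by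
  simp [dirKey]

/-- The lexicographically positive vectors fill a half-open half-plane. There, directions turn
counterclockwise as the slope grows, the vertical one comes last, and the order of two directions is
the sign of their cross product. Since `b / 0 = 0`, all vertical vectors share one key. -/
theorem dirKey_le_iff {a b c d : ℝ} (h : LexPos a b) (h' : LexPos c d) :
    dirKey a b ≤ dirKey c d ↔ 0 ≤ a * d - b * c := by
  rw [dirKey, dirKey, Prod.Lex.toLex_le_toLex]
  rcases h with ha | ⟨rfl, hb⟩ <;> rcases h' with hc | ⟨rfl, hd⟩
  · simp only [ha.ne', hc.ne', if_false, lt_self_iff_false, true_and, false_or]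
    rw [div_le_div_iff₀ ha hc, sub_nonneg, mul_comm d a]
  · simp [ha.ne', mul_nonneg ha.le hd.le]
  · have := mul_pos hb hc
    constructor <;> intro h
    · norm_num [hc.ne'] at h
    · linarith
  · simp

variable (x y : ℕ → ℝ)

/-- The position of a point, for the lexicographic order of the plane. -/
noncomputable def pos (i : ℕ) : ℝ ×ₗ ℝ := toLex (x i, y i)

/-- Twice the signed area of a triangle. -/
noncomputable def ori (a b c : ℕ) : ℝ := (x b - x a) * (y c - y a) - (y b - y a) * (x c - x a)

/-- The slope of the line through two points. -/
noncomputable def slope (a b : ℕ) : ℝ ×ₗ ℝ := dirKey (x b - x a) (y b - y a)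

theorem slope_comm (a b : ℕ) : slope x y a b = slope x y b a := by
  rw [slope, slope, ← dirKey_neg, neg_sub, neg_sub]

theorem ori_neg (a b c : ℕ) : ori (-x) (-y) a b c = ori x y a b c := by
  simp only [ori, Pi.neg_apply]; ring

theorem slope_neg (a b : ℕ) : slope (-x) (-y) a b = slope x y a b := by
  rw [slope, slope, ← dirKey_neg]
  congr 1 <;> simp only [Pi.neg_apply] <;> ring

theorem pos_neg_lt {a b : ℕ} : pos (-x) (-y) a < pos (-x) (-y) b ↔ pos x y b < pos x y a := by
  simp [pos, Prod.Lex.toLex_lt_toLex]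
  tauto

theorem ori_rotate (a b c : ℕ) : ori x y b c a = ori x y a b c := by
  simp only [ori]; ring

variable {x y}

theorem pos_lt_iff {a b : ℕ} : pos x y a < pos x y b ↔ LexPos (x b - x a) (y b - y a) := by
  rw [pos, pos, Prod.Lex.toLex_lt_toLex, LexPos, sub_pos, sub_pos, sub_eq_zero, eq_comm (a := x a)]

theorem slope_left_le_iff {a b c : ℕ} (h : pos x y a < pos x y b) (h' : pos x y a < pos x y c) :
    slope x y a b ≤ slope x y a c ↔ 0 ≤ ori x y a b c := by
  rw [slope, slope, dirKey_le_iff (pos_lt_iff.1 h) (pos_lt_iff.1 h'), ori]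

theorem slope_mid_le_iff {a b c : ℕ} (h : pos x y a < pos x y b) (h' : pos x y b < pos x y c) :
    slope x y a b ≤ slope x y b c ↔ 0 ≤ ori x y a b c := by
  rw [slope, slope, dirKey_le_iff (pos_lt_iff.1 h) (pos_lt_iff.1 h'), ori]
  ring_nf

theorem slope_right_le_iff {a b c : ℕ} (h : pos x y a < pos x y c) (h' : pos x y b < pos x y c) :
    slope x y a c ≤ slope x y b c ↔ 0 ≤ ori x y a b c := by
  rw [slope, slope, dirKey_le_iff (pos_lt_iff.1 h) (pos_lt_iff.1 h'), ori]
  ring_nf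

/-- The slope of the long side of a triangle lies between the slopes of the two short sides. -/
theorem slope_right_le_iff_left {a b c : ℕ} (h : pos x y a < pos x y b)
    (h' : pos x y b < pos x y c) :
    slope x y b c ≤ slope x y a c ↔ slope x y a c ≤ slope x y a b := by
  rw [slope_right_le_iff h' (h.trans h'), slope_left_le_iff (h.trans h') h,
    ← ori_rotate x y b a c]

theorem slope_congr_left {a b : ℕ} (h : pos x y a = pos x y b) (c : ℕ) :
    slope x y a c = slope x y b c := by
  have := Prod.ext_iff.1 (toLex.injective h)
  simp only at this
  rw [slope, slope, this.1, this.2]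

variable (x y)

/-- Removes points from the top of a stack as long as they violate convexity with `q`. -/
noncomputable def popUntil (q : ℕ) : List ℕ → List ℕ
  | s :: s' :: st => if ori x y s' s q < 0 then popUntil q (s' :: st) else s :: s' :: st
  | st => st

/-- The lower convex chain of a list that is sorted lexicographically, as a stack. -/
noncomputable def chain (l : List ℕ) : List ℕ := l.foldl (fun st q => q :: popUntil x y q st) []

/-- `a` is not above a segment between points of `l`. -/
def Low (l : List ℕ) (a : ℕ) : Prop :=
  ∀ b ∈ l, ∀ c ∈ l, pos x y b < pos x y a → pos x y a < pos x y c → 0 ≤ ori x y b a c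

/-- Each edge of the stack supports the points of `l` to the left of its right end. -/
def Supports (l : List ℕ) : List ℕ → Prop
  | s :: s' :: st =>
    (∀ b ∈ l, pos x y b < pos x y s → slope x y b s ≤ slope x y s' s) ∧ Supports l (s' :: st)
  | [s] => ∀ b ∈ l, ¬ pos x y b < pos x y s
  | [] => True

theorem ori_neg_fun : ori (-x) (-y) = ori x y := by
  funext a b c; exact ori_neg x y a b c

theorem popUntil_neg (q : ℕ) (st : List ℕ) : popUntil (-x) (-y) q st = popUntil x y q st := by
  fun_induction popUntil x y q st with
  | case1 s s' st h ih => rw [popUntil, ori_neg, if_pos h, ih]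
  | case2 s s' st h => rw [popUntil, ori_neg, if_neg h]
  | case3 st h => rw [popUntil.eq_2 _ _ _ _ h]

/-- Half a turn of the plane preserves orientations and reverses the lexicographic order. The upper
chain is therefore found by the same scan, run on the reversed list. -/
theorem chain_neg (l : List ℕ) : chain (-x) (-y) l = chain x y l := by
  simp [chain, popUntil_neg]

theorem popUntil_suffix (q : ℕ) (st : List ℕ) : popUntil x y q st <:+ st := by
  fun_induction popUntil x y q st with
  | case1 s s' st h ih => exact ih.trans (List.suffix_cons _ _)
  | case2 s s' st h => exact List.suffix_refl _
  | case3 st h => exact List.suffix_refl _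

variable {x y}

theorem Low.mono {l l' : List ℕ} {a : ℕ} (h : Low x y l' a) (hl : l ⊆ l') : Low x y l a :=
  fun b hb c hc => h b (hl hb) c (hl hc)

theorem Supports.concat {l : List ℕ} {q : ℕ} {st : List ℕ} (h : Supports x y l st)
    (hq : ∀ s ∈ st, pos x y s < pos x y q) : Supports x y (l ++ [q]) st := by
  induction st with
  | nil => trivial
  | cons s st ih =>
    have hs := hq s (by simp)
    cases st with
    | nil =>
      intro b hb
      rcases List.mem_append.1 hb with hb | hb
      · exact h b hb
      · obtain rfl := List.mem_singleton.1 hb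
        exact hs.not_gt
    | cons s' st =>
      refine ⟨fun b hb hbs => ?_, ih h.2 fun s hs => hq s (by simp_all)⟩
      rcases List.mem_append.1 hb with hb | hb
      · exact h.1 b hb hbs
      · obtain rfl := List.mem_singleton.1 hb
        exact absurd hbs hs.not_gt

/-- The hypothesis `hH` says that the points to the right of the top `t` are not below the segment
from `t` to `q`; this persists when `t` is popped. At the end the edge from the new top to `q`
leaves no point to the right of that top below it. Each popped point comes with a witness that it
lies strictly above a segment ending in `q`. -/
theorem popUntil_spec {l : List ℕ} {q : ℕ} (hq : ∀ b ∈ l, pos x y b < pos x y q) (t : ℕ)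
    (st : List ℕ) (hst : ∀ s ∈ t :: st, s ∈ l)
    (hdec : (t :: st).Pairwise fun a b => pos x y b < pos x y a) (hS : Supports x y l (t :: st))
    (hH : ∀ b ∈ l, pos x y t < pos x y b → slope x y b q ≤ slope x y t q) :
    ∃ t' st', popUntil x y q (t :: st) = t' :: st' ∧ Supports x y l (t' :: st') ∧
      (∀ b ∈ l, pos x y t' < pos x y b → slope x y b q ≤ slope x y t' q) ∧
      (∀ s ∈ st'.head?, 0 ≤ ori x y s t' q) ∧
      ∀ a ∈ t :: st, a ∉ t' :: st' → ∃ b ∈ l, pos x y b < pos x y a ∧ ori x y b a q < 0 := by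
  induction st generalizing t with
  | nil => exact ⟨t, [], rfl, hS, hH, by simp, by simp⟩
  | cons s st ih =>
    rw [popUntil]
    have htl := hst t (by simp)
    have hsl := hst s (by simp)
    have hst' : pos x y s < pos x y t := (List.pairwise_cons.1 hdec).1 s (by simp)
    have htq := hq t htl
    have hsq := hq s hsl
    split_ifs with hneg
    · have h₁ : slope x y t q < slope x y s q :=
        lt_of_not_ge fun h => not_le.2 hneg ((slope_right_le_iff hsq htq).1 h)
      have h₂ : slope x y s q < slope x y s t :=
        lt_of_not_ge fun h => not_le.2 hneg ((slope_left_le_iff hst' hsq).1 h)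
      -- A point between `s` and `t` is not below the edge from `s` to `t`, because that edge
      -- supports; and this edge is steeper than the segment from `s` to `q`.
      have hH' : ∀ b ∈ l, pos x y s < pos x y b → slope x y b q ≤ slope x y s q := by
        intro b hb hsb
        have hbq := hq b hb
        rcases lt_trichotomy (pos x y b) (pos x y t) with hbt | hbt | hbt
        · have h₃ := (slope_right_le_iff_left hsb hbt).1 (hS.1 b hb hbt)
          exact (slope_right_le_iff_left hsb hbq).2 (h₂.le.trans h₃)
        · rw [slope_congr_left hbt]
          exact h₁.le
        · exact (hH b hb hbt).trans h₁.le
      obtain ⟨t', st', he, hS', hH', hz, hpop⟩ := ih s (fun a ha => hst a (by simp_all))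
        (List.pairwise_cons.1 hdec).2 hS.2 hH'
      refine ⟨t', st', he, hS', hH', hz, fun a ha ha' => ?_⟩
      rcases List.mem_cons.1 ha with rfl | ha
      · exact ⟨s, hsl, hst', hneg⟩
      · exact hpop a ha ha'
    · exact ⟨t, s :: st, rfl, hS, hH, by simpa using hneg, fun a ha ha' => absurd ha ha'⟩

/-- The stack consists of the points on the lower chain, from right to left. -/
theorem chain_spec {l : List ℕ} (hl : l.Pairwise fun a b => pos x y a < pos x y b) :
    (chain x y l).Sublist l.reverse ∧ ∀ a ∈ l, a ∈ chain x y l ↔ Low x y l a := by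
  -- The induction also needs that the edges on the stack support the points seen so far and that
  -- the top of the stack is the rightmost of them.
  suffices H : (chain x y l).Sublist l.reverse ∧ Supports x y l (chain x y l) ∧
      (∀ b ∈ l, ∃ t st, chain x y l = t :: st ∧ pos x y b ≤ pos x y t) ∧
      ∀ a ∈ l, a ∈ chain x y l ↔ Low x y l a from ⟨H.1, H.2.2.2⟩
  induction l using List.reverseRecOn with
  | nil => simp [chain, Supports]
  | append_singleton l q ih =>
    obtain ⟨hl', -, hq⟩ := List.pairwise_append.1 hl
    replace hq : ∀ b ∈ l, pos x y b < pos x y q := fun b hb => hq b hb q (by simp)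
    obtain ⟨hsub, hS, htop, hlow⟩ := ih hl'
    have hcq : chain x y (l ++ [q]) = q :: popUntil x y q (chain x y l) := by simp [chain]
    have hqlow : Low x y (l ++ [q]) q := by
      intro b _ c hc _ hqc
      rcases List.mem_append.1 hc with hc | hc
      · exact absurd hqc (hq c hc).not_gt
      · obtain rfl := List.mem_singleton.1 hc
        exact absurd hqc (lt_irrefl _)
    have hsuf := popUntil_suffix x y q (chain x y l)
    have hmem : ∀ s ∈ popUntil x y q (chain x y l), s ∈ l := fun s hs =>
      List.mem_reverse.1 (hsub.subset (hsuf.subset hs))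
    have hlast : ∀ b ∈ l ++ [q], pos x y b ≤ pos x y q := by
      intro b hb
      rcases List.mem_append.1 hb with hb | hb
      · exact (hq b hb).le
      · obtain rfl := List.mem_singleton.1 hb
        exact le_rfl
    rw [hcq]
    rcases List.eq_nil_or_concat l with rfl | ⟨l₀, z, hz⟩
    · simp [chain, popUntil, Supports] at hqlow ⊢
      exact hqlow
    obtain ⟨t, st, hts, -⟩ := htop z (by simp [hz])
    have htop' : ∀ b ∈ l, pos x y b ≤ pos x y t := by
      intro b hb
      obtain ⟨t', st', h₁, h₂⟩ := htop b hb
      rw [hts, List.cons.injEq] at h₁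
      rwa [h₁.1]
    have hdec : (chain x y l).Pairwise fun a b => pos x y b < pos x y a :=
      (List.pairwise_reverse.2 hl').sublist hsub
    obtain ⟨t', st', he, hS', hH', hz', hpop⟩ := popUntil_spec hq t st
      (fun s hs => List.mem_reverse.1 (hsub.subset (hts ▸ hs))) (hts ▸ hdec) (hts ▸ hS)
      fun b hb h => absurd h (htop' b hb).not_gt
    rw [← hts] at he hpop
    rw [he] at hsuf hmem ⊢
    have ht'l := hmem t' (by simp)
    -- Slopes increase along three steps: from `b` to `t'` at most that of the last edge on the
    -- stack, which is at most that from `t'` to `q`, since popping has stopped.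
    have hF : ∀ b ∈ l, pos x y b < pos x y t' → 0 ≤ ori x y b t' q := by
      intro b hb hbt
      cases st' with
      | nil => exact absurd hbt (hS' b hb)
      | cons s st' =>
        have hst : pos x y s < pos x y t' :=
          (List.pairwise_cons.1 (hdec.sublist hsuf.sublist)).1 s (by simp)
        exact (slope_mid_le_iff hbt (hq _ ht'l)).1 ((hS'.1 b hb hbt).trans
          ((slope_mid_le_iff hst (hq _ ht'l)).2 (hz' s (by simp))))
    refine ⟨?_, ⟨?_, hS'.concat fun s hs => hq s (hmem s hs)⟩,
      fun b hb => ⟨q, _, rfl, hlast b hb⟩, ?_⟩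
    · simpa using (hsuf.sublist.trans hsub)
    · intro b hb hbq
      rcases List.mem_append.1 hb with hb | hb
      · rcases lt_trichotomy (pos x y b) (pos x y t') with h | h | h
        · exact (slope_right_le_iff hbq (hq _ ht'l)).2 (hF b hb h)
        · rw [slope_congr_left h]
        · exact hH' b hb h
      · obtain rfl := List.mem_singleton.1 hb
        exact absurd hbq (lt_irrefl _)
    · intro a ha
      rcases List.mem_append.1 ha with hal | ha
      · have hne : a ≠ q := fun h => (hq a hal).ne (h ▸ rfl)
        rw [List.mem_cons, or_iff_right hne]
        constructor
        · intro hat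
          have hlowa := (hlow a hal).1 (hsuf.subset hat)
          -- For a point deeper in the stack the new top `t'` serves as intermediary: the slope from
          -- `b` to `a` is at most that from `a` to `t'`, hence at most that from `a` to `q`.
          have hFa : ∀ b ∈ l, pos x y b < pos x y a → 0 ≤ ori x y b a q := by
            intro b hb hba
            rcases List.mem_cons.1 hat with rfl | hat
            · exact hF b hb hba
            · have hat' : pos x y a < pos x y t' :=
                (List.pairwise_cons.1 (hdec.sublist hsuf.sublist)).1 a hat
              exact (slope_mid_le_iff hba (hq a hal)).1
                (((slope_mid_le_iff hba hat').2 (hlowa b hb t' ht'l hba hat')).trans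
                  ((slope_left_le_iff hat' (hq a hal)).2 (hF a hal hat')))
          intro b hb c hc hba hac
          have hbl : b ∈ l := by
            rcases List.mem_append.1 hb with hb | hb
            · exact hb
            · obtain rfl := List.mem_singleton.1 hb
              exact absurd hba (hq a hal).not_gt
          rcases List.mem_append.1 hc with hc | hc
          · exact hlowa b hbl c hc hba hac
          · obtain rfl := List.mem_singleton.1 hc
            exact hFa b hbl hba
        · intro hla
          -- A low point is low for the shorter list as well, so it was on the stack before; if it
          -- is missing now it has been popped, and the witness for that contradicts lowness.
          by_contra hat
          obtain ⟨b, hb, hba, hneg⟩ :=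
            hpop a ((hlow a hal).2 (hla.mono (List.subset_append_left _ _))) hat
          exact absurd (hla b (by simp [hb]) q (by simp) hba (hq a hal)) (not_le.2 hneg)
      · obtain rfl := List.mem_singleton.1 ha
        simp [hqlow]

end RealRAM

/-! ### Convex layers of a lexicographically sorted list. -/

namespace RealRAM

variable (x y : ℕ → ℝ)

/-- The lower chain, from left to right. -/
noncomputable def lowPart (l : List ℕ) : List ℕ := (chain x y l).reverse

/-- The upper chain, from right to left. -/
noncomputable def upPart (l : List ℕ) : List ℕ := (chain x y l.reverse).reverse

/-- The outermost convex layer of a lexicographically sorted list. -/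
noncomputable def layer (l : List ℕ) : List ℕ :=
  lowPart x y l ++ (upPart x y l).filter fun a => a ∉ lowPart x y l

theorem chain_sublist (l : List ℕ) : (chain x y l).Sublist l.reverse := by
  induction l using List.reverseRecOn with
  | nil => simp [chain]
  | append_singleton l q ih =>
    have : chain x y (l ++ [q]) = q :: popUntil x y q (chain x y l) := by simp [chain]
    simpa [this] using ((popUntil_suffix x y q _).sublist.trans ih)

theorem lowPart_sublist (l : List ℕ) : (lowPart x y l).Sublist l := by
  simpa [lowPart] using (chain_sublist x y l).reverse

theorem upPart_sublist (l : List ℕ) : (upPart x y l).Sublist l.reverse := by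
  simpa [upPart] using (chain_sublist x y l.reverse).reverse

theorem layer_subset (l : List ℕ) : layer x y l ⊆ l := by
  intro a ha
  rcases List.mem_append.1 ha with ha | ha
  · exact (lowPart_sublist x y l).subset ha
  · exact List.mem_reverse.1 ((upPart_sublist x y l).subset (List.mem_of_mem_filter ha))

theorem layer_ne_nil {l : List ℕ} (hl : l ≠ []) : layer x y l ≠ [] := by
  rcases List.eq_nil_or_concat l with rfl | ⟨l, q, rfl⟩
  · exact absurd rfl hl
  · simp [layer, lowPart, chain]

theorem layer_nodup {l : List ℕ} (hl : l.Nodup) : (layer x y l).Nodup := by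
  refine List.nodup_append'.2 ⟨hl.sublist (lowPart_sublist x y l),
    ((List.nodup_reverse.2 hl).sublist (upPart_sublist x y l)).filter _, ?_⟩
  intro a ha ha'
  simp at ha'
  exact ha'.2 ha

/-- The points that are left after the removal of the outermost layer. -/
noncomputable def inner (l : List ℕ) : List ℕ := l.filter fun a => a ∉ layer x y l

theorem inner_sublist (l : List ℕ) : (inner x y l).Sublist l := List.filter_sublist

theorem length_inner_lt {l : List ℕ} (hl : l ≠ []) : (inner x y l).length < l.length := by
  obtain ⟨a, ha⟩ := List.exists_mem_of_ne_nil _ (layer_ne_nil x y hl)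
  exact List.length_filter_lt_length_iff_exists.2 ⟨a, layer_subset x y l ha, by simpa using ha⟩

/-- The convex layers of a lexicographically sorted list, from the outside to the inside. -/
noncomputable def layers (l : List ℕ) : List (List ℕ) :=
  if _ : l = [] then [] else layer x y l :: layers (inner x y l)
termination_by l.length
decreasing_by exact length_inner_lt x y ‹_›

@[simp] theorem layers_nil : layers x y [] = [] := by rw [layers]; simp

theorem layers_of_ne_nil {l : List ℕ} (h : l ≠ []) :
    layers x y l = layer x y l :: layers x y (inner x y l) := by rw [layers, dif_neg h]

/-- Induction along the convex layers. -/
theorem layers_induction {P : List ℕ → Prop} (h₀ : P [])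
    (h₁ : ∀ l, l ≠ [] → P (inner x y l) → P l) (l : List ℕ) : P l := by
  induction h : l.length using Nat.strong_induction_on generalizing l with
  | _ n ih =>
    by_cases hl : l = []
    · rwa [hl]
    · exact h₁ l hl (ih _ (h ▸ length_inner_lt x y hl) _ rfl)

theorem flatten_layers_perm {l : List ℕ} (hl : l.Nodup) : (layers x y l).flatten.Perm l := by
  induction l using layers_induction x y with
  | h₀ => simp
  | h₁ l hne ih =>
    rw [layers_of_ne_nil x y hne, List.flatten_cons]
    refine ((ih (hl.sublist (inner_sublist x y l))).append_left _).trans ?_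
    refine (List.perm_ext_iff_of_nodup (List.nodup_append'.2 ⟨layer_nodup x y hl,
      hl.sublist (inner_sublist x y l), ?_⟩) hl).2 fun a => ?_
    · intro a ha ha'
      simp [inner] at ha'
      exact ha'.2 ha
    · have := @layer_subset x y l a
      simp [inner]
      tauto

variable {x y}

theorem mem_lowPart {l : List ℕ} (hl : l.Pairwise fun a b => pos x y a < pos x y b) {a : ℕ} :
    a ∈ lowPart x y l ↔ a ∈ l ∧ Low x y l a := by
  rw [lowPart, List.mem_reverse]
  constructor
  · intro h
    have ha := List.mem_reverse.1 ((chain_sublist x y l).subset h)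
    exact ⟨ha, ((chain_spec hl).2 a ha).1 h⟩
  · rintro ⟨ha, h⟩
    exact ((chain_spec hl).2 a ha).2 h

/-- Upper points are the low points after half a turn of the plane. -/
theorem mem_upPart {l : List ℕ} (hl : l.Pairwise fun a b => pos x y a < pos x y b) {a : ℕ} :
    a ∈ upPart x y l ↔ a ∈ l ∧ Low (-x) (-y) l a := by
  have h : upPart x y l = lowPart (-x) (-y) l.reverse := by
    rw [upPart, lowPart, chain_neg]
  rw [h, mem_lowPart (List.pairwise_reverse.2 (hl.imp fun h => (pos_neg_lt x y).2 h)),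
    List.mem_reverse]
  refine and_congr_right fun _ => ⟨fun h => h.mono ?_, fun h => h.mono ?_⟩ <;> simp

theorem mem_layer {l : List ℕ} (hl : l.Pairwise fun a b => pos x y a < pos x y b) {a : ℕ} :
    a ∈ layer x y l ↔ a ∈ l ∧ (Low x y l a ∨ Low (-x) (-y) l a) := by
  simp only [layer, List.mem_append, List.mem_filter, decide_eq_true_eq, mem_lowPart hl,
    mem_upPart hl]
  tauto

theorem triplewise_of_low {l A : List ℕ} (hA : A.Pairwise fun a b => pos x y a < pos x y b)
    (h : ∀ a ∈ A, a ∈ l ∧ Low x y l a) : A.Triplewise fun a b c => 0 ≤ ori x y a b c := by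
  induction A with
  | nil => simp
  | cons a A ih =>
    obtain ⟨ha, hA⟩ := List.pairwise_cons.1 hA
    refine List.triplewise_cons.2 ⟨?_, ih hA fun b hb => h b (by simp [hb])⟩
    refine List.Pairwise.imp_of_mem (fun {b c} hb hc hbc => ?_) hA
    exact (h b (by simp [hb])).2 a (h a (by simp)).1 c (h c (by simp [hc])).1 (ha b hb) hbc

theorem pos_injOn_of_pairwise {l : List ℕ} (hl : l.Pairwise fun a b => pos x y a < pos x y b)
    {a b : ℕ} (ha : a ∈ l) (hb : b ∈ l) (h : pos x y a = pos x y b) : a = b := by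
  by_contra hne
  have hp : l.Pairwise fun a b => pos x y a ≠ pos x y b := hl.imp fun h => h.ne
  have _ : Std.Symm fun a b => pos x y a ≠ pos x y b := ⟨fun _ _ h => h.symm⟩
  exact hp.forall ha hb hne h

theorem lowPart_pairwise {l : List ℕ} (hl : l.Pairwise fun a b => pos x y a < pos x y b) :
    (lowPart x y l).Pairwise fun a b => pos x y a < pos x y b := hl.sublist (lowPart_sublist x y l)

theorem upPart_pairwise {l : List ℕ} (hl : l.Pairwise fun a b => pos x y a < pos x y b) :
    (upPart x y l).Pairwise fun a b => pos x y b < pos x y a :=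
  (List.pairwise_reverse.2 hl).sublist (upPart_sublist x y l)

theorem lowPart_triplewise {l : List ℕ} (hl : l.Pairwise fun a b => pos x y a < pos x y b) :
    (lowPart x y l).Triplewise fun a b c => 0 ≤ ori x y a b c :=
  triplewise_of_low (lowPart_pairwise hl) fun _ ha => (mem_lowPart hl).1 ha

theorem upPart_triplewise {l : List ℕ} (hl : l.Pairwise fun a b => pos x y a < pos x y b) :
    (upPart x y l).Triplewise fun a b c => 0 ≤ ori x y a b c := by
  rw [← ori_neg_fun x y]
  exact triplewise_of_low ((upPart_pairwise hl).imp fun h => (pos_neg_lt x y).2 h)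
    fun _ ha => (mem_upPart hl).1 ha

theorem triplewise_sublist {α : Type*} {p : α → α → α → Prop} {l l' : List α}
    (h : l.Triplewise p) (hs : l'.Sublist l) : l'.Triplewise p := by
  induction hs with
  | slnil => exact h
  | cons a _ ih => exact ih (List.triplewise_cons.1 h).2
  | cons_cons a hs ih =>
    rw [List.triplewise_cons] at h ⊢
    exact ⟨h.1.sublist hs, ih h.2⟩

/-- The outermost layer is listed counterclockwise. -/
theorem layer_triplewise {l : List ℕ} (hl : l.Pairwise fun a b => pos x y a < pos x y b) :
    (layer x y l).Triplewise fun a b c => 0 ≤ ori x y a b c := by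
  have hmemA : ∀ a ∈ lowPart x y l, a ∈ l ∧ Low x y l a := fun a ha => (mem_lowPart hl).1 ha
  have hmemB : ∀ b ∈ (upPart x y l).filter fun a => a ∉ lowPart x y l,
      b ∈ l ∧ Low (-x) (-y) l b ∧ b ∉ lowPart x y l := by
    intro b hb
    simp only [List.mem_filter, decide_eq_true_eq, mem_upPart hl] at hb
    exact ⟨hb.1.1, hb.1.2, hb.2⟩
  refine List.triplewise_append.2 ⟨lowPart_triplewise hl,
    triplewise_sublist (upPart_triplewise hl) List.filter_sublist, fun a ha => ?_, fun c hc => ?_⟩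
  -- One point `a` of the lower chain and two of the upper chain, with `c` to the left of `b`.
  -- Depending on the position of `a`, the middle one of the three points is on the lower or on the
  -- upper chain, and its extremality gives the orientation after a cyclic rotation. A coincidence
  -- of positions is excluded, as the second list avoids the lower chain.
  · refine List.Pairwise.imp_of_mem (fun {b c} hb hc hcb => ?_)
      ((upPart_pairwise hl).sublist List.filter_sublist)
    obtain ⟨hal, hLa⟩ := hmemA a ha
    obtain ⟨hbl, hUb, hbA⟩ := hmemB b hb
    obtain ⟨hcl, hUc, hcA⟩ := hmemB c hc
    rcases lt_trichotomy (pos x y a) (pos x y b) with hab | hab | hab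
    · rcases lt_trichotomy (pos x y a) (pos x y c) with hac | hac | hac
      · have := hUc b hbl a hal ((pos_neg_lt x y).2 hcb) ((pos_neg_lt x y).2 hac)
        rwa [ori_neg, ori_rotate] at this
      · exact absurd (pos_injOn_of_pairwise hl hal hcl hac ▸ ha) hcA
      · have := hLa c hcl b hbl hac hab
        rwa [← ori_rotate] at this
    · exact absurd (pos_injOn_of_pairwise hl hal hbl hab ▸ ha) hbA
    · have := hUb a hal c hcl ((pos_neg_lt x y).2 hab) ((pos_neg_lt x y).2 hcb)
      rwa [ori_neg] at this
  -- Two points of the lower chain and one of the upper chain, again decided by which of them is in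
  -- the middle.
  · refine List.Pairwise.imp_of_mem (fun {a b} ha hb hab => ?_) (lowPart_pairwise hl)
    obtain ⟨hal, hLa⟩ := hmemA a ha
    obtain ⟨hbl, hLb⟩ := hmemA b hb
    obtain ⟨hcl, hUc, hcA⟩ := hmemB c hc
    rcases lt_trichotomy (pos x y b) (pos x y c) with hbc | hbc | hbc
    · exact hLb a hal c hcl hab hbc
    · exact absurd (pos_injOn_of_pairwise hl hbl hcl hbc ▸ hb) hcA
    · rcases lt_trichotomy (pos x y a) (pos x y c) with hac | hac | hac
      · have := hUc b hbl a hal ((pos_neg_lt x y).2 hbc) ((pos_neg_lt x y).2 hac)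
        rwa [ori_neg, ori_rotate] at this
      · exact absurd (pos_injOn_of_pairwise hl hal hcl hac ▸ ha) hcA
      · have := hLa c hcl b hbl hac hab
        rwa [ori_rotate, ori_rotate] at this

end RealRAM

/-! ### The slopes of a convex chain as seen from a point -/

namespace RealRAM

section Unimodal

variable {α K : Type*} [LinearOrder K] (κ : α → K)

/-- First strictly decreasing and then increasing, or first increasing and then strictly
decreasing. -/
def Unimodal (l : List α) : Prop :=
  l.Triplewise (fun a b c => κ a ≤ κ b → κ b ≤ κ c) ∨
    l.Triplewise (fun a b c => κ b < κ a → κ c < κ b)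

theorem pairwise_le_of_valley {a b : α} {l : List α}
    (h : (a :: b :: l).Triplewise fun a b c => κ a ≤ κ b → κ b ≤ κ c) (hab : κ a ≤ κ b) :
    (b :: l).Pairwise fun a b => κ a ≤ κ b := by
  induction l generalizing a b with
  | nil => simp
  | cons c l ih =>
    have h' := List.triplewise_cons.1 h
    have hbc := (List.pairwise_cons.1 h'.1).1
    refine List.pairwise_cons.2 ⟨fun d hd => hbc d hd hab, ih h'.2 (hbc c (by simp) hab)⟩

theorem pairwise_gt_of_peak {a b : α} {l : List α}
    (h : (a :: b :: l).Triplewise fun a b c => κ b < κ a → κ c < κ b) (hab : κ b < κ a) :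
    (b :: l).Pairwise fun a b => κ b < κ a := by
  induction l generalizing a b with
  | nil => simp
  | cons c l ih =>
    have h' := List.triplewise_cons.1 h
    have hbc := (List.pairwise_cons.1 h'.1).1
    refine List.pairwise_cons.2 ⟨fun d hd => hbc d hd hab, ih h'.2 (hbc c (by simp) hab)⟩

theorem ups_of_sorted {a : α} {l : List α} (h : (a :: l).Pairwise fun a b => κ a ≤ κ b) :
    ups κ a l = l := by
  induction l generalizing a with
  | nil => rfl
  | cons b l ih =>
    obtain ⟨h₁, h₂⟩ := List.pairwise_cons.1 h
    rw [ups, if_pos (h₁ b (by simp)), ih h₂]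

theorem downs_of_sorted {a : α} {l : List α} (h : (a :: l).Pairwise fun a b => κ a ≤ κ b) :
    downs κ a l = [] := by
  have := length_ups_add_length_downs κ a l
  rw [ups_of_sorted κ h] at this
  exact List.length_eq_zero_iff.1 (by omega)

theorem downs_of_sorted_gt {a : α} {l : List α} (h : (a :: l).Pairwise fun a b => κ b < κ a) :
    downs κ a l = l := by
  induction l generalizing a with
  | nil => rfl
  | cons b l ih =>
    obtain ⟨h₁, h₂⟩ := List.pairwise_cons.1 h
    rw [downs, if_neg (h₁ b (by simp)).not_ge, ih h₂]

theorem ups_of_sorted_gt {a : α} {l : List α} (h : (a :: l).Pairwise fun a b => κ b < κ a) :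
    ups κ a l = [] := by
  have := length_ups_add_length_downs κ a l
  rw [downs_of_sorted_gt κ h] at this
  exact List.length_eq_zero_iff.1 (by omega)

/-- In a valley all falling entries precede the rising ones, in a peak it is the other way round.
The head belongs to whichever monotone part comes first, and keeping it attached there makes the
induction work. -/
theorem Unimodal.ups_downs_sorted {a : α} {l : List α} (h : Unimodal κ (a :: l)) :
    (ups κ a l).Pairwise (fun a b => κ a ≤ κ b) ∧
      (a :: downs κ a l).Pairwise (fun a b => κ b < κ a) ∨
    (a :: ups κ a l).Pairwise (fun a b => κ a ≤ κ b) ∧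
      (downs κ a l).Pairwise (fun a b => κ b < κ a) := by
  rcases h with h | h
  · left
    induction l generalizing a with
    | nil => simp [ups, downs]
    | cons b l ih =>
      by_cases hab : κ a ≤ κ b
      · have hs := pairwise_le_of_valley κ h hab
        rw [ups, if_pos hab, downs, if_pos hab, ups_of_sorted κ hs, downs_of_sorted κ hs]
        exact ⟨hs, by simp⟩
      · obtain ⟨h₁, h₂⟩ := ih (List.triplewise_cons.1 h).2
        rw [ups, if_neg hab, downs, if_neg hab]
        refine ⟨h₁, List.pairwise_cons.2 ⟨fun c hc => ?_, h₂⟩⟩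
        rcases List.mem_cons.1 hc with rfl | hc
        · exact not_le.1 hab
        · exact ((List.pairwise_cons.1 h₂).1 c hc).trans (not_le.1 hab)
  · right
    induction l generalizing a with
    | nil => simp [ups, downs]
    | cons b l ih =>
      by_cases hab : κ a ≤ κ b
      · obtain ⟨h₁, h₂⟩ := ih (List.triplewise_cons.1 h).2
        rw [ups, if_pos hab, downs, if_pos hab]
        refine ⟨List.pairwise_cons.2 ⟨fun c hc => ?_, h₁⟩, h₂⟩
        rcases List.mem_cons.1 hc with rfl | hc
        · exact hab
        · exact hab.trans ((List.pairwise_cons.1 h₁).1 c hc)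
      · have hs := pairwise_gt_of_peak κ h (not_le.1 hab)
        rw [ups, if_neg hab, downs, if_neg hab, ups_of_sorted_gt κ hs, downs_of_sorted_gt κ hs]
        exact ⟨by simp, hs⟩

/-- Inside a longer list the first entry of a piece is compared with the end of the preceding piece,
so it may be sorted into the wrong part. It is the only such entry, hence at most one descent per
part. -/
theorem Unimodal.descents_le {l : List α} (h : Unimodal κ l) (a : α) :
    descents κ (ups κ a l) ≤ 1 ∧ descents κ (downs κ a l).reverse ≤ 1 := by
  cases l with
  | nil => simp [ups, downs]
  | cons b l =>
    have hu : descents κ (ups κ b l) = 0 := by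
      refine descents_eq_zero κ ?_
      rcases h.ups_downs_sorted κ with h | h
      · exact h.1
      · exact h.1.tail
    have hd : descents κ (downs κ b l).reverse = 0 := by
      refine descents_eq_zero κ (List.pairwise_reverse.2 ?_)
      rcases h.ups_downs_sorted κ with h | h
      · exact h.2.tail.imp le_of_lt
      · exact h.2.imp le_of_lt
    have h₁ := descents_cons_le κ b (ups κ b l)
    have h₂ := descents_append_le κ (downs κ b l).reverse [b]
    rw [ups, downs]
    rw [descents_singleton] at h₂
    split
    · omega
    · rw [List.reverse_cons]
      omega

/-- Each piece contributes at most one descent of its own and one at the joint to its neighbour. -/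
theorem descents_ups_flatten_le (Cs : List (List α)) (h : ∀ C ∈ Cs, Unimodal κ C) (a : α) :
    descents κ (ups κ a Cs.flatten) ≤ 2 * Cs.length ∧
      descents κ (downs κ a Cs.flatten).reverse ≤ 2 * Cs.length := by
  induction Cs generalizing a with
  | nil => simp [ups, downs]
  | cons C Cs ih =>
    rw [List.flatten_cons, ups_append, downs_append, List.reverse_append, List.length_cons]
    have h₁ := (h C (by simp)).descents_le κ a
    have h₂ := ih (fun C hC => h C (by simp [hC])) ((a :: C).getLast (by simp))
    have h₃ := descents_append_le κ (ups κ a C)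
      (ups κ ((a :: C).getLast (by simp)) Cs.flatten)
    have h₄ := descents_append_le κ (downs κ ((a :: C).getLast (by simp)) Cs.flatten).reverse
      (downs κ a C).reverse
    omega

/-- Two descents per piece in the rising part, two in the falling part, and one where the two parts
meet. -/
theorem descents_rearrange_le {Cs : List (List α)} (h : ∀ C ∈ Cs, Unimodal κ C) (a : α) :
    descents κ (rearrange κ a Cs.flatten) ≤ 4 * Cs.length + 1 := by
  have h₁ := descents_ups_flatten_le κ Cs h a
  have h₂ := descents_append_le κ (ups κ a Cs.flatten) (downs κ a Cs.flatten).reverse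
  rw [rearrange]
  omega

end Unimodal

theorem triplewise_imp {α : Type*} {R : α → α → Prop} {p q : α → α → α → Prop} {l : List α}
    (hR : l.Pairwise R) (hp : l.Triplewise p)
    (h : ∀ a ∈ l, ∀ b ∈ l, ∀ c ∈ l, R a b → R b c → p a b c → q a b c) : l.Triplewise q := by
  induction l with
  | nil => simp
  | cons a l ih =>
    obtain ⟨ha, hR⟩ := List.pairwise_cons.1 hR
    obtain ⟨hpa, hp⟩ := List.triplewise_cons.1 hp
    refine List.triplewise_cons.2 ⟨?_, ih hR hp fun a ha b hb c hc =>
      h a (by simp [ha]) b (by simp [hb]) c (by simp [hc])⟩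
    refine (hR.and hpa).imp_of_mem fun {b c} hb hc hbc => ?_
    exact h a (by simp) b (by simp [hb]) c (by simp [hc]) (ha b hb) hbc.1 hbc.2

variable {x y : ℕ → ℝ}

/-- `C` is a convex chain that is listed from left to right. -/
def ConvexChain (x y : ℕ → ℝ) (C : List ℕ) : Prop :=
  C.Pairwise (fun a b => pos x y a < pos x y b) ∧ C.Triplewise fun a b c => 0 ≤ ori x y a b c

theorem ConvexChain.sublist {C C' : List ℕ} (h : ConvexChain x y C) (hs : C'.Sublist C) :
    ConvexChain x y C' := ⟨h.1.sublist hs, triplewise_sublist h.2 hs⟩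

/-- If the slope from `p` does not decrease from `a` to `b`, then the edge from `a` to `b` is at
least as steep as the line from `p` to `b`. By convexity so is the edge from `b` to `c`, and the
slope does not decrease from `b` to `c` either. -/
theorem ConvexChain.unimodal_right {C : List ℕ} (h : ConvexChain x y C) {p : ℕ}
    (hp : ∀ c ∈ C, pos x y p < pos x y c) : Unimodal (slope x y p) C := by
  left
  refine triplewise_imp h.1 h.2 fun a ha b hb c hc hab hbc habc hle => ?_
  have hpa := hp a ha
  have hpb := hp b hb
  have hpc := hp c hc
  rw [slope_left_le_iff hpa hpb, ← slope_right_le_iff hpb hab] at hle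
  rw [slope_left_le_iff hpb hpc, ← slope_mid_le_iff hpb hbc]
  exact hle.trans ((slope_mid_le_iff hab hbc).2 habc)

/-- A drop in slope from `a` to `b` means that the line from `b` to `p` is less steep than the edge
from `a` to `b`, hence less steep than the edge from `b` to `c`; so the slope drops again. -/
theorem ConvexChain.unimodal_left {C : List ℕ} (h : ConvexChain x y C) {p : ℕ}
    (hp : ∀ c ∈ C, pos x y c < pos x y p) : Unimodal (slope x y p) C := by
  right
  refine triplewise_imp h.1 h.2 fun a ha b hb c hc hab hbc habc hlt => ?_
  have hpa := hp a ha
  have hpb := hp b hb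
  have hpc := hp c hc
  rw [slope_comm x y p, slope_comm x y p, ← not_le] at hlt ⊢
  rw [slope_right_le_iff hpa hpb, ← slope_mid_le_iff hab hpb, not_le] at hlt
  rw [slope_right_le_iff hpb hpc, ← slope_left_le_iff hbc hpb, not_le]
  exact hlt.trans_le ((slope_mid_le_iff hab hbc).2 habc)

theorem filter_ne_eq {A : List ℕ} (hA : A.Pairwise fun a b => pos x y a < pos x y b) {p : ℕ}
    (hp : ∀ a ∈ A, pos x y a = pos x y p → a = p) :
    (A.filter fun a => a ≠ p) = (A.filter fun a => pos x y a < pos x y p) ++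
      A.filter fun a => pos x y p < pos x y a := by
  induction A with
  | nil => simp
  | cons a A ih =>
    obtain ⟨ha, hA⟩ := List.pairwise_cons.1 hA
    have ih := ih hA fun b hb => hp b (by simp [hb])
    rcases lt_trichotomy (pos x y a) (pos x y p) with h | h | h
    · have hne : a ≠ p := fun h' => h.ne (h' ▸ rfl)
      simp only [List.filter_cons, hne, h, h.not_gt, ne_eq, not_false_eq_true, decide_true, if_true,
        decide_false] at ih ⊢
      simpa using ih
    · obtain rfl := hp a (by simp) h
      simp only [List.filter_cons, ne_eq, not_true_eq_false, decide_false, lt_self_iff_false] at ih ⊢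
      simpa using ih
    · have hne : a ≠ p := fun h' => h.ne' (h' ▸ rfl)
      have h₁ : (A.filter fun a => pos x y a < pos x y p) = [] :=
        List.filter_eq_nil_iff.2 fun b hb => by simpa using (h.trans (ha b hb)).le
      rw [h₁] at ih
      simp only [List.filter_cons, hne, h, h.not_gt, ne_eq, not_false_eq_true, decide_true, if_true,
        decide_false, h₁] at ih ⊢
      simpa using ih

/-- The slope of a line ignores its direction, so the two unimodality results apply only to points
on one side of `p`. The chain is cut at the position of `p`, whether or not `p` belongs to it. -/
theorem ConvexChain.exists_unimodal {A : List ℕ} (hA : ConvexChain x y A) {p : ℕ}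
    (hp : ∀ a ∈ A, pos x y a = pos x y p → a = p) :
    ∃ C C' : List ℕ, (A.filter fun a => a ≠ p) = C ++ C' ∧ Unimodal (slope x y p) C ∧
      Unimodal (slope x y p) C' :=
  ⟨_, _, filter_ne_eq hA.1 hp,
    (hA.sublist List.filter_sublist).unimodal_left fun c hc => by simpa using (List.mem_filter.1 hc).2,
    (hA.sublist List.filter_sublist).unimodal_right fun c hc => by
      simpa using (List.mem_filter.1 hc).2⟩

/-- Two pieces from the lower chain and two from the upper one. The latter is a convex chain after
half a turn, which changes no slope. -/
theorem layer_exists_unimodal {l : List ℕ} (hl : l.Pairwise fun a b => pos x y a < pos x y b)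
    {p : ℕ} (hp : ∀ a ∈ l, pos x y a = pos x y p → a = p) :
    ∃ Cs : List (List ℕ), Cs.length = 4 ∧ ((layer x y l).filter fun a => a ≠ p) = Cs.flatten ∧
      ∀ C ∈ Cs, Unimodal (slope x y p) C := by
  have hA : ConvexChain x y (lowPart x y l) := ⟨lowPart_pairwise hl, lowPart_triplewise hl⟩
  have hB : ConvexChain (-x) (-y) ((upPart x y l).filter fun a => a ∉ lowPart x y l) := by
    refine ConvexChain.sublist ⟨(upPart_pairwise hl).imp fun h => (pos_neg_lt x y).2 h, ?_⟩
      List.filter_sublist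
    rw [ori_neg_fun]
    exact upPart_triplewise hl
  obtain ⟨C₁, C₂, h, h₁, h₂⟩ := hA.exists_unimodal (p := p)
    fun a ha => hp a ((lowPart_sublist x y l).subset ha)
  obtain ⟨C₃, C₄, h', h₃, h₄⟩ := hB.exists_unimodal (p := p) fun a ha h => by
    refine hp a (List.mem_reverse.1 ((upPart_sublist x y l).subset (List.mem_of_mem_filter ha))) ?_
    simpa [pos] using h
  have hs : slope (-x) (-y) p = slope x y p := funext fun q => slope_neg x y p q
  rw [hs] at h₃ h₄
  refine ⟨[C₁, C₂, C₃, C₄], rfl, ?_, by simp [h₁, h₂, h₃, h₄]⟩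
  rw [layer, List.filter_append, h, h']
  simp

/-- Seen from `p`, the slopes along the convex layers consist of few monotone pieces. -/
theorem layers_exists_unimodal {l : List ℕ} (hl : l.Pairwise fun a b => pos x y a < pos x y b)
    {p : ℕ} (hp : ∀ a ∈ l, pos x y a = pos x y p → a = p) :
    ∃ Cs : List (List ℕ), Cs.length = 4 * (layers x y l).length ∧
      ((layers x y l).flatten.filter fun a => a ≠ p) = Cs.flatten ∧
      ∀ C ∈ Cs, Unimodal (slope x y p) C := by
  induction l using layers_induction x y with
  | h₀ => exact ⟨[], by simp⟩
  | h₁ l hne ih =>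
    obtain ⟨Cs, h₁, h₂, h₃⟩ := ih (hl.sublist (inner_sublist x y l))
      fun a ha => hp a ((inner_sublist x y l).subset ha)
    obtain ⟨Cs', h₁', h₂', h₃'⟩ := layer_exists_unimodal hl hp
    refine ⟨Cs' ++ Cs, ?_, ?_, fun C hC => (List.mem_append.1 hC).elim (h₃' C) (h₃ C)⟩
    · rw [layers_of_ne_nil x y hne, List.length_append, List.length_cons, h₁, h₁']
      ring
    · rw [layers_of_ne_nil x y hne, List.flatten_cons, List.filter_append, h₂, h₂',
        List.flatten_append]

end RealRAM

/-! ### The computation of the convex layers -/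

namespace RealRAM

/-- Twice the signed area of the triangle of the points `a`, `b`, `c`. -/
def oriExpr (a b c : NatExpr) : RealExpr :=
  .sub (.mul (.sub (.load 0 b) (.load 0 a)) (.sub (.load 1 c) (.load 1 a)))
    (.mul (.sub (.load 1 b) (.load 1 a)) (.sub (.load 0 c) (.load 0 a)))

@[simp] theorem oriExpr_eval (a b c : NatExpr) (s : State) :
    (oriExpr a b c).eval s = ori (s.real 0) (s.real 1) (a.eval s) (b.eval s) (c.eval s) := rfl

@[simp] theorem oriExpr_cost (a b c : NatExpr) :
    (oriExpr a b c).cost = 4 * a.cost + 2 * b.cost + 2 * c.cost + 15 := by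
  simp [oriExpr]; omega

/-- Pops points from the stack in array `17`, of height given by variable `18`, as long as they
violate convexity with the point in variable `8`. -/
def popProg : Prog :=
  .loop (.and (ltTest (.lit 1) (nvar 18)) (.neg (.realLe (.lit 0)
      (oriExpr (.load 17 (.sub (nvar 18) (.lit 2))) (.load 17 (.sub (nvar 18) (.lit 1))) (nvar 8)))))
    (set 18 (.sub (nvar 18) (.lit 1)))

theorem popProg_runs (s : State) (k : ℕ) (st : List ℕ)
    (hst : seg (s.nat 17) 0 (s.nat 18 0) = st.reverse) (hk : 100 * st.length + 100 ≤ k) :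
    Runs popProg s k fun s' k' =>
      seg (s'.nat 17) 0 (s'.nat 18 0) =
        (popUntil (s.real 0) (s.real 1) (s.nat 8 0) st).reverse ∧
      k + 100 * s'.nat 18 0 ≤ k' + 100 * st.length + 80 := by
  refine Runs.loop (fun s' k' => ∃ st', popUntil (s.real 0) (s.real 1) (s.nat 8 0) st' =
    popUntil (s.real 0) (s.real 1) (s.nat 8 0) st ∧
    seg (s'.nat 17) 0 (s'.nat 18 0) = st'.reverse ∧
    k + 100 * st'.length ≤ k' + 100 * st.length) ⟨st, rfl, hst, le_rfl⟩ ?_ ?_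
  · rintro s' k' hf ⟨st', hp, hs, hk'⟩ hc
    have h8 : s'.nat 8 = s.nat 8 := hf.nat 8 (by decide)
    have hr : s'.real = s.real := by
      funext a; exact hf.real a (by simp [Prog.realVars, set])
    have hlen := congrArg List.length hs
    simp only [length_seg, List.length_reverse] at hlen
    simp [hlen, h8, hr] at hc
    match st', hc, hlen with
    | a :: b :: st', hc, hlen =>
      simp only [List.length_cons] at hlen hc hk'
      have hz : s'.nat 18 0 = st'.length + 1 + 1 := hlen
      rw [hz, seg_succ, seg_succ] at hs
      have hs₂ : seg (s'.nat 17) 0 st'.length ++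
          [s'.nat 17 st'.length, s'.nat 17 (st'.length + 1)] = st'.reverse ++ [b, a] := by
        simpa using hs
      obtain ⟨h₁, h'⟩ := List.append_inj' hs₂ rfl
      simp only [List.cons.injEq, and_true] at h'
      obtain ⟨h₂, h₃⟩ := h'
      simp [h₂, h₃] at hc
      simp [hz]
      refine ⟨by omega, by omega, b :: st', ?_, by simp [seg_succ, h₁, h₂], by simp; omega⟩
      rw [← hp, popUntil, if_pos hc]
  · rintro s' k' hf ⟨st', hp, hs, hk'⟩ hc
    have h8 : s'.nat 8 = s.nat 8 := hf.nat 8 (by decide)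
    have hr : s'.real = s.real := by
      funext a; exact hf.real a (by simp [Prog.realVars, set])
    have hlen := congrArg List.length hs
    simp only [length_seg, List.length_reverse] at hlen
    simp [hlen, h8, hr] at hc
    simp only [ltTest_cost, Test.cost, NatExpr.cost, RealExpr.cost, nvar_cost, oriExpr_cost]
    refine ⟨by omega, ?_, by omega⟩
    rw [hs, ← hp]
    match st', hc, hlen with
    | [], hc, hlen => rfl
    | [a], hc, hlen => rfl
    | a :: b :: st', hc, hlen =>
      simp only [List.length_cons] at hlen hc hk'
      have hz : s'.nat 18 0 = st'.length + 1 + 1 := hlen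
      rw [hz, seg_succ, seg_succ] at hs
      have hs₂ : seg (s'.nat 17) 0 st'.length ++
          [s'.nat 17 st'.length, s'.nat 17 (st'.length + 1)] = st'.reverse ++ [b, a] := by
        simpa using hs
      obtain ⟨h₁, h'⟩ := List.append_inj' hs₂ rfl
      simp only [List.cons.injEq, and_true] at h'
      obtain ⟨h₂, h₃⟩ := h'
      simp [h₂, h₃] at hc
      rw [popUntil, if_neg (not_lt.2 hc)]

theorem chain_concat (x y : ℕ → ℝ) (l : List ℕ) (q : ℕ) :
    chain x y (l ++ [q]) = q :: popUntil x y q (chain x y l) := by simp [chain]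

/-- Computes the convex chain of a sequence, of length given by variable `1`, whose entry with the
number in variable `7` is `e`. -/
def chainProg (e : NatExpr) : Prog :=
  block [set 18 (.lit 0), set 7 (.lit 0),
    .loop (ltTest (nvar 7) (nvar 1)) (block [
      set 8 e, popProg, .natStore 17 (nvar 18) (nvar 8), incr 18, incr 7])]

/-- The expression `e` is a parameter, so that the same scan can read array `2` forwards or
backwards; `hg` says that it yields the entry `g i` as long as arrays `1` and `2` are untouched. -/
theorem chainProg_runs (e : NatExpr) (he : e.cost ≤ 20) (g : ℕ → ℕ) (s : State) (k : ℕ)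
    (hg : ∀ s' : State, s'.nat 1 = s.nat 1 → s'.nat 2 = s.nat 2 → e.eval s' = g (s'.nat 7 0))
    (hk : 300 * (s.nat 1 0 + 1) ≤ k) :
    Runs (chainProg e) s k fun s' k' =>
      seg (s'.nat 17) 0 (s'.nat 18 0) = lowPart (s.real 0) (s.real 1) (seg g 0 (s.nat 1 0)) ∧
      k ≤ k' + 300 * (s.nat 1 0 + 1) := by
  simp only [chainProg, runs_block_cons, runs_set, NatExpr.cost]
  refine ⟨by omega, by omega, ?_⟩
  -- Amortization: 100 credits are kept for every point on the stack and pay for its later removal,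
  -- which makes the whole scan linear.
  refine Runs.loop (fun s' k' => s'.nat 7 0 ≤ s.nat 1 0 ∧
    seg (s'.nat 17) 0 (s'.nat 18 0) = lowPart (s.real 0) (s.real 1) (seg g 0 (s'.nat 7 0)) ∧
    k + 100 * s'.nat 18 0 ≤ k' + 250 * s'.nat 7 0 + 20) ?_ ?_ ?_
  · simp [lowPart, chain]
    omega
  · rintro s' k' hf ⟨hi, hs, hk'⟩ hc
    have h1 : s'.nat 1 = s.nat 1 := by
      simpa using hf.nat 1 (by simp [Prog.natVars, block, set, incr, popProg])
    have h2 : s'.nat 2 = s.nat 2 := by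
      simpa using hf.nat 2 (by simp [Prog.natVars, block, set, incr, popProg])
    have hr : s'.real = s.real := by
      funext a
      simpa using hf.real a (by simp [Prog.realVars, block, set, incr, popProg])
    simp [h1] at hc
    have hz : s'.nat 18 0 = (chain (s.real 0) (s.real 1) (seg g 0 (s'.nat 7 0))).length := by
      simpa [lowPart] using congrArg List.length hs
    have hzi : s'.nat 18 0 ≤ s'.nat 7 0 := by
      simpa [hz] using (chain_sublist (s.real 0) (s.real 1) (seg g 0 (s'.nat 7 0))).length_le
    simp only [runs_block_cons, runs_set, ltTest_cost, nvar_cost]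
    refine ⟨by omega, by omega, ?_⟩
    refine (popProg_runs _ _ (chain (s.real 0) (s.real 1) (seg g 0 (s'.nat 7 0))) ?_ ?_).mono ?_
    · simpa [lowPart] using hs
    · omega
    · rintro s'' k'' hf' ⟨hs', hk''⟩
      have h8 : s''.nat 8 0 = g (s'.nat 7 0) := by
        simpa [hg s' h1 h2] using congrFun (hf'.nat 8 (by decide)) 0
      have h7 : s''.nat 7 = s'.nat 7 := by simpa using hf'.nat 7 (by decide)
      have hlen := congrArg List.length hs'
      simp [hr, hg s' h1 h2] at hs' hlen
      simp [h8, h7]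
      and_intros <;> try omega
      rw [seg_succ, seg_update_of_le (by omega), seg_succ, hs', lowPart, chain_concat]
      simp
  · rintro s' k' hf ⟨hi, hs, hk'⟩ hc
    have h1 : s'.nat 1 = s.nat 1 := by
      simpa using hf.nat 1 (by simp [Prog.natVars, block, set, incr, popProg])
    simp [h1] at hc ⊢
    rw [show s'.nat 7 0 = s.nat 1 0 by omega] at hs
    exact ⟨by omega, by omega, hs, by omega⟩

/-- Array `16` marks the points in array `12`. -/
def Marked (s : State) : Prop := ∀ v, s.nat 16 v = 0 ↔ v ∉ seg (s.nat 12) 0 (s.nat 13 0)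

/-- Appends the unmarked points of the stack to array `12` and marks them. -/
def moveProg : Prog :=
  block [set 7 (.lit 0),
    .loop (ltTest (nvar 7) (nvar 18)) (block [
      .cond (.natLe (.load 16 (.load 17 (nvar 7))) (.lit 0))
        (block [.natStore 16 (.load 17 (nvar 7)) (.lit 1),
          .natStore 12 (nvar 13) (.load 17 (nvar 7)), incr 13])
        .skip,
      incr 7])]

/-- As the stack has no repetitions, marks set during the loop never affect a later test, and the
test amounts to membership in the initial contents of array `12`. -/
theorem moveProg_runs (s : State) (k : ℕ) (hm : Marked s)
    (hz : (seg (s.nat 17) 0 (s.nat 18 0)).Nodup) (hk : 100 * (s.nat 18 0 + 1) ≤ k) :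
    Runs moveProg s k fun s' k' => Marked s' ∧
      seg (s'.nat 12) 0 (s'.nat 13 0) = seg (s.nat 12) 0 (s.nat 13 0) ++
        (seg (s.nat 17) 0 (s.nat 18 0)).filter (fun a => a ∉ seg (s.nat 12) 0 (s.nat 13 0)) ∧
      (∀ i < s.nat 13 0, s'.nat 12 i = s.nat 12 i) ∧
      k ≤ k' + 100 * (s.nat 18 0 + 1) := by
  simp only [moveProg, runs_block_cons, runs_set, NatExpr.cost]
  refine ⟨by omega, ?_⟩
  set S₀ := seg (s.nat 12) 0 (s.nat 13 0) with hS₀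
  refine Runs.loop (fun s' k' => s'.nat 7 0 ≤ s.nat 18 0 ∧ Marked s' ∧
    seg (s'.nat 12) 0 (s'.nat 13 0) = S₀ ++
      (seg (s.nat 17) 0 (s'.nat 7 0)).filter (fun a => a ∉ S₀) ∧
    (∀ i < s.nat 13 0, s'.nat 12 i = s.nat 12 i) ∧ s.nat 13 0 ≤ s'.nat 13 0 ∧
    k ≤ k' + 100 * s'.nat 7 0 + 20) ?_ ?_ ?_
  · refine ⟨by simp, ?_, by simp [S₀], by simp, by simp, by simp; omega⟩
    intro v
    simpa using hm v
  · rintro s' k' hf ⟨hi, hm', hs, hS, h13, hk'⟩ hc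
    have h18 : s'.nat 18 = s.nat 18 := by simpa using hf.nat 18 (by decide)
    have h17 : s'.nat 17 = s.nat 17 := by simpa using hf.nat 17 (by decide)
    simp [h18] at hc
    have hnd : (seg (s.nat 17) 0 (s'.nat 7 0 + 1)).Nodup := by
      rw [show s.nat 18 0 = (s'.nat 7 0 + 1) + (s.nat 18 0 - (s'.nat 7 0 + 1)) by omega,
        seg_add] at hz
      exact hz.of_append_left
    rw [seg_succ, Nat.zero_add] at hnd
    have hv := hm' (s.nat 17 (s'.nat 7 0))
    have hvn : s.nat 17 (s'.nat 7 0) ∉ seg (s.nat 17) 0 (s'.nat 7 0) := by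
      intro h
      exact (List.nodup_append'.1 hnd).2.2 h (by simp)
    have hv : s'.nat 16 (s.nat 17 (s'.nat 7 0)) = 0 ↔ s.nat 17 (s'.nat 7 0) ∉ S₀ := by
      rw [hv, hs]
      simp [hvn]
    simp [h17]
    refine ⟨by omega, by omega, fun h => ?_, fun h => ?_⟩
    · have hS' := hv.1 h
      and_intros <;> try omega
      · intro w
        have hw := hm' w
        simp only [nat_setNat_self, nat_setNat_of_ne _ _ _ (show (16 : ℕ) ≠ 7 by decide),
          nat_setNat_of_ne _ _ _ (show (16 : ℕ) ≠ 13 by decide),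
          nat_setNat_of_ne _ _ _ (show (16 : ℕ) ≠ 12 by decide),
          nat_setNat_of_ne _ _ _ (show (12 : ℕ) ≠ 7 by decide),
          nat_setNat_of_ne _ _ _ (show (12 : ℕ) ≠ 13 by decide),
          nat_setNat_of_ne _ _ _ (show (13 : ℕ) ≠ 7 by decide),
          nat_setNat_of_ne _ _ _ (show (12 : ℕ) ≠ 16 by decide), Function.update_self]
        rw [seg_succ, seg_update_of_le (by omega), Nat.zero_add, Function.update_self]
        by_cases hwv : w = s.nat 17 (s'.nat 7 0)
        · simp [hwv]
        · rw [Function.update_of_ne hwv, hw]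
          simp [hwv]
      · rw [seg_succ, seg_update_of_le (by omega), hs, seg_succ, List.filter_append]
        simp [hS']
      · intro i hi
        rw [Function.update_of_ne (by omega), hS i hi]
    · have hS' : ¬ s.nat 17 (s'.nat 7 0) ∉ S₀ := fun h' => h (hv.2 h')
      and_intros <;> try omega
      · intro w
        simpa using hm' w
      · rw [hs, seg_succ, List.filter_append]
        simp at hS'
        simp [hS']
  · rintro s' k' hf ⟨hi, hm', hs, hS, h13, hk'⟩ hc
    have h18 : s'.nat 18 = s.nat 18 := by simpa using hf.nat 18 (by decide)
    simp [h18] at hc ⊢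
    rw [show s'.nat 7 0 = s.nat 18 0 by omega] at hs
    exact ⟨by omega, by omega, hm', by simpa using hs, hS, by omega⟩

end RealRAM

/-! ### Peeling off one layer after the other. -/

namespace RealRAM

/-- Removes the marked points from the sequence in array `2`. -/
def compactProg : Prog :=
  block [set 7 (.lit 0), set 8 (.lit 0),
    .loop (ltTest (nvar 7) (nvar 1)) (block [
      .cond (.natLe (.load 16 (.load 2 (nvar 7))) (.lit 0))
        (block [.natStore 2 (nvar 8) (.load 2 (nvar 7)), incr 8])
        .skip,
      incr 7]),
    set 1 (nvar 8)]

theorem compactProg_runs (s : State) (k : ℕ) (hk : 100 * (s.nat 1 0 + 1) ≤ k) :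
    Runs compactProg s k fun s' k' =>
      seg (s'.nat 2) 0 (s'.nat 1 0) =
        (seg (s.nat 2) 0 (s.nat 1 0)).filter (fun v => s.nat 16 v = 0) ∧
      k ≤ k' + 100 * (s.nat 1 0 + 1) := by
  simp only [compactProg, runs_block_cons, runs_set, NatExpr.cost, runs_block_nil, nvar_cost]
  refine ⟨by omega, by omega, ?_⟩
  -- The write position never overtakes the read position, so compaction in place does not destroy
  -- unread entries.
  refine Runs.loop (fun s' k' => s'.nat 7 0 ≤ s.nat 1 0 ∧ s'.nat 8 0 ≤ s'.nat 7 0 ∧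
    seg (s'.nat 2) 0 (s'.nat 8 0) =
      (seg (s.nat 2) 0 (s'.nat 7 0)).filter (fun v => s.nat 16 v = 0) ∧
    (∀ i, s'.nat 7 0 ≤ i → s'.nat 2 i = s.nat 2 i) ∧ k ≤ k' + 80 * s'.nat 7 0 + 20) ?_ ?_ ?_
  · refine ⟨by simp, by simp, by simp, by simp, by simp; omega⟩
  · rintro s' k' hf ⟨hi, hj, hs, h2, hk'⟩ hc
    have h1 : s'.nat 1 = s.nat 1 := by simpa using hf.nat 1 (by decide)
    have h16 : s'.nat 16 = s.nat 16 := by simpa using hf.nat 16 (by decide)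
    simp [h1] at hc
    simp [h16, h2]
    refine ⟨by omega, by omega, fun h => ?_, fun h => ?_⟩
    · and_intros <;> try omega
      · rw [seg_succ, seg_update_of_le (by omega), hs, seg_succ]
        simp [h]
      · intro i hi
        rw [Function.update_of_ne (by omega), h2 i (by omega)]
    · and_intros <;> try omega
      · rw [hs, seg_succ]
        simp [h]
      · intro i hi
        exact h2 i (by omega)
  · rintro s' k' hf ⟨hi, hj, hs, h2, hk'⟩ hc
    have h1 : s'.nat 1 = s.nat 1 := by simpa using hf.nat 1 (by decide)
    simp [h1] at hc ⊢
    rw [show s'.nat 7 0 = s.nat 1 0 by omega] at hs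
    exact ⟨by omega, by omega, by omega, hs, by omega⟩

/-- Peels off the outermost convex layer. -/
def roundProg : Prog :=
  block [chainProg (.load 2 (nvar 7)), moveProg,
    chainProg (.load 2 (.sub (nvar 1) (.add (nvar 7) (.lit 1)))), moveProg,
    incr 15, .natStore 14 (nvar 15) (nvar 13), compactProg]

theorem reverse_seg (f : ℕ → ℕ) (n : ℕ) :
    (seg f 0 n).reverse = seg (fun i => f (n - (i + 1))) 0 n := by
  refine List.ext_getElem (by simp) fun i h₁ h₂ => ?_
  simp at h₁
  rw [List.getElem_reverse, getElem_seg, getElem_seg]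
  simp only [length_seg, Nat.zero_add]
  congr 1
  omega

-- The marks play two roles: at the second move they filter from the upper chain what the lower
-- chain has already contributed, as in `layer`, and at the compaction they single out `inner`.
-- Disjointness from `S` ensures that marks from earlier layers do not interfere.
set_option maxRecDepth 4000 in
theorem roundProg_runs (s : State) (k : ℕ) (l S : List ℕ) (hl : seg (s.nat 2) 0 (s.nat 1 0) = l)
    (hS : seg (s.nat 12) 0 (s.nat 13 0) = S) (hm : Marked s) (hnd : l.Nodup)
    (hd : ∀ a ∈ l, a ∉ S) (hk : 1100 * (l.length + 1) ≤ k) :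
    Runs roundProg s k fun s' k' =>
      seg (s'.nat 2) 0 (s'.nat 1 0) = inner (s.real 0) (s.real 1) l ∧
      seg (s'.nat 12) 0 (s'.nat 13 0) = S ++ layer (s.real 0) (s.real 1) l ∧ Marked s' ∧
      (∀ i < s.nat 13 0, s'.nat 12 i = s.nat 12 i) ∧ s'.nat 15 0 = s.nat 15 0 + 1 ∧
      s'.nat 14 = Function.update (s.nat 14) (s.nat 15 0 + 1) (s'.nat 13 0) ∧
      k ≤ k' + 1100 * (l.length + 1) := by
  set x := s.real 0
  set y := s.real 1
  have hN : s.nat 1 0 = l.length := by simp [← hl]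
  simp only [roundProg, runs_block_cons]
  refine (chainProg_runs _ (by simp) (s.nat 2) s k (fun s' _ h => by simp [h]) (by omega)).mono ?_
  rintro s₁ k₁ hf₁ ⟨hZ₁, hk₁⟩
  rw [hl] at hZ₁
  have hr₁ : s₁.real = s.real := by
    funext a
    exact hf₁.real a (by simp [Prog.realVars, block, set, incr, popProg, chainProg])
  have hz₁ : s₁.nat 18 0 ≤ l.length := by
    rw [← length_seg (s₁.nat 17) 0 (s₁.nat 18 0), hZ₁]
    exact (lowPart_sublist x y l).length_le
  have hS₁ : seg (s₁.nat 12) 0 (s₁.nat 13 0) = S := by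
    rw [hf₁.nat 12 (by decide), hf₁.nat 13 (by decide), hS]
  refine (moveProg_runs s₁ k₁ ?_ ?_ (by omega)).mono ?_
  · intro v
    rw [hf₁.nat 16 (by decide), hf₁.nat 12 (by decide), hf₁.nat 13 (by decide)]
    exact hm v
  · rw [hZ₁]
    exact hnd.sublist (lowPart_sublist x y l)
  rintro s₂ k₂ hf₂ ⟨hm₂, hS₂, hp₂, hk₂⟩
  -- None of the remaining points was listed before, so the first move takes the entire lower chain.
  rw [hS₁, hZ₁, List.filter_eq_self.2 fun a ha => by
    simpa using hd a ((lowPart_sublist x y l).subset ha)] at hS₂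
  have hr₂ : s₂.real = s.real := by
    rw [← hr₁]
    funext a; exact hf₂.real a (by simp [Prog.realVars, block, set, incr, moveProg])
  have h1₂ : s₂.nat 1 = s.nat 1 := (hf₂.nat 1 (by decide)).trans (hf₁.nat 1 (by decide))
  have h2₂ : s₂.nat 2 = s.nat 2 := (hf₂.nat 2 (by decide)).trans (hf₁.nat 2 (by decide))
  refine (chainProg_runs _ (by simp) (fun i => s.nat 2 (s.nat 1 0 - (i + 1))) s₂ k₂
    (fun s' h h' => by simp [h, h', h1₂, h2₂]) (by rw [h1₂]; omega)).mono ?_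
  rintro s₃ k₃ hf₃ ⟨hZ₃, hk₃⟩
  have hup : upPart x y l = lowPart x y l.reverse := rfl
  rw [h1₂, ← reverse_seg, hl, hr₂, ← hup] at hZ₃
  rw [h1₂] at hk₃
  have hr₃ : s₃.real = s.real := by
    rw [← hr₂]
    funext a
    exact hf₃.real a (by simp [Prog.realVars, block, set, incr, popProg, chainProg])
  have hz₃ : s₃.nat 18 0 ≤ l.length := by
    rw [← length_seg (s₃.nat 17) 0 (s₃.nat 18 0), hZ₃]
    simpa using (upPart_sublist x y l).length_le
  have hS₃ : seg (s₃.nat 12) 0 (s₃.nat 13 0) = S ++ lowPart x y l := by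
    rw [hf₃.nat 12 (by decide), hf₃.nat 13 (by decide), hS₂]
  refine (moveProg_runs s₃ k₃ ?_ ?_ (by omega)).mono ?_
  · intro v
    rw [hf₃.nat 16 (by decide), hf₃.nat 12 (by decide), hf₃.nat 13 (by decide)]
    exact hm₂ v
  · rw [hZ₃]
    exact (List.nodup_reverse.2 hnd).sublist (upPart_sublist x y l)
  rintro s₄ k₄ hf₄ ⟨hm₄, hS₄, hp₄, hk₄⟩
  have hS₄' : seg (s₄.nat 12) 0 (s₄.nat 13 0) = S ++ layer x y l := by
    rw [hS₄, hS₃, hZ₃, layer, List.append_assoc]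
    congr 2
    refine List.filter_congr fun a ha => ?_
    have := hd a (List.mem_reverse.1 ((upPart_sublist x y l).subset ha))
    simp [this]
  have hr₄ : s₄.real = s.real := by
    rw [← hr₃]
    funext a; exact hf₄.real a (by simp [Prog.realVars, block, set, incr, moveProg])
  have h1₄ : s₄.nat 1 = s.nat 1 :=
    (hf₄.nat 1 (by decide)).trans ((hf₃.nat 1 (by decide)).trans h1₂)
  have h2₄ : s₄.nat 2 = s.nat 2 :=
    (hf₄.nat 2 (by decide)).trans ((hf₃.nat 2 (by decide)).trans h2₂)
  have h14₄ : s₄.nat 14 = s.nat 14 := (hf₄.nat 14 (by decide)).trans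
    ((hf₃.nat 14 (by decide)).trans ((hf₂.nat 14 (by decide)).trans (hf₁.nat 14 (by decide))))
  have h15₄ : s₄.nat 15 = s.nat 15 := (hf₄.nat 15 (by decide)).trans
    ((hf₃.nat 15 (by decide)).trans ((hf₂.nat 15 (by decide)).trans (hf₁.nat 15 (by decide))))
  have hlen₂ : s.nat 13 0 ≤ s₂.nat 13 0 := by
    have h := congrArg List.length hS₂
    rw [← hS] at h
    simp at h
    omega
  simp only [runs_incr, runs_natStore, nvar_cost]
  refine ⟨by omega, by omega, (compactProg_runs _ _ ?_).mono ?_⟩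
  · simp [h1₄]
    omega
  rintro s₅ k₅ hf₅ ⟨h₅, hk₅⟩
  have h12₅ : s₅.nat 12 = s₄.nat 12 := by simpa using hf₅.nat 12 (by decide)
  have h13₅ : s₅.nat 13 = s₄.nat 13 := by simpa using hf₅.nat 13 (by decide)
  have h14₅ := hf₅.nat 14 (by decide)
  have h15₅ := hf₅.nat 15 (by decide)
  have h16₅ : s₅.nat 16 = s₄.nat 16 := by simpa using hf₅.nat 16 (by decide)
  simp [h1₄, h2₄] at h₅ hk₅
  simp [h14₄, h15₄] at h14₅ h15₅
  simp only [runs_block_nil]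
  refine ⟨by omega, ?_, by rw [h12₅, h13₅, hS₄'], ?_, ?_, by simp [h15₅], by rw [h14₅, h13₅],
    by omega⟩
  · rw [h₅, hl, inner]
    refine List.filter_congr fun a ha => ?_
    have h₁ := hm₄ a
    rw [hS₄', List.mem_append, not_or, and_iff_right (hd a ha)] at h₁
    simp [h₁]
  · intro v
    rw [h16₅, h12₅, h13₅]
    exact hm₄ v
  · intro i hi
    rw [h12₅, hp₄ i (by rw [hf₃.nat 13 (by decide)]; omega), hf₃.nat 12 (by decide),
      hp₂ i (by rwa [hf₁.nat 13 (by decide)]), hf₁.nat 12 (by decide)]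

/-- Peels off convex layers until no point is left. -/
def roundsProg : Prog := .loop (ltTest (.lit 0) (nvar 1)) roundProg

theorem roundsProg_runs (s : State) (k n : ℕ) (l : List ℕ)
    (hl : seg (s.nat 2) 0 (s.nat 1 0) = l) (hln : l.length ≤ n) (hnd : l.Nodup) (h13 : s.nat 13 0 = 0)
    (h14 : s.nat 14 0 = 0) (h15 : s.nat 15 0 = 0) (h16 : ∀ v, s.nat 16 v = 0)
    (hk : 1200 * (n + 1) * (layers (s.real 0) (s.real 1) l).length + 20 ≤ k) :
    Runs roundsProg s k fun s' k' =>
      QRep (s'.nat 14) (s'.nat 12) 0 (layers (s.real 0) (s.real 1) l) ∧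
      s'.nat 14 0 = 0 ∧ s'.nat 15 0 = (layers (s.real 0) (s.real 1) l).length ∧
      k ≤ k' + (1200 * (n + 1) * (layers (s.real 0) (s.real 1) l).length + 20) := by
  generalize hx : s.real 0 = x at *
  generalize hy : s.real 1 = y at *
  obtain ⟨C, hC⟩ : ∃ C, C = 1200 * (n + 1) := ⟨_, rfl⟩
  rw [← hC] at hk ⊢
  -- Each round costs at most `C`, a bound linear in the number of all points, and produces one
  -- layer.
  refine Runs.loop (fun s' k' => ∃ (Ls : List (List ℕ)) (l' : List ℕ),
    layers x y l = Ls ++ layers x y l' ∧ seg (s'.nat 2) 0 (s'.nat 1 0) = l' ∧ l'.Sublist l ∧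
    QRep (s'.nat 14) (s'.nat 12) 0 Ls ∧ s'.nat 14 0 = 0 ∧ s'.nat 15 0 = Ls.length ∧
    seg (s'.nat 12) 0 (s'.nat 13 0) = Ls.flatten ∧ Marked s' ∧ (∀ a ∈ l', a ∉ Ls.flatten) ∧
    k ≤ k' + C * Ls.length) ?_ ?_ ?_
  · exact ⟨[], l, rfl, hl, .refl _, trivial, h14, h15, by simp [h13], by simp [Marked, h13, h16],
      by simp, by simp⟩
  · rintro s' k' hf ⟨Ls, l', hL, hl', hsub, hR, h14, h15, h12, hm, hd, hk'⟩ hc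
    have hr : s'.real = s.real := by
      funext a
      exact hf.real a (by
        simp [Prog.realVars, block, set, incr, popProg, chainProg, roundProg, moveProg, compactProg])
    have hl'len : s'.nat 1 0 = l'.length := by simp [← hl']
    have hne : l' ≠ [] := by
      rintro rfl
      simp [hl'len] at hc
    rw [layers_of_ne_nil x y hne] at hL
    have hlen := congrArg List.length hL
    rw [List.length_append, List.length_cons] at hlen
    have hle := hsub.length_le
    rw [hlen, Nat.mul_add, Nat.mul_add, mul_one] at hk
    simp only [ltTest_cost, NatExpr.cost, nvar_cost]
    refine ⟨by omega, (roundProg_runs s' _ l' _ hl' h12 hm (hnd.sublist hsub) hd ?_).mono ?_⟩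
    · omega
    rintro s'' k'' hf' ⟨h₁, h₂, h₃, h₄, h₅, h₆, h₇⟩
    rw [hr, hx, hy] at h₁ h₂
    have hE : s'.nat 13 0 = Ls.flatten.length := by simp [← h12]
    have hend := hR.end_eq
    rw [h14, Nat.zero_add, Nat.zero_add] at hend
    refine ⟨Ls ++ [layer x y l'], inner x y l', ?_, h₁, (inner_sublist x y l').trans hsub, ?_, ?_, ?_,
      ?_, h₃, ?_, ?_⟩
    · rw [hL]
      simp
    · rw [qRep_concat, Nat.zero_add, h₆, h15]
      have h13'' : s''.nat 13 0 = Ls.flatten.length + (layer x y l').length := by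
        simpa using congrArg List.length h₂
      refine ⟨hR.congr (fun i hi => Function.update_of_ne (by omega) _ _) fun i hi => h₄ i ?_, ?_, ?_⟩
      · rwa [Nat.zero_add, hend, ← hE] at hi
      · simp [hend, h13'']
      · rw [Function.update_of_ne (by omega), hend]
        rw [h13'', seg_add, Nat.zero_add] at h₂
        exact (List.append_inj h₂ (by simp)).2
    · rw [h₆, Function.update_of_ne (by omega), h14]
    · simp [h₅, h15]
    · simp [h₂]
    · intro a ha
      simp [inner] at ha
      simp only [List.flatten_append, List.flatten_singleton, List.mem_append, not_or]
      exact ⟨hd a ha.1, ha.2⟩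
    · rw [List.length_append, List.length_singleton, Nat.mul_add, mul_one]
      omega
  · rintro s' k' hf ⟨Ls, l', hL, hl', hsub, hR, h14, h15, h12, hm, hd, hk'⟩ hc
    have hl'len : s'.nat 1 0 = l'.length := by simp [← hl']
    obtain rfl : l' = [] := by
      simp [hl'len] at hc
      exact hc
    simp at hL
    rw [hL] at hk ⊢
    simp only [ltTest_cost, NatExpr.cost, nvar_cost]
    exact ⟨by omega, hR, h14, h15, by omega⟩

end RealRAM

/-! ### The program for all layers and its output. -/

namespace RealRAM

/-- Prepares the lexicographic sorting of all points. -/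
def initProg : Prog :=
  block [set 1 (nvar 0), set 7 (.lit 0),
    .loop (ltTest (nvar 7) (nvar 0)) (block [
      .natStore 2 (nvar 7) (nvar 7), .realStore 2 (nvar 7) (.load 0 (nvar 7)),
      .realStore 3 (nvar 7) (.load 1 (nvar 7)), incr 7])]

theorem initProg_runs (s : State) (k : ℕ) (hk : 100 * (s.nat 0 0 + 1) ≤ k) :
    Runs initProg s k fun s' k' =>
      seg (s'.nat 2) 0 (s.nat 0 0) = List.range (s.nat 0 0) ∧ s'.nat 1 0 = s.nat 0 0 ∧
      (∀ u < s.nat 0 0, key s'.real u = pos (s.real 0) (s.real 1) u) ∧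
      k ≤ k' + 100 * (s.nat 0 0 + 1) := by
  simp only [initProg, runs_block_cons, runs_set, NatExpr.cost, nvar_cost]
  refine ⟨by omega, by omega, ?_⟩
  refine Runs.loop (fun s' k' => s'.nat 7 0 ≤ s.nat 0 0 ∧
    seg (s'.nat 2) 0 (s'.nat 7 0) = List.range (s'.nat 7 0) ∧
    (∀ u < s'.nat 7 0, key s'.real u = pos (s.real 0) (s.real 1) u) ∧
    k ≤ k' + 100 * s'.nat 7 0 + 20) ?_ ?_ ?_
  · refine ⟨by simp, by simp, by simp, by simp; omega⟩
  · rintro s' k' hf ⟨hi, hs, hr, hk'⟩ hc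
    have h0 : s'.nat 0 = s.nat 0 := by simpa using hf.nat 0 (by decide)
    have hr0 : s'.real 0 = s.real 0 := by simpa using hf.real 0 (by decide)
    have hr1 : s'.real 1 = s.real 1 := by simpa using hf.real 1 (by decide)
    simp [h0] at hc
    simp [hr0, hr1]
    and_intros <;> try omega
    · rw [seg_succ, seg_update_of_le (by omega), hs, List.range_succ]
      simp
    · intro u hu
      rcases hu.lt_or_eq with hu | rfl
      · rw [← hr u hu]
        simp [key, Function.update_of_ne hu.ne]
      · simp [key, pos]
  · rintro s' k' hf ⟨hi, hs, hr, hk'⟩ hc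
    have h0 : s'.nat 0 = s.nat 0 := by simpa using hf.nat 0 (by decide)
    have h1 : s'.nat 1 0 = s.nat 0 0 := by simpa using congrFun (hf.nat 1 (by decide)) 0
    simp [h0] at hc ⊢
    rw [show s'.nat 7 0 = s.nat 0 0 by omega] at hs hr
    exact ⟨by omega, by omega, hs, h1, hr, by omega⟩

/-- Computes all convex layers; they are stored in array `12`, with boundaries in array `14` and
their number in variable `15`. -/
def layersProg : Prog := block [initProg, sortProg, roundsProg]

/-- A bound for the running time of `layersProg` for `n` points with `m` layers. -/
def layersCost (n m : ℕ) : ℕ := sortCost n n + 1200 * (n + 1) * m + 100 * n + 200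

/-- The sorted list is only known through the specification of the sort. The time bound must be
fixed in advance, hence the hypothesis `hm` that every sorted list of the points has `m` layers. -/
theorem layersProg_runs (s : State) (k n m : ℕ) (hn : s.nat 0 0 = n)
    (h0 : ∀ a i, a ≠ 0 → s.nat a i = 0)
    (hinj : ∀ i < n, ∀ j < n, pos (s.real 0) (s.real 1) i = pos (s.real 0) (s.real 1) j → i = j)
    (hm : ∀ l : List ℕ,
      l.Pairwise (fun a b => pos (s.real 0) (s.real 1) a < pos (s.real 0) (s.real 1) b) →
      l.Perm (List.range n) → (layers (s.real 0) (s.real 1) l).length = m)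
    (hk : layersCost n m ≤ k) :
    Runs layersProg s k fun s' k' => ∃ l : List ℕ,
      l.Pairwise (fun a b => pos (s.real 0) (s.real 1) a < pos (s.real 0) (s.real 1) b) ∧
      l.Perm (List.range n) ∧
      QRep (s'.nat 14) (s'.nat 12) 0 (layers (s.real 0) (s.real 1) l) ∧ s'.nat 14 0 = 0 ∧
      s'.nat 15 0 = m ∧ k ≤ k' + layersCost n m := by
  subst hn
  unfold layersCost at hk
  simp only [layersProg, runs_block_cons, runs_block_nil]
  refine (initProg_runs s k (by omega)).mono ?_
  rintro s₁ k₁ hf₁ ⟨hs₁, hN₁, hr₁, hk₁⟩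
  have hz : ∀ a, a ≠ 0 → a ∉ layersProg.natVars → ∀ i, s₁.nat a i = 0 := by
    intro a ha ha' i
    rw [hf₁.nat a (fun h => ha' (List.mem_append_left _ h)), h0 a i ha]
  generalize s.nat 0 0 = n at *
  refine (sortProg_runs s₁ k₁ n ?_ (by rw [hN₁]; omega)).mono ?_
  -- For the lexicographic sort no structure is known; the trivial bound by the length gives the
  -- usual `n log n`.
  · refine (descents_le_length _ _).trans ?_
    rw [(rearrange_perm _ _ _).length_eq, length_seg, hN₁]
  rintro s₂ k₂ hf₂ ⟨hp₂, hs₂, hk₂⟩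
  have hN₂ : s₂.nat 1 0 = n := by rw [hf₂.nat 1 (by decide), hN₁]
  rw [hN₁] at hp₂ hs₂ hk₂
  rw [hs₁] at hp₂
  have hx : s₂.real 0 = s.real 0 := by rw [hf₂.real 0 (by decide), hf₁.real 0 (by decide)]
  have hy : s₂.real 1 = s.real 1 := by rw [hf₂.real 1 (by decide), hf₁.real 1 (by decide)]
  have hnd : (seg (s₂.nat 2) 0 n).Nodup := hp₂.nodup_iff.2 List.nodup_range
  have hlt : ∀ a ∈ seg (s₂.nat 2) 0 n, a < n := fun a ha => by
    simpa using hp₂.subset ha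
  have hsort : (seg (s₂.nat 2) 0 n).Pairwise
      fun a b => pos (s.real 0) (s.real 1) a < pos (s.real 0) (s.real 1) b := by
    refine (hs₂.and hnd).imp_of_mem fun {a b} ha hb hab => ?_
    have h := hab.1
    rw [hr₁ a (hlt a ha), hr₁ b (hlt b hb)] at h
    exact lt_of_le_of_ne h fun h' => hab.2 (hinj a (hlt a ha) b (hlt b hb) h')
  have hzero : ∀ a, a = 13 ∨ a = 14 ∨ a = 15 ∨ a = 16 → ∀ i, s₂.nat a i = 0 := by
    rintro a (rfl | rfl | rfl | rfl) i <;>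
      rw [hf₂.nat _ (by decide), hf₁.nat _ (by decide), h0 _ _ (by decide)]
  have hlm := hm _ hsort hp₂
  refine (roundsProg_runs s₂ k₂ n (seg (s₂.nat 2) 0 n) (by rw [hN₂]) (by simp) hnd
    (hzero 13 (by simp) 0) (hzero 14 (by simp) 0) (hzero 15 (by simp) 0)
    (fun v => hzero 16 (by simp) v) ?_).mono ?_
  · rw [hx, hy, hlm]
    omega
  rintro s₃ k₃ hf₃ ⟨h₁, h₂, h₃, h₄⟩
  rw [hx, hy] at h₁ h₃ h₄
  rw [hlm] at h₃ h₄
  refine ⟨by omega, _, hsort, hp₂, h₁, h₂, h₃, ?_⟩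
  unfold layersCost
  omega

/-- Lists of numbers, each one preceded by its length. -/
def encodeNat (L : List (List ℕ)) : List ℕ := L.flatMap fun l => l.length :: l

theorem encodeNat_append (L L' : List (List ℕ)) :
    encodeNat (L ++ L') = encodeNat L ++ encodeNat L' := List.flatMap_append

@[simp] theorem encodeNat_singleton (l : List ℕ) : encodeNat [l] = l.length :: l := by
  simp [encodeNat]

/-- Outputs the entries of array `a` from the position in variable `8` to that before `e`. -/
def emitSegProg (a : ℕ) (e : NatExpr) : Prog :=
  .loop (ltTest (nvar 8) e) (block [.emit (.load a (nvar 8)), incr 8])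

theorem emitSegProg_runs (a : ℕ) (e : NatExpr) (he : e.cost ≤ 20) (ha : a ≠ 8) (s : State)
    (k v : ℕ) (hv : ∀ s' : State, (∀ a, a ≠ 8 → s'.nat a = s.nat a) → e.eval s' = v)
    (h : s.nat 8 0 ≤ v) (hk : 50 * (v - s.nat 8 0 + 1) ≤ k) :
    Runs (emitSegProg a e) s k fun s' k' =>
      s'.out = s.out ++ seg (s.nat a) (s.nat 8 0) (v - s.nat 8 0) ∧ s'.nat 8 0 = v ∧
      k ≤ k' + 50 * (v - s.nat 8 0 + 1) := by
  refine Runs.loop (fun s' k' => s.nat 8 0 ≤ s'.nat 8 0 ∧ s'.nat 8 0 ≤ v ∧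
    s'.out = s.out ++ seg (s.nat a) (s.nat 8 0) (s'.nat 8 0 - s.nat 8 0) ∧
    k ≤ k' + 50 * (s'.nat 8 0 - s.nat 8 0)) ?_ ?_ ?_
  · simpa using h
  · rintro s' k' hf ⟨hi, hiv, ho, hk'⟩ hc
    have hs : ∀ a, a ≠ 8 → s'.nat a = s.nat a := fun a ha => by
      simpa using hf.nat a (by simpa [Prog.natVars, block, incr, set] using ha)
    simp [hv s' hs] at hc
    simp [hs a ha]
    and_intros <;> try omega
    rw [ho, show s'.nat 8 0 + 1 - s.nat 8 0 = (s'.nat 8 0 - s.nat 8 0) + 1 by omega, seg_succ,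
      show s.nat 8 0 + (s'.nat 8 0 - s.nat 8 0) = s'.nat 8 0 by omega, List.append_assoc]
  · rintro s' k' hf ⟨hi, hiv, ho, hk'⟩ hc
    have hs : ∀ a, a ≠ 8 → s'.nat a = s.nat a := fun a ha => by
      simpa using hf.nat a (by simpa [Prog.natVars, block, incr, set] using ha)
    simp [hv s' hs] at hc ⊢
    have hiv' : s'.nat 8 0 = v := by omega
    rw [hiv'] at ho hk'
    exact ⟨by omega, ho, hiv', by omega⟩

/-- Outputs the convex layers. -/
def emitProg : Prog :=
  block [set 7 (.lit 0), set 8 (.lit 0),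
    .loop (ltTest (nvar 7) (nvar 15)) (block [
      .emit (.sub (.load 14 (.add (nvar 7) (.lit 1))) (.load 14 (nvar 7))),
      emitSegProg 12 (.load 14 (.add (nvar 7) (.lit 1))), incr 7])]

theorem emitProg_runs (s : State) (k : ℕ) (L : List (List ℕ))
    (hL : QRep (s.nat 14) (s.nat 12) 0 L) (h14 : s.nat 14 0 = 0) (h15 : s.nat 15 0 = L.length)
    (hk : 200 * (L.length + L.flatten.length + 1) ≤ k) :
    Runs emitProg s k fun s' k' => s'.out = s.out ++ encodeNat L ∧
      k ≤ k' + 200 * (L.length + L.flatten.length + 1) := by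
  simp only [emitProg, runs_block_cons, runs_set, NatExpr.cost, runs_block_nil]
  refine ⟨by omega, by omega, ?_⟩
  refine Runs.loop (fun s' k' => ∃ Ls Ls' : List (List ℕ), L = Ls ++ Ls' ∧
    s'.nat 7 0 = Ls.length ∧ s'.nat 8 0 = s.nat 14 Ls.length ∧
    QRep (s.nat 14) (s.nat 12) Ls.length Ls' ∧ s'.out = s.out ++ encodeNat Ls ∧
    k ≤ k' + 200 * Ls.length + 50 * s.nat 14 Ls.length + 20 ∧
    s.nat 14 Ls.length + Ls'.flatten.length = L.flatten.length) ?_ ?_ ?_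
  · exact ⟨[], L, rfl, by simp, by simp [h14], hL, by simp [encodeNat], by simp; omega, by simp [h14]⟩
  · rintro s' k' hf ⟨Ls, Ls', rfl, h7, h8, hR, ho, hk', hlen⟩ hc
    have h14' : s'.nat 14 = s.nat 14 := by simpa using hf.nat 14 (by decide)
    have h12' : s'.nat 12 = s.nat 12 := by simpa using hf.nat 12 (by decide)
    have h15' : s'.nat 15 = s.nat 15 := by simpa using hf.nat 15 (by decide)
    simp [h15', h15, h7] at hc
    match Ls', hc, hR with
    | l :: Ls', hc, hR =>
      obtain ⟨h₁, h₂, h₃⟩ := hR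
      rw [List.flatten_cons, List.length_append] at hlen
      rw [List.length_append, List.length_cons] at hk
      simp only [runs_block_cons, runs_emit, ltTest_cost, nvar_cost, NatExpr.cost]
      refine ⟨by omega, by omega, ?_⟩
      refine (emitSegProg_runs 12 _ (by simp) (by decide) _ _ (s.nat 14 Ls.length + l.length)
        (fun s'' h => ?_) ?_ ?_).mono ?_
      · have h₇ := h 7 (by decide)
        have h₁₄ := h 14 (by decide)
        simp at h₇ h₁₄
        simp [h₇, h₁₄, h7, h14', h₁]
      · simp [h8]
      · simp only [nat_write, h8, Nat.add_sub_cancel_left]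
        omega
      · rintro s'' k'' hf' ⟨ho', h8', hk''⟩
        have h7' : s''.nat 7 = s'.nat 7 := by simpa using hf'.nat 7 (by decide)
        simp [h8, h7, h14', h12', h₁, h₂, ho] at ho' h8' hk''
        simp [h7', h7, h8']
        and_intros <;> try omega
        refine ⟨Ls ++ [l], Ls', by simp, by simp, by simp [h₁], by simpa using h₃, ?_, ?_, ?_⟩
        · simp [ho', encodeNat_append]
        · simp [h₁]
          omega
        · simp [h₁] at hlen ⊢
          omega
  · rintro s' k' hf ⟨Ls, Ls', rfl, h7, h8, hR, ho, hk', hlen⟩ hc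
    have h15' : s'.nat 15 = s.nat 15 := by simpa using hf.nat 15 (by decide)
    simp [h15', h15, h7] at hc
    subst hc
    simp only [List.append_nil, List.flatten_nil, List.length_nil, Nat.add_zero] at *
    simp only [ltTest_cost, nvar_cost]
    exact ⟨by omega, by omega, ho, by omega⟩

end RealRAM

/-! ### The collinear subsets through a pivot -/

namespace RealRAM

section Congr

variable {α K : Type*} [LinearOrder K] {κ κ' : α → K}

theorem ups_congr {a : α} {l : List α} (h : ∀ b ∈ a :: l, κ b = κ' b) : ups κ a l = ups κ' a l := by
  induction l generalizing a with
  | nil => rfl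
  | cons b l ih =>
    rw [ups, ups, h a (by simp), h b (by simp), ih fun c hc => h c (List.mem_cons_of_mem _ hc)]

theorem downs_congr {a : α} {l : List α} (h : ∀ b ∈ a :: l, κ b = κ' b) :
    downs κ a l = downs κ' a l := by
  induction l generalizing a with
  | nil => rfl
  | cons b l ih =>
    rw [downs, downs, h a (by simp), h b (by simp), ih fun c hc => h c (List.mem_cons_of_mem _ hc)]

theorem descents_congr {l : List α} (h : ∀ b ∈ l, κ b = κ' b) : descents κ l = descents κ' l := by
  induction l with
  | nil => rfl
  | cons a l ih =>
    cases l with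
    | nil => rfl
    | cons b l =>
      rw [descents, descents, h a (by simp), h b (by simp),
        ih fun c hc => h c (List.mem_cons_of_mem _ hc)]

/-- The keys held in memory agree with the slopes only at the points of the current sequence; this
and `reports_congr` transfer results between the two. -/
theorem descents_rearrange_congr {a : α} {l : List α} (h : ∀ b ∈ a :: l, κ b = κ' b) :
    descents κ (rearrange κ a l) = descents κ' (rearrange κ' a l) := by
  have h' : rearrange κ a l = rearrange κ' a l := by
    rw [rearrange, rearrange, ups_congr h, downs_congr h]
  rw [h', descents_congr]
  intro b hb
  exact h b (List.mem_cons_of_mem _ ((rearrange_perm κ' a l).subset hb))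

/-- The maximal blocks of consecutive entries with equal keys, as far as they have at least two
entries and no entry less than `p`; the number `p` is added to each of them. -/
def reports (κ : ℕ → K) (p : ℕ) : List ℕ → List (List ℕ)
  | [] => []
  | a :: l =>
    (if (∀ b ∈ a :: l.takeWhile fun b => κ b = κ a, p ≤ b) ∧
        1 < (a :: l.takeWhile fun b => κ b = κ a).length then
      [p :: a :: l.takeWhile fun b => κ b = κ a] else []) ++
      reports κ p (l.dropWhile fun b => κ b = κ a)
termination_by l => l.length
decreasing_by exact Nat.lt_succ_of_le (List.dropWhile_sublist _).length_le

theorem reports_congr {κ κ' : ℕ → K} (p : ℕ) {l : List ℕ} (h : ∀ b ∈ l, κ b = κ' b) :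
    reports κ p l = reports κ' p l := by
  induction hn : l.length using Nat.strong_induction_on generalizing l with
  | _ n ih =>
    cases l with
    | nil => simp [reports]
    | cons a l =>
      have ha := h a (by simp)
      have h₁ : ∀ l' : List ℕ, (∀ b ∈ l', κ b = κ' b) →
          (l'.takeWhile fun b => κ b = κ a) = (l'.takeWhile fun b => κ' b = κ' a) ∧
          (l'.dropWhile fun b => κ b = κ a) = (l'.dropWhile fun b => κ' b = κ' a) := by
        intro l' hl'
        induction l' with
        | nil => simp
        | cons c l' ih' =>
          obtain ⟨h₁, h₂⟩ := ih' fun b hb => hl' b (List.mem_cons_of_mem _ hb)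
          simp only [List.takeWhile_cons, List.dropWhile_cons, hl' c (by simp), ha] at h₁ h₂ ⊢
          rw [h₁, h₂]
          exact ⟨rfl, rfl⟩
      obtain ⟨h₂, h₃⟩ := h₁ l fun b hb => h b (List.mem_cons_of_mem _ hb)
      have hsub := List.dropWhile_sublist (fun b => decide (κ b = κ a)) (l := l)
      rw [reports, reports, h₂, ← h₃, ih _ ?_ ?_ rfl]
      · have := hsub.length_le
        rw [List.length_cons] at hn
        omega
      · intro b hb
        exact h b (List.mem_cons_of_mem _ (hsub.subset hb))

end Congr

/-- Stores the points other than the pivot in variable `19`, in the order of array `12`, and their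
slopes as seen from the pivot. -/
def slopesProg : Prog :=
  block [set 1 (.lit 0), set 7 (.lit 0),
    .loop (ltTest (nvar 7) (nvar 0)) (block [
      set 8 (.load 12 (nvar 7)),
      .cond (.and (.natLe (nvar 8) (nvar 19)) (.natLe (nvar 19) (nvar 8))) .skip (block [
        .natStore 2 (nvar 1) (nvar 8),
        .cond (.and (.realLe (.load 0 (nvar 8)) (.load 0 (nvar 19)))
            (.realLe (.load 0 (nvar 19)) (.load 0 (nvar 8))))
          (.realStore 2 (nvar 8) (.lit 1)) (.realStore 2 (nvar 8) (.lit 0)),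
        .realStore 3 (nvar 8) (.div (.sub (.load 1 (nvar 8)) (.load 1 (nvar 19)))
          (.sub (.load 0 (nvar 8)) (.load 0 (nvar 19)))),
        incr 1]),
      incr 7])]

/-- The two stored reals are the components of `dirKey`: the flag for a vertical direction and the
quotient, for which the convention of division by zero is the same in the machine and in `dirKey`.
-/
theorem slopesProg_runs (s : State) (k : ℕ) (hk : 200 * (s.nat 0 0 + 1) ≤ k) :
    Runs slopesProg s k fun s' k' =>
      seg (s'.nat 2) 0 (s'.nat 1 0) =
        (seg (s.nat 12) 0 (s.nat 0 0)).filter (fun a => a ≠ s.nat 19 0) ∧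
      (∀ u ∈ seg (s'.nat 2) 0 (s'.nat 1 0),
        key s'.real u = slope (s.real 0) (s.real 1) (s.nat 19 0) u) ∧
      k ≤ k' + 200 * (s.nat 0 0 + 1) := by
  simp only [slopesProg, runs_block_cons, runs_set, NatExpr.cost]
  refine ⟨by omega, by omega, ?_⟩
  set p := s.nat 19 0
  refine Runs.loop (fun s' k' => s'.nat 7 0 ≤ s.nat 0 0 ∧
    seg (s'.nat 2) 0 (s'.nat 1 0) = (seg (s.nat 12) 0 (s'.nat 7 0)).filter (fun a => a ≠ p) ∧
    (∀ u ∈ seg (s'.nat 2) 0 (s'.nat 1 0),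
      key s'.real u = slope (s.real 0) (s.real 1) p u) ∧
    k ≤ k' + 150 * s'.nat 7 0 + 20) ?_ ?_ ?_
  · refine ⟨by simp, by simp, by simp, by simp; omega⟩
  · rintro s' k' hf ⟨hi, hs, hr, hk'⟩ hc
    have h0 : s'.nat 0 = s.nat 0 := by simpa using hf.nat 0 (by decide)
    have h12 : s'.nat 12 = s.nat 12 := by simpa using hf.nat 12 (by decide)
    have h19 : s'.nat 19 0 = p := by simpa using congrFun (hf.nat 19 (by decide)) 0
    have hr0 : s'.real 0 = s.real 0 := by simpa using hf.real 0 (by decide)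
    have hr1 : s'.real 1 = s.real 1 := by simpa using hf.real 1 (by decide)
    simp [h0] at hc
    generalize hv : s.nat 12 (s'.nat 7 0) = v at *
    have hsucc : seg (s.nat 12) 0 (s'.nat 7 0 + 1) = seg (s.nat 12) 0 (s'.nat 7 0) ++ [v] := by
      rw [seg_succ, Nat.zero_add, hv]
    have hnew : ∀ (e : ℝ) (r : ℕ → ℕ → ℝ),
        e = (if s.real 0 v - s.real 0 p = 0 then 1 else 0) →
        r 2 = Function.update (s'.real 2) v e →
        r 3 = Function.update (s'.real 3) v
          ((s.real 1 v - s.real 1 p) / (s.real 0 v - s.real 0 p)) →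
        ∀ u ∈ seg (s'.nat 2) 0 (s'.nat 1 0) ++ [v], key r u = slope (s.real 0) (s.real 1) p u := by
      intro e r he h₂ h₃ u hu
      rw [key, h₂, h₃]
      by_cases huv : u = v
      · rw [huv, Function.update_self, Function.update_self, he]
        rfl
      · rw [Function.update_of_ne huv, Function.update_of_ne huv]
        rw [List.mem_append, List.mem_singleton, or_iff_left huv] at hu
        exact hr u hu
    simp [h12, h19, hr0, hr1, hv]
    refine ⟨by omega, by omega, by omega, fun h₁ h₂ => ?_, fun hne => ?_⟩
    · have hvp : v = p := le_antisymm h₁ h₂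
      and_intros <;> try omega
      · rw [hs, hsucc]
        simp [hvp]
    · have hvp : v ≠ p := fun h => by
        subst h
        exact absurd (hne le_rfl) (lt_irrefl _)
      have hseg : seg (Function.update (s'.nat 2) (s'.nat 1 0) v) 0 (s'.nat 1 0 + 1) =
          seg (s'.nat 2) 0 (s'.nat 1 0) ++ [v] := by
        rw [seg_succ, seg_update_of_le (by omega), Nat.zero_add, Function.update_self]
      rw [hseg]
      refine ⟨by omega, by omega, fun h₁ h₂ => ?_, fun hne => ?_⟩
      · and_intros <;> try omega
        · rw [hs, hsucc]
          simp [hvp]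
        · exact hnew 1 _ (by rw [if_pos (sub_eq_zero.2 (le_antisymm h₁ h₂))]) (by simp) (by simp)
      · and_intros <;> try omega
        · rw [hs, hsucc]
          simp [hvp]
        · refine hnew 0 _ ?_ (by simp) (by simp)
          rw [if_neg]
          intro h
          rw [sub_eq_zero] at h
          exact absurd (hne h.le) (not_lt.2 h.ge)
  · rintro s' k' hf ⟨hi, hs, hr, hk'⟩ hc
    have h0 : s'.nat 0 = s.nat 0 := by simpa using hf.nat 0 (by decide)
    simp [h0] at hc ⊢
    rw [show s'.nat 7 0 = s.nat 0 0 by omega] at hs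
    refine ⟨by omega, by omega, by simpa using hs, hr, by omega⟩

/-- Finds the end of a block of equal keys and compares its entries with the pivot. -/
def scanProg : Prog :=
  .loop (.and (ltTest (nvar 9) (nvar 1))
      (.and (keyLe (.load 2 (nvar 9)) (.load 2 (nvar 8)))
        (keyLe (.load 2 (nvar 8)) (.load 2 (nvar 9)))))
    (block [.cond (ltTest (.load 2 (nvar 9)) (nvar 19)) (set 20 (.lit 1)) .skip, incr 9])

theorem scanProg_runs (s : State) (k a : ℕ) (l : List ℕ)
    (hl : seg (s.nat 2) (s.nat 8 0) (s.nat 1 0 - s.nat 8 0) = a :: l)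
    (h9 : s.nat 9 0 = s.nat 8 0) (h20 : s.nat 20 0 = 0)
    (hk : 100 * ((l.takeWhile fun b => key s.real b = key s.real a).length + 3) ≤ k) :
    Runs scanProg s k fun s' k' =>
      s'.nat 9 0 = s.nat 8 0 + (a :: l.takeWhile fun b => key s.real b = key s.real a).length ∧
      (s'.nat 20 0 = 0 ↔
        ∀ b ∈ a :: l.takeWhile fun b => key s.real b = key s.real a, s.nat 19 0 ≤ b) ∧
      k ≤ k' + 100 * ((l.takeWhile fun b => key s.real b = key s.real a).length + 3) := by
  set κ := key s.real
  set P : ℕ → Bool := fun b => decide (κ b = κ a) with hP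
  set i := s.nat 8 0 with hi
  set N := s.nat 1 0
  have hN : N - i = l.length + 1 := by simpa using congrArg List.length hl
  have hia : s.nat 2 i = a := by
    rw [hN, seg_succ', List.cons.injEq] at hl
    exact hl.1
  have htw : (a :: l).takeWhile P = a :: l.takeWhile P := by simp [P]
  -- The block is the part already scanned followed by the initial entries of the rest with the same
  -- key; the scan stops when the second part is empty.
  refine Runs.loop (fun s' k' => i ≤ s'.nat 9 0 ∧ s'.nat 9 0 ≤ N ∧
    a :: l.takeWhile P = seg (s.nat 2) i (s'.nat 9 0 - i) ++
      (seg (s.nat 2) (s'.nat 9 0) (N - s'.nat 9 0)).takeWhile P ∧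
    (s'.nat 20 0 = 0 ↔ ∀ b ∈ seg (s.nat 2) i (s'.nat 9 0 - i), s.nat 19 0 ≤ b) ∧
    k ≤ k' + 95 * (s'.nat 9 0 - i)) ?_ ?_ ?_
  · rw [h9, hl, htw]
    refine ⟨le_rfl, by omega, by simp, by simp [h20], by omega⟩
  · rintro s' k' hf ⟨hij, hjN, htake, hflag, hk'⟩ hc
    have h1 : s'.nat 1 = s.nat 1 := hf.nat 1 (by decide)
    have h2 : s'.nat 2 = s.nat 2 := hf.nat 2 (by decide)
    have h8 : s'.nat 8 0 = i := congrFun (hf.nat 8 (by decide)) 0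
    have h19 : s'.nat 19 = s.nat 19 := hf.nat 19 (by decide)
    have hr : s'.real = s.real := by
      funext a; exact hf.real a (by simp [Prog.realVars, block, incr, set])
    simp only [Test.Holds, ltTest_holds, keyLe_holds, nvar_eval, NatExpr.eval, h1, h2, h8, hr,
      hia] at hc
    obtain ⟨hjN', hle, hge⟩ := hc
    generalize hj : s'.nat 9 0 = j at *
    have hPj : P (s.nat 2 j) = true := by simpa [P] using le_antisymm hle hge
    have hsucc : seg (s.nat 2) i (j + 1 - i) = seg (s.nat 2) i (j - i) ++ [s.nat 2 j] := by
      rw [show j + 1 - i = j - i + 1 by omega, seg_succ, show i + (j - i) = j by omega]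
    have htake' : a :: l.takeWhile P = seg (s.nat 2) i (j + 1 - i) ++
        (seg (s.nat 2) (j + 1) (N - (j + 1))).takeWhile P := by
      rw [htake, hsucc, show N - j = N - (j + 1) + 1 by omega, seg_succ',
        List.takeWhile_cons_of_pos hPj]
      simp
    have hlen : j - i ≤ (l.takeWhile P).length := by
      have := congrArg List.length htake'
      simp at this
      omega
    simp [h2, h19, hj]
    refine ⟨by omega, by omega, fun h => ?_, fun h => ?_⟩
    · and_intros <;> try omega
      · exact ⟨s.nat 2 j, by rw [hsucc]; simp, h⟩
    · and_intros <;> try omega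
      · rw [hflag, hsucc]
        constructor
        · intro h' b hb
          rcases List.mem_append.1 hb with hb | hb
          · exact h' b hb
          · rw [List.mem_singleton.1 hb]
            exact h
        · intro h' b hb
          exact h' b (by simp [hb])
  · rintro s' k' hf ⟨hij, hjN, htake, hflag, hk'⟩ hc
    have h1 : s'.nat 1 = s.nat 1 := hf.nat 1 (by decide)
    have h2 : s'.nat 2 = s.nat 2 := hf.nat 2 (by decide)
    have h8 : s'.nat 8 0 = i := congrFun (hf.nat 8 (by decide)) 0
    have hr : s'.real = s.real := by
      funext a; exact hf.real a (by simp [Prog.realVars, block, incr, set])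
    simp only [Test.Holds, ltTest_holds, keyLe_holds, nvar_eval, NatExpr.eval, h1, h2, h8, hr,
      hia] at hc
    have hnil : (seg (s.nat 2) (s'.nat 9 0) (N - s'.nat 9 0)).takeWhile P = [] := by
      rcases Nat.eq_zero_or_pos (N - s'.nat 9 0) with h | h
      · rw [h]
        rfl
      · rw [show N - s'.nat 9 0 = N - s'.nat 9 0 - 1 + 1 by omega, seg_succ',
          List.takeWhile_cons_of_neg]
        simp only [P, decide_eq_true_eq]
        intro h'
        exact hc ⟨by omega, h'.le, h'.ge⟩
    rw [hnil, List.append_nil] at htake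
    have hlen := congrArg List.length htake
    rw [length_seg] at hlen
    rw [htake]
    have hlen' := hlen
    rw [List.length_cons] at hlen'
    simp only [Test.cost, ltTest_cost, keyLe_cost, nvar_cost, NatExpr.cost, length_seg]
    exact ⟨by omega, by omega, hflag, by omega⟩

end RealRAM

/-! ### The program for collinear subsets -/

namespace RealRAM

theorem seg_takeWhile {K : Type*} [LinearOrder K] (κ : ℕ → K) {f : ℕ → ℕ}
    {i N a : ℕ} {l : List ℕ} (h : seg f i (N - i) = a :: l) :
    seg f i (a :: l.takeWhile fun b => κ b = κ a).length =
        a :: l.takeWhile (fun b => κ b = κ a) ∧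
      seg f (i + (a :: l.takeWhile fun b => κ b = κ a).length)
        (N - (i + (a :: l.takeWhile fun b => κ b = κ a).length)) =
        l.dropWhile (fun b => κ b = κ a) ∧
      i + (a :: l.takeWhile fun b => κ b = κ a).length ≤ N := by
  set g := a :: l.takeWhile fun b => κ b = κ a with hg
  set r := l.dropWhile fun b => κ b = κ a with hr
  have hgr : a :: l = g ++ r := by simp [hg, hr]
  rw [hgr] at h
  have hlen := congrArg List.length h
  rw [length_seg, List.length_append] at hlen
  have hpos : 0 < g.length := by simp [hg]
  rw [hlen, seg_add] at h
  obtain ⟨h₁, h₂⟩ := List.append_inj h (by simp)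
  refine ⟨h₁, ?_, by omega⟩
  rw [show N - (i + g.length) = r.length by omega, h₂]

/-- Reports the blocks of equal keys in the list that starts at position `0` of array `2`. -/
def groupsProg : Prog :=
  block [set 8 (.lit 0),
    .loop (ltTest (nvar 8) (nvar 1)) (block [
      set 9 (nvar 8), set 20 (.lit 0), scanProg,
      .cond (.and (.natLe (nvar 20) (.lit 0)) (ltTest (.add (nvar 8) (.lit 1)) (nvar 9)))
        (block [.emit (.add (.sub (nvar 9) (nvar 8)) (.lit 1)), .emit (nvar 19),
          emitSegProg 2 (nvar 9)])
        (set 8 (nvar 9))])]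

theorem groupsProg_runs (s : State) (k : ℕ) (hk : 900 * (s.nat 1 0 + 1) ≤ k) :
    Runs groupsProg s k fun s' k' =>
      s'.out = s.out ++ encodeNat (reports (key s.real) (s.nat 19 0)
        (seg (s.nat 2) 0 (s.nat 1 0))) ∧
      k ≤ k' + 900 * (s.nat 1 0 + 1) := by
  simp only [groupsProg, runs_block_cons, runs_set, NatExpr.cost, runs_block_nil]
  refine ⟨by omega, ?_⟩
  set p := s.nat 19 0
  set N := s.nat 1 0
  set κ := key s.real
  -- What has been written, followed by the reports for the unread rest, does not change. Both
  -- branches leave variable `8` at the end of the block just scanned.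
  refine Runs.loop (fun s' k' => s'.nat 8 0 ≤ N ∧
    s'.out ++ encodeNat (reports κ p (seg (s.nat 2) (s'.nat 8 0) (N - s'.nat 8 0))) =
      s.out ++ encodeNat (reports κ p (seg (s.nat 2) 0 N)) ∧
    k ≤ k' + 800 * s'.nat 8 0 + 10) ?_ ?_ ?_
  · simp
    omega
  · rintro s' k' hf ⟨hi, ho, hk'⟩ hc
    have h1 : s'.nat 1 = s.nat 1 := by simpa using hf.nat 1 (by decide)
    have h2 : s'.nat 2 = s.nat 2 := by simpa using hf.nat 2 (by decide)
    have h19 : s'.nat 19 = s.nat 19 := by simpa using hf.nat 19 (by decide)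
    have hr : s'.real = s.real := by
      funext a
      simpa using hf.real a (by simp [Prog.realVars, block, incr, set, scanProg, emitSegProg])
    simp only [ltTest_holds, nvar_eval, h1] at hc
    generalize hi' : s'.nat 8 0 = i at *
    change i < N at hc
    obtain ⟨a, l, hal⟩ : ∃ a l, seg (s.nat 2) i (N - i) = a :: l :=
      ⟨_, _, by rw [show N - i = N - i - 1 + 1 by omega, seg_succ']⟩
    obtain ⟨hg, hrest, hle⟩ := seg_takeWhile κ hal
    rw [hal, reports, ← hrest, encodeNat_append] at ho
    simp only [runs_block_cons, runs_set, ltTest_cost, nvar_cost]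
    refine ⟨by omega, by omega, by simp; omega, ?_⟩
    refine (scanProg_runs _ _ a l ?_ ?_ ?_ ?_).mono ?_
    · simpa [h1, h2, hi'] using hal
    · simp
    · simp
    · simp only [real_setNat, hr, NatExpr.cost]
      rw [List.length_cons] at hle
      change 100 * ((l.takeWhile fun b => κ b = κ a).length + 3) ≤ _
      omega
    rintro s'' k'' hf' ⟨h9, h20, hk''⟩
    have h8' : s''.nat 8 0 = i := by simpa [hi'] using congrFun (hf'.nat 8 (by decide)) 0
    have h2' : s''.nat 2 = s.nat 2 := by simpa [h2] using hf'.nat 2 (by decide)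
    have h19' : s''.nat 19 0 = p := by simpa [h19] using congrFun (hf'.nat 19 (by decide)) 0
    have ho' : s''.out = s'.out := by simpa using hf'.out (by decide)
    simp only [real_setNat, hr, NatExpr.cost] at h9 h20 hk''
    rw [show key s.real = κ from rfl] at h9 h20 hk''
    set g := a :: l.takeWhile fun b => κ b = κ a with hgdef
    have hlen : (l.takeWhile fun b => κ b = κ a).length + 1 = g.length := by simp [hgdef]
    simp only [nat_setNat_of_ne _ _ _ (show (8 : ℕ) ≠ 20 by decide),
      nat_setNat_of_ne _ _ _ (show (8 : ℕ) ≠ 9 by decide), hi'] at h9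
    have h20' : s''.nat 20 0 = 0 ↔ ∀ b ∈ g, p ≤ b := by
      simpa [h19] using h20
    simp only [runs_cond, runs_block_cons, runs_emit, runs_block_nil, Test.cost, NatExpr.cost,
      ltTest_cost, nvar_cost, runs_set]
    refine ⟨by omega, fun hyes => ?_, fun hno => ?_⟩
    · simp only [Test.Holds, nvar_eval, NatExpr.eval, ltTest_holds, h8', h9, Nat.le_zero, h20']
        at hyes
      rw [if_pos ⟨hyes.1, by omega⟩] at ho
      refine ⟨by omega, by omega, ?_⟩
      refine (emitSegProg_runs 2 _ (by simp) (by decide) _ _ (i + g.length)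
        (fun t ht => ?_) ?_ ?_).mono ?_
      · simpa [h9] using congrFun (ht 9 (by decide)) 0
      · simp [h8']
      · simp only [nat_write, h8', Nat.add_sub_cancel_left]
        omega
      rintro t kt hft ⟨hot, h8t, hkt⟩
      simp only [nat_write, h8', Nat.add_sub_cancel_left, out_write, h2', hg, ho', nvar_eval,
        NatExpr.eval, h9, h19'] at hot h8t hkt
      rw [h8t]
      refine ⟨by omega, by omega, by omega, ?_, by omega⟩
      rw [hot, ← ho]
      simp
    · simp only [Test.Holds, nvar_eval, NatExpr.eval, ltTest_holds, h8', h9, Nat.le_zero, h20']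
        at hno
      rw [if_neg (fun h => hno ⟨h.1, by omega⟩)] at ho
      refine ⟨by omega, ?_⟩
      simp only [nvar_eval, h9, nat_setNat_self, Function.update_self, out_setNat, ho']
      refine ⟨by omega, by omega, ?_, by omega⟩
      rw [← ho]
      simp [encodeNat]
  · rintro s' k' hf ⟨hi, ho, hk'⟩ hc
    have h1 : s'.nat 1 = s.nat 1 := by simpa using hf.nat 1 (by decide)
    simp only [ltTest_holds, nvar_eval, h1] at hc
    have : s'.nat 8 0 = N := by omega
    rw [this] at ho hk'
    simp only [ltTest_cost, nvar_cost]
    refine ⟨by omega, by omega, ?_, by omega⟩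
    rw [← ho]
    simp [encodeNat, reports]

/-- Reports the collinear subsets through all pivots. -/
def pivotsProg : Prog :=
  block [set 19 (.lit 0),
    .loop (ltTest (nvar 19) (nvar 0)) (block [slopesProg, sortProg, groupsProg, incr 19])]

theorem sortCost_mono_left {m n d : ℕ} (h : m ≤ n) : sortCost m d ≤ sortCost n d := by
  unfold sortCost
  gcongr

-- The sorted lists `σ p` are existential because the order among equal slopes is left open. The
-- bound `hd` is required for every initial predecessor `a`, as the first entry depends on the
-- pivot.
set_option maxRecDepth 4000 in
theorem pivotsProg_runs (s : State) (k n d : ℕ) (hn : s.nat 0 0 = n)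
    (hd : ∀ p < n, ∀ a, descents (slope (s.real 0) (s.real 1) p)
      (rearrange (slope (s.real 0) (s.real 1) p) a
        ((seg (s.nat 12) 0 n).filter fun a => a ≠ p)) ≤ d)
    (hk : n * (sortCost n d + 1200 * (n + 1)) + 20 ≤ k) :
    Runs pivotsProg s k fun s' k' => ∃ σ : ℕ → List ℕ,
      (∀ p < n, (σ p).Perm ((seg (s.nat 12) 0 n).filter fun a => a ≠ p) ∧
        (σ p).Pairwise fun a b => slope (s.real 0) (s.real 1) p a ≤
          slope (s.real 0) (s.real 1) p b) ∧
      s'.out = s.out ++ encodeNat ((List.range n).flatMap fun p =>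
        reports (slope (s.real 0) (s.real 1) p) p (σ p)) ∧
      k ≤ k' + n * (sortCost n d + 1200 * (n + 1)) + 20 := by
  simp only [pivotsProg, runs_block_cons, runs_set, NatExpr.cost, runs_block_nil]
  refine ⟨by omega, ?_⟩
  set x := s.real 0 with hx
  set y := s.real 1 with hy
  set S := seg (s.nat 12) 0 n with hS
  have hSn : S.length = n := by simp [hS]
  generalize hC : sortCost n d + 1200 * (n + 1) = C at *
  refine Runs.loop (fun s' k' => s'.nat 19 0 ≤ n ∧ ∃ σ : ℕ → List ℕ,
    (∀ p < s'.nat 19 0, (σ p).Perm (S.filter fun a => a ≠ p) ∧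
      (σ p).Pairwise fun a b => slope x y p a ≤ slope x y p b) ∧
    s'.out = s.out ++ encodeNat ((List.range (s'.nat 19 0)).flatMap fun p =>
      reports (slope x y p) p (σ p)) ∧
    k ≤ k' + s'.nat 19 0 * C + 5) ?_ ?_ ?_
  · refine ⟨by simp, fun _ => [], by simp, by simp [encodeNat], by simp; omega⟩
  · rintro s' k' hf ⟨hp, σ, hσ, ho, hk'⟩ hc
    have h0 : s'.nat 0 0 = n := by simpa [hn] using congrFun (hf.nat 0 (by decide)) 0
    have h12 : s'.nat 12 = s.nat 12 := by simpa using hf.nat 12 (by decide)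
    have hr0 : s'.real 0 = x := by simpa using hf.real 0 (by decide)
    have hr1 : s'.real 1 = y := by simpa using hf.real 1 (by decide)
    simp only [ltTest_holds, nvar_eval, h0] at hc
    generalize hp' : s'.nat 19 0 = p at *
    -- Splits off the budget of the current pivot, so that the remaining estimates are linear in the
    -- products.
    obtain ⟨q, hq⟩ : ∃ q, n * C = p * C + C + q := by
      obtain ⟨r, rfl⟩ := Nat.exists_eq_add_of_lt hc
      exact ⟨r * C, by ring⟩
    simp only [runs_block_cons, ltTest_cost, nvar_cost, runs_block_nil, runs_incr]
    refine ⟨by omega, ?_⟩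
    refine (slopesProg_runs s' _ (by rw [h0]; omega)).mono ?_
    rintro s₁ k₁ hf₁ ⟨hs₁, hκ₁, hk₁⟩
    rw [h0] at hk₁
    rw [h0, h12, hp', ← hS] at hs₁
    rw [hr0, hr1, hp'] at hκ₁
    have hN : s₁.nat 1 0 ≤ n := by
      have := congrArg List.length hs₁
      rw [length_seg] at this
      rw [this, ← hSn]
      exact List.length_filter_le _ _
    have hcost := sortCost_mono_left (d := d) hN
    have hd₁ : descents (key s₁.real) (rearrange (key s₁.real) (s₁.nat 2 0)
        (seg (s₁.nat 2) 0 (s₁.nat 1 0))) ≤ d := by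
      -- The first cell of array `2` has a meaningful key only if the sequence is nonempty.
      rcases Nat.eq_zero_or_pos (s₁.nat 1 0) with h | h
      · rw [h]
        exact (Nat.zero_le _).trans' (by simp [rearrange, ups, downs])
      · rw [descents_rearrange_congr (κ' := slope x y p), hs₁]
        · exact hd p hc _
        · intro b hb
          rw [List.mem_cons] at hb
          refine hκ₁ b ?_
          rcases hb with rfl | hb
          · exact mem_seg.2 ⟨0, le_rfl, by omega, rfl⟩
          · exact hb
    refine (sortProg_runs s₁ k₁ d hd₁ (by omega)).mono ?_
    rintro s₂ k₂ hf₂ ⟨hs₂, hp₂, hk₂⟩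
    have hN₂ : s₂.nat 1 = s₁.nat 1 := hf₂.nat 1 (by decide)
    have hk2 : key s₂.real = key s₁.real := by
      funext u
      rw [key, key, hf₂.real 2 (by decide), hf₂.real 3 (by decide)]
    have hp19 : s₂.nat 19 0 = p := by
      rw [hf₂.nat 19 (by decide), hf₁.nat 19 (by decide), hp']
    have ho₂ : s₂.out = s'.out := by rw [hf₂.out (by decide), hf₁.out (by decide)]
    refine (groupsProg_runs s₂ k₂ (by rw [hN₂]; omega)).mono ?_
    rintro s₃ k₃ hf₃ ⟨ho₃, hk₃⟩
    have hp₃ : s₃.nat 19 0 = p := by rw [hf₃.nat 19 (by decide), hp19]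
    rw [hN₂] at hk₃ ho₃
    rw [hk2, hp19, ho₂, ho] at ho₃
    set τ := seg (s₂.nat 2) 0 (s₁.nat 1 0) with hτ
    have hκτ : ∀ b ∈ τ, key s₁.real b = slope x y p b := fun b hb => hκ₁ b (hs₂.subset hb)
    rw [reports_congr p hκτ] at ho₃
    simp only [hp₃, nat_setNat_self, Function.update_self, out_setNat]
    refine ⟨by omega, by omega, by omega, Function.update σ p τ, fun q' hq' => ?_, ?_, ?_⟩
    · rcases Nat.lt_succ_iff_lt_or_eq.1 hq' with h | rfl
      · rw [Function.update_of_ne h.ne]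
        exact hσ q' h
      · rw [Function.update_self, ← hs₁]
        refine ⟨hs₂, ?_⟩
        refine hp₂.imp_of_mem ?_
        intro a b ha hb hab
        rwa [hκτ a ha, hκτ b hb] at hab
    · rw [ho₃, List.range_succ, List.flatMap_append, encodeNat_append]
      simp only [List.flatMap_cons, List.flatMap_nil, List.append_nil, Function.update_self,
        List.append_assoc]
      congr 3
      simp only [List.flatMap_def]
      congr 1
      refine List.map_congr_left fun q' hq' => ?_
      rw [Function.update_of_ne (List.mem_range.1 hq').ne]
    · rw [Nat.add_mul, Nat.one_mul]
      omega
  · rintro s' k' hf ⟨hp, σ, hσ, ho, hk'⟩ hc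
    have h0 : s'.nat 0 0 = n := by simpa [hn] using congrFun (hf.nat 0 (by decide)) 0
    simp only [ltTest_holds, nvar_eval, h0] at hc
    rw [show s'.nat 19 0 = n by omega] at hσ ho hk'
    simp only [ltTest_cost, nvar_cost]
    exact ⟨by omega, by omega, σ, hσ, ho, by omega⟩

end RealRAM

/-! ### Convex layers of point sets -/

namespace CollinearPoints

/-- A point of a set lies on the boundary of the convex hull if and only if there is a supporting
line through it. -/
theorem mem_frontier_convexHull_iff {A : Set Plane} {a : Plane} (ha : a ∈ A) :
    a ∈ frontier (convexHull ℝ A) ↔ ∃ u v : ℝ, (u ≠ 0 ∨ v ≠ 0) ∧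
      ∀ b ∈ A, 0 ≤ u * (b 1 - a 1) - v * (b 0 - a 0) := by
  have hmem : a ∈ convexHull ℝ A := subset_convexHull ℝ A ha
  constructor
  · intro h
    obtain ⟨f, hf, hfa⟩ : ∃ f : Plane →ₗ[ℝ] ℝ, f ≠ 0 ∧ ∀ b ∈ A, f b ≤ f a := by
      -- With interior points, separate `a` from the open interior. Otherwise `A` spans less than
      -- the plane, and a nonzero functional that vanishes on the directions of `A` is constant on
      -- it.
      by_cases hne : (interior (convexHull ℝ A)).Nonempty
      · obtain ⟨f, hf, hfa⟩ :=
          geometric_hahn_banach_of_nonempty_interior_point (convex_convexHull ℝ A) h.2 hne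
        refine ⟨f, fun h => hf ?_, fun b hb => hfa b (subset_convexHull ℝ A hb)⟩
        ext v
        exact LinearMap.congr_fun h v
      · rw [interior_convexHull_nonempty_iff_affineSpan_eq_top,
          AffineSubspace.affineSpan_eq_top_iff_vectorSpan_eq_top_of_nonempty ℝ _ _ ⟨a, ha⟩] at hne
        obtain ⟨f, hf, hle⟩ := Submodule.exists_le_ker_of_lt_top _ (lt_top_iff_ne_top.2 hne)
        refine ⟨f, hf, fun b hb => ?_⟩
        have := hle (vsub_mem_vectorSpan ℝ hb ha)
        rw [LinearMap.mem_ker, vsub_eq_sub, map_sub, sub_eq_zero] at this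
        exact this.le
    have hexp : ∀ v : Plane, f v = v 0 * f (EuclideanSpace.single 0 1) +
        v 1 * f (EuclideanSpace.single 1 1) := by
      intro v
      have : v = v 0 • EuclideanSpace.single 0 1 + v 1 • EuclideanSpace.single 1 1 := by
        ext i
        fin_cases i <;> simp
      conv_lhs => rw [this]
      simp
    refine ⟨-f (EuclideanSpace.single 1 1), f (EuclideanSpace.single 0 1), ?_, fun b hb => ?_⟩
    · by_contra! h0
      refine hf (LinearMap.ext fun v => ?_)
      rw [hexp, h0.2, neg_eq_zero.1 h0.1]
      simp
    · have := hfa b hb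
      rw [hexp b, hexp a] at this
      linarith
  · rintro ⟨u, v, huv, h⟩
    refine ⟨subset_closure hmem, fun hint => ?_⟩
    have hconv : Convex ℝ {b : Plane | 0 ≤ u * (b 1 - a 1) - v * (b 0 - a 0)} := by
      intro b hb c hc s t hs ht hst
      simp only [Set.mem_ofPred_eq, PiLp.add_apply, PiLp.smul_apply, smul_eq_mul] at *
      have hs' : s = 1 - t := by linarith
      have h₁ := mul_nonneg hs hb
      have h₂ := mul_nonneg ht hc
      subst hs'
      linarith
    have hsub := convexHull_min h hconv
    -- At an interior point one could move a little in the normal direction `(v, -u)`, which makes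
    -- the affine form negative.
    have htend : Filter.Tendsto (fun ε : ℝ => a + ε • (!₂[v, -u] : Plane)) (nhdsWithin 0 (Set.Ioi 0))
        (nhds a) := by
      have : Continuous fun ε : ℝ => a + ε • (!₂[v, -u] : Plane) := by fun_prop
      simpa using (this.tendsto 0).mono_left nhdsWithin_le_nhds
    obtain ⟨ε, hε, hpos⟩ := ((htend.eventually (mem_interior_iff_mem_nhds.1 hint)).and
      self_mem_nhdsWithin).exists
    have : 0 ≤ u * ((a + ε • (!₂[v, -u] : Plane)) 1 - a 1) -
        v * ((a + ε • (!₂[v, -u] : Plane)) 0 - a 0) := hsub hε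
    simp at this
    have hpos' : 0 < ε := hpos
    have h' : 0 < u ^ 2 + v ^ 2 := by
      rcases huv with h | h
      · have := pow_pos (abs_pos.2 h) 2
        rw [sq_abs] at this
        positivity
      · have := pow_pos (abs_pos.2 h) 2
        rw [sq_abs] at this
        positivity
    nlinarith [mul_pos hpos' h']

end CollinearPoints

/-! ### The layers of sorted lists are the convex layers of the point set. -/

namespace RealRAM

open CollinearPoints (Plane hullLayer peel convexLayer peelingDepth)

theorem lexPos_or_neg {u v : ℝ} (h : u ≠ 0 ∨ v ≠ 0) : LexPos u v ∨ LexPos (-u) (-v) := by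
  unfold LexPos
  rcases lt_trichotomy u 0 with hu | rfl | hu
  · exact .inr (.inl (by linarith))
  · rcases lt_or_gt_of_ne (h.resolve_left (not_not.2 rfl)) with hv | hv
    · exact .inr (.inr ⟨by simp, by linarith⟩)
    · exact .inl (.inr ⟨rfl, hv⟩)
  · exact .inl (.inl hu)

theorem LexPos.ne_zero {u v : ℝ} (h : LexPos u v) : u ≠ 0 ∨ v ≠ 0 := by
  rcases h with h | h
  · exact .inl h.ne'
  · exact .inr h.2.ne'

variable {x y : ℕ → ℝ}

/-- The direction of the supporting line separates: slopes from the left to `a` are at most its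
slope, and slopes from `a` to the right are at least its slope. -/
theorem low_of_supporting {l : List ℕ} {a : ℕ} {u v : ℝ} (huv : LexPos u v)
    (h : ∀ b ∈ l, 0 ≤ u * (y b - y a) - v * (x b - x a)) : Low x y l a := by
  intro b hb c hc hba hac
  rw [pos_lt_iff] at hba hac
  have h₁ := (dirKey_le_iff hba huv).2 (by linarith [h b hb])
  have h₂ := (dirKey_le_iff huv hac).2 (by linarith [h c hc])
  have := (dirKey_le_iff hba hac).1 (h₁.trans h₂)
  unfold ori
  linarith

theorem Low.exists_supporting {l : List ℕ} {a : ℕ} (h : Low x y l a)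
    (hp : ∀ b ∈ l, pos x y b = pos x y a → b = a) :
    ∃ u v : ℝ, (u ≠ 0 ∨ v ≠ 0) ∧ ∀ b ∈ l, 0 ≤ u * (y b - y a) - v * (x b - x a) := by
  classical
  by_cases hr : ∃ c ∈ l, pos x y a < pos x y c
  · obtain ⟨c, hc, hmin⟩ := (l.toFinset.filter fun c => pos x y a < pos x y c).exists_min_image
      (slope x y a) (by obtain ⟨c, hc, hac⟩ := hr; exact ⟨c, by simp [hc, hac]⟩)
    simp only [Finset.mem_filter, List.mem_toFinset, and_imp] at hc hmin
    refine ⟨x c - x a, y c - y a, (pos_lt_iff.1 hc.2).ne_zero, fun b hb => ?_⟩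
    rcases lt_trichotomy (pos x y b) (pos x y a) with hba | hba | hba
    · have := h b hb c hc.1 hba hc.2
      unfold ori at this
      linarith
    · rw [hp b hb hba]
      simp
    · have := (slope_left_le_iff hc.2 hba).1 (hmin b hb hba)
      unfold ori at this
      linarith
  · by_cases hr' : ∃ c ∈ l, pos x y c < pos x y a
    -- If `a` is the rightmost point, the steepest line arriving from the left supports.
    · obtain ⟨c, hc, hmax⟩ := (l.toFinset.filter fun c => pos x y c < pos x y a).exists_max_image
        (fun c => slope x y c a) (by obtain ⟨c, hc, hac⟩ := hr'; exact ⟨c, by simp [hc, hac]⟩)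
      simp only [Finset.mem_filter, List.mem_toFinset, and_imp] at hc hmax
      refine ⟨x a - x c, y a - y c, (pos_lt_iff.1 hc.2).ne_zero, fun b hb => ?_⟩
      rcases lt_trichotomy (pos x y b) (pos x y a) with hba | hba | hba
      · have := hmax b hb hba
        rw [slope, slope, dirKey_le_iff (pos_lt_iff.1 hba) (pos_lt_iff.1 hc.2)] at this
        linarith
      · rw [hp b hb hba]
        simp
      · exact absurd ⟨b, hb, hba⟩ hr
    · refine ⟨1, 0, by simp, fun b hb => ?_⟩
      rw [hp b hb (le_antisymm (not_lt.1 fun h => hr ⟨b, hb, h⟩)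
        (not_lt.1 fun h => hr' ⟨b, hb, h⟩))]
      simp

/-- The set lies to the left of the directed line `(u, v)`. A lexicographically positive direction
puts `a` on the lower side, a negative one on the upper side after half a turn. -/
theorem exists_supporting_iff {l : List ℕ} {a : ℕ}
    (hp : ∀ b ∈ l, pos x y b = pos x y a → b = a) :
    (∃ u v : ℝ, (u ≠ 0 ∨ v ≠ 0) ∧ ∀ b ∈ l, 0 ≤ u * (y b - y a) - v * (x b - x a)) ↔
      Low x y l a ∨ Low (-x) (-y) l a := by
  constructor
  · rintro ⟨u, v, huv, h⟩
    rcases lexPos_or_neg huv with huv | huv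
    · exact .inl (low_of_supporting huv h)
    · refine .inr (low_of_supporting huv fun b hb => ?_)
      have := h b hb
      simp only [Pi.neg_apply]
      linarith
  · rintro (h | h)
    · exact h.exists_supporting hp
    · obtain ⟨u, v, huv, h'⟩ := h.exists_supporting fun b hb hba => hp b hb (by
        simpa [pos] using hba)
      refine ⟨-u, -v, by simpa using huv, fun b hb => ?_⟩
      have := h' b hb
      simp only [Pi.neg_apply] at this
      linarith

/-- The points with the given coordinates. -/
noncomputable def point (x y : ℕ → ℝ) (i : ℕ) : Plane := !₂[x i, y i]

@[simp] theorem point_zero (i : ℕ) : point x y i 0 = x i := rfl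

@[simp] theorem point_one (i : ℕ) : point x y i 1 = y i := rfl

theorem pos_eq_of_point_eq {i j : ℕ} (h : point x y i = point x y j) : pos x y i = pos x y j := by
  rw [pos, pos, ← point_zero (x := x) (y := y) i, ← point_one (x := x) (y := y) i, h]
  rfl

theorem hullLayer_point {l : List ℕ} (hl : l.Pairwise fun a b => pos x y a < pos x y b) :
    hullLayer (point x y '' {i | i ∈ l}) = point x y '' {i | i ∈ layer x y l} := by
  have hinj := fun a ha b hb => pos_injOn_of_pairwise hl (a := a) (b := b) ha hb
  have key : ∀ a ∈ l, point x y a ∈ frontier (convexHull ℝ (point x y '' {i | i ∈ l})) ↔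
      a ∈ layer x y l := by
    intro a ha
    rw [CollinearPoints.mem_frontier_convexHull_iff
      (Set.mem_image_of_mem (point x y) (show a ∈ {i | i ∈ l} from ha)), mem_layer hl,
      and_iff_right ha, ← exists_supporting_iff fun b hb h => hinj b hb a ha h]
    simp
  ext q
  constructor
  · rintro ⟨⟨a, ha, rfl⟩, h⟩
    exact ⟨a, (key a ha).1 h, rfl⟩
  · rintro ⟨a, ha, rfl⟩
    exact ⟨⟨a, layer_subset x y l ha, rfl⟩, (key a (layer_subset x y l ha)).2 ha⟩

theorem peel_point {l : List ℕ} (hl : l.Pairwise fun a b => pos x y a < pos x y b) :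
    peel (point x y '' {i | i ∈ l}) = point x y '' {i | i ∈ inner x y l} := by
  have hinj := fun a ha b hb => pos_injOn_of_pairwise hl (a := a) (b := b) ha hb
  rw [peel, hullLayer_point hl]
  ext q
  constructor
  · rintro ⟨⟨a, ha, rfl⟩, h⟩
    refine ⟨a, ?_, rfl⟩
    simp only [inner, Set.mem_ofPred_eq, List.mem_filter, decide_eq_true_eq]
    exact ⟨ha, fun h' => h ⟨a, h', rfl⟩⟩
  · rintro ⟨a, ha, rfl⟩
    simp only [inner, Set.mem_ofPred_eq, List.mem_filter, decide_eq_true_eq] at ha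
    refine ⟨⟨a, ha.1, rfl⟩, ?_⟩
    rintro ⟨b, hb, h⟩
    rw [hinj b (layer_subset x y l hb) a ha.1 (pos_eq_of_point_eq h)] at hb
    exact ha.2 hb

/-- Stated as an equivalence for every `k`, so that the infimum in `peelingDepth` can be read off.
-/
theorem peel_iterate_point {l : List ℕ} (hl : l.Pairwise fun a b => pos x y a < pos x y b)
    (k : ℕ) : peel^[k] (point x y '' {i | i ∈ l}) = ∅ ↔ (layers x y l).length ≤ k := by
  induction l using layers_induction x y generalizing k with
  | h₀ =>
    have : ∀ k, peel^[k] (∅ : Set Plane) = ∅ := fun k =>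
      Function.iterate_fixed (by simp [peel]) k
    simp [this]
  | h₁ l hne ih =>
    rw [layers_of_ne_nil x y hne, List.length_cons]
    cases k with
    | zero =>
      obtain ⟨a, ha⟩ := List.exists_mem_of_ne_nil l hne
      simp only [Function.iterate_zero, id_eq, Set.image_eq_empty, nonpos_iff_eq_zero,
        Nat.add_eq_zero_iff, one_ne_zero, and_false, iff_false]
      exact Set.Nonempty.ne_empty ⟨a, ha⟩
    | succ k =>
      rw [Function.iterate_succ_apply, peel_point hl, ih (hl.sublist (inner_sublist x y l)),
        Nat.add_le_add_iff_right]

theorem peelingDepth_point {l : List ℕ} (hl : l.Pairwise fun a b => pos x y a < pos x y b) :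
    peelingDepth (point x y '' {i | i ∈ l}) = (layers x y l).length := by
  rw [peelingDepth]
  simp only [peel_iterate_point hl]
  exact le_antisymm (Nat.sInf_le (Set.mem_ofPred.2 le_rfl))
    (Nat.sInf_mem (s := {k | (layers x y l).length ≤ k}) ⟨_, Set.mem_ofPred.2 le_rfl⟩)

theorem convexLayer_point {l : List ℕ} (hl : l.Pairwise fun a b => pos x y a < pos x y b)
    (j : ℕ) (hj : j < (layers x y l).length) :
    convexLayer (point x y '' {i | i ∈ l}) j = point x y '' {i | i ∈ (layers x y l)[j]} := by
  induction l using layers_induction x y generalizing j with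
  | h₀ => simp at hj
  | h₁ l hne ih =>
    cases j with
    | zero =>
      rw [convexLayer, Function.iterate_zero, id, hullLayer_point hl]
      simp only [layers_of_ne_nil x y hne, List.getElem_cons_zero]
    | succ j =>
      simp only [layers_of_ne_nil x y hne, List.length_cons, Nat.add_lt_add_iff_right] at hj
      have := ih (hl.sublist (inner_sublist x y l)) j hj
      rw [convexLayer] at this ⊢
      rw [Function.iterate_succ_apply, peel_point hl, this]
      simp only [layers_of_ne_nil x y hne, List.getElem_cons_succ]

/-- The convex layers are convex polygons. -/
theorem layers_spec {l : List ℕ} (hl : l.Pairwise fun a b => pos x y a < pos x y b) :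
    ∀ r ∈ layers x y l, r ≠ [] ∧ r.Nodup ∧ r ⊆ l ∧
      r.Triplewise fun a b c => 0 ≤ ori x y a b c := by
  induction l using layers_induction x y with
  | h₀ => simp
  | h₁ l hne ih =>
    intro r hr
    rw [layers_of_ne_nil x y hne, List.mem_cons] at hr
    rcases hr with rfl | hr
    · refine ⟨layer_ne_nil x y hne, layer_nodup x y ?_, layer_subset x y l, layer_triplewise hl⟩
      exact hl.imp fun {a b} h => by rintro rfl; exact lt_irrefl _ h
    · obtain ⟨h₁, h₂, h₃, h₄⟩ := ih (hl.sublist (inner_sublist x y l)) r hr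
      exact ⟨h₁, h₂, fun a ha => (inner_sublist x y l).subset (h₃ ha), h₄⟩

end RealRAM

/-! ### Maximal collinear subsets -/

namespace CollinearPoints

theorem collinear_iff_orient {A : Set Plane} {a b : Plane} (ha : a ∈ A) (hb : b ∈ A) (hab : a ≠ b) :
    Collinear ℝ A ↔ ∀ c ∈ A, orient a b c = 0 := by
  rw [collinear_iff_of_mem ha]
  constructor
  · rintro ⟨v, hv⟩ c hc
    obtain ⟨r, rfl⟩ := hv b hb
    obtain ⟨t, rfl⟩ := hv c hc
    simp [orient]
    ring
  · intro h
    refine ⟨b - a, fun c hc => ?_⟩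
    have h' := h c hc
    unfold orient at h'
    by_cases h0 : b 0 - a 0 = 0
    · have h1 : b 1 - a 1 ≠ 0 := by
        intro h1
        refine hab ?_
        ext i
        fin_cases i
        · exact (sub_eq_zero.1 h0).symm
        · exact (sub_eq_zero.1 h1).symm
      refine ⟨(c 1 - a 1) / (b 1 - a 1), ?_⟩
      ext i
      fin_cases i
      · rw [h0, zero_mul, zero_sub, neg_eq_zero, mul_eq_zero, or_iff_right h1] at h'
        simp [h0, sub_eq_zero.1 h']
      · simp [div_mul_cancel₀ _ h1]
    · refine ⟨(c 0 - a 0) / (b 0 - a 0), ?_⟩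
      ext i
      fin_cases i
      · simp [div_mul_cancel₀ _ h0]
      · simp only [Fin.mk_one, Fin.isValue, vadd_eq_add, PiLp.add_apply, PiLp.smul_apply,
          PiLp.sub_apply, smul_eq_mul]
        field_simp
        linarith

variable {n : ℕ} {p : Fin n → Plane}

/-- Two distinct points determine their line, and any point of it can be added without losing
collinearity. A maximal collinear set thus consists of all given points on that line. -/
theorem isMaximalCollinear_iff (hp : Function.Injective p) {S : Finset (Fin n)} {a b : Fin n}
    (ha : a ∈ S) (hb : b ∈ S) (hab : a ≠ b) :
    IsMaximalCollinear p S ↔ ∀ c, c ∈ S ↔ orient (p a) (p b) (p c) = 0 := by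
  classical
  have key : ∀ T : Finset (Fin n), a ∈ T → b ∈ T →
      (Collinear ℝ (p '' (T : Set (Fin n))) ↔ ∀ c ∈ T, orient (p a) (p b) (p c) = 0) := by
    intro T haT hbT
    rw [collinear_iff_orient (Set.mem_image_of_mem p haT) (Set.mem_image_of_mem p hbT)
      (hp.ne hab)]
    simp
  constructor
  · intro h c
    have hS := (key S ha hb).1 h.1
    refine ⟨hS c, fun hc => ?_⟩
    have hins : Collinear ℝ (p '' ((insert c S : Finset (Fin n)) : Set (Fin n))) := by
      rw [key _ (Finset.mem_insert_of_mem ha) (Finset.mem_insert_of_mem hb)]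
      intro d hd
      rcases Finset.mem_insert.1 hd with rfl | hd
      · exact hc
      · exact hS d hd
    exact h.2 hins (Finset.subset_insert c S) (Finset.mem_insert_self c S)
  · intro h
    refine ⟨(key S ha hb).2 fun c hc => (h c).1 hc, fun T hT hST c hc => ?_⟩
    exact (h c).2 ((key T (hST ha) (hST hb)).1 hT c hc)

end CollinearPoints

/-! ### The reported blocks are the maximal collinear subsets. -/

namespace RealRAM

/-- Unlike for the order, no sign condition is needed: equality only tests whether the vectors are
parallel. -/
theorem dirKey_eq_iff {u v u' v' : ℝ} (h : u ≠ 0 ∨ v ≠ 0) (h' : u' ≠ 0 ∨ v' ≠ 0) :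
    dirKey u v = dirKey u' v' ↔ u * v' - v * u' = 0 := by
  rw [dirKey, dirKey, toLex_inj, Prod.mk.injEq]
  by_cases hu : u = 0 <;> by_cases hu' : u' = 0
  · simp [hu, hu']
  · simp [hu, hu', h.resolve_left (not_not.2 hu)]
  · simp [hu, hu', h'.resolve_left (not_not.2 hu')]
  · simp only [hu, hu', if_false, true_and]
    rw [div_eq_div_iff hu hu', sub_eq_zero, eq_comm, mul_comm v']

section Reports

variable {K : Type*} [LinearOrder K] {κ : ℕ → K}

/-- In a sorted list the head has the least key, so the entries with that key form a prefix. -/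
theorem takeWhile_eq_filter {a : ℕ} {l : List ℕ}
    (h : (a :: l).Pairwise fun b c => κ b ≤ κ c) :
    (l.takeWhile fun b => κ b = κ a) = (l.filter fun b => κ b = κ a) ∧
    ∀ b ∈ l.dropWhile fun b => κ b = κ a, κ b ≠ κ a := by
  induction l with
  | nil => simp
  | cons b l ih =>
    by_cases hb : κ b = κ a
    · simpa [hb] using ih (h.sublist (by simp))
    · rw [List.takeWhile_cons_of_neg (by simpa), List.dropWhile_cons_of_neg (by simpa)]
      have hlt : ∀ c ∈ b :: l, κ c ≠ κ a := by
        intro c hc hca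
        rw [List.pairwise_cons, List.pairwise_cons] at h
        refine hb (le_antisymm ?_ (h.1 b (by simp)))
        rcases List.mem_cons.1 hc with rfl | hc
        · exact hca.le
        · exact (h.2.1 c hc).trans hca.le
      exact ⟨(List.filter_eq_nil_iff.2 fun c hc => by simpa using hlt c hc).symm, hlt⟩

theorem mem_reports {p : ℕ} {l : List ℕ} (h : l.Pairwise fun b c => κ b ≤ κ c) {r : List ℕ} :
    r ∈ reports κ p l ↔ ∃ a ∈ l, r = p :: (l.filter fun b => κ b = κ a) ∧
      (∀ b ∈ l.filter fun b => κ b = κ a, p ≤ b) ∧ 1 < (l.filter fun b => κ b = κ a).length := by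
  induction hn : l.length using Nat.strong_induction_on generalizing l with
  | _ n ih =>
    cases l with
    | nil => simp [reports]
    | cons a l =>
      obtain ⟨htake, hdrop⟩ := takeWhile_eq_filter h
      have hsub := List.dropWhile_sublist (fun b => decide (κ b = κ a)) (l := l)
      have hfil : a :: (l.filter fun b => κ b = κ a) = (a :: l).filter fun b => κ b = κ a := by simp
      have hfil' : ∀ c, κ c ≠ κ a → ((a :: l).filter fun b => κ b = κ c) =
          (l.dropWhile fun b => κ b = κ a).filter fun b => κ b = κ c := by
        intro c hc
        rw [List.filter_cons_of_neg (by simpa using hc.symm)]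
        conv_lhs => rw [← List.takeWhile_append_dropWhile (p := fun b => decide (κ b = κ a)) (l := l),
          List.filter_append, htake]
        rw [List.filter_eq_nil_iff.2, List.nil_append]
        intro b hb
        simp only [List.mem_filter, decide_eq_true_eq] at hb ⊢
        rw [hb.2]
        exact hc.symm
      rw [reports, List.mem_append, ih _ (by
        have := hsub.length_le
        rw [List.length_cons] at hn
        omega) (h.sublist (hsub.trans (List.sublist_cons_self a l))) rfl, htake, hfil]
      constructor
      · rintro (hr | ⟨c, hc, rfl, h₁, h₂⟩)
        · split_ifs at hr with hcond
          · exact ⟨a, by simp, List.mem_singleton.1 hr, hcond⟩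
          · simp at hr
        · refine ⟨c, List.mem_cons_of_mem _ (hsub.subset hc), ?_⟩
          rw [hfil' c (hdrop c hc)]
          exact ⟨rfl, h₁, h₂⟩
      · rintro ⟨c, hc, rfl, h₁, h₂⟩
        by_cases hca : κ c = κ a
        · rw [hca] at h₁ h₂ ⊢
          left
          rw [if_pos ⟨h₁, h₂⟩]
          simp
        · right
          rw [hfil' c hca] at h₁ h₂ ⊢
          refine ⟨c, ?_, rfl, h₁, h₂⟩
          have : c ∈ (l.dropWhile fun b => κ b = κ a).filter fun b => κ b = κ c := by
            rw [← hfil' c hca]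
            simpa using hc
          exact List.mem_of_mem_filter this

/-- The entry heading a block occurs in no later block, since the keys differ. Noninclusion, rather
than inequality of lists, is what remains meaningful after passing to finite sets. -/
theorem reports_pairwise {p : ℕ} {l : List ℕ} (h : l.Pairwise fun b c => κ b ≤ κ c)
    (hp : p ∉ l) : (reports κ p l).Pairwise fun r r' => ¬ r ⊆ r' := by
  induction hn : l.length using Nat.strong_induction_on generalizing l with
  | _ n ih =>
    cases l with
    | nil => simp [reports]
    | cons a l =>
      obtain ⟨-, hdrop⟩ := takeWhile_eq_filter h
      have hsub := List.dropWhile_sublist (fun b => decide (κ b = κ a)) (l := l)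
      have hs := h.sublist (hsub.trans (List.sublist_cons_self a l))
      have ih' := ih _ (by
        have := hsub.length_le
        rw [List.length_cons] at hn
        omega) hs (fun h => hp (List.mem_cons_of_mem _ (hsub.subset h))) rfl
      rw [reports]
      refine List.pairwise_append.2 ⟨?_, ih', ?_⟩
      · split_ifs <;> simp
      · intro r hr r' hr' hrr
        split_ifs at hr with hcond
        · obtain ⟨c, hc, rfl, -⟩ := (mem_reports hs).1 hr'
          rw [List.mem_singleton.1 hr] at hrr
          have := hrr (show a ∈ _ by simp)
          rcases List.mem_cons.1 this with rfl | h'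
          · exact hp (by simp)
          · exact hdrop a (List.mem_of_mem_filter h') rfl
        · simp at hr

end Reports

theorem exists_map_eq {α β : Type*} (f : α → β) {l : List β} (h : ∀ b ∈ l, ∃ a, f a = b) :
    ∃ l' : List α, l'.map f = l := by
  induction l with
  | nil => exact ⟨[], rfl⟩
  | cons b l ih =>
    obtain ⟨a, rfl⟩ := h b (by simp)
    obtain ⟨l', rfl⟩ := ih fun c hc => h c (List.mem_cons_of_mem _ hc)
    exact ⟨a :: l', rfl⟩

theorem exists_map_val_eq {n : ℕ} {L : List (List ℕ)} (h : ∀ l ∈ L, ∀ i ∈ l, i < n) :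
    ∃ L' : List (List (Fin n)), L'.map (List.map Fin.val) = L :=
  exists_map_eq _ fun l hl => exists_map_eq _ fun i hi => ⟨⟨i, h l hl i hi⟩, rfl⟩

theorem encode_eq {n : ℕ} (L : List (List (Fin n))) :
    CollinearPoints.encode L = encodeNat (L.map (List.map Fin.val)) := by
  simp [CollinearPoints.encode, encodeNat, List.flatMap_map]

open CollinearPoints (Plane orient)

variable {n : ℕ} {p : Fin n → Plane} {x y : ℕ → ℝ}

theorem slope_eq_iff (hp : Function.Injective p) (hxy : ∀ i : Fin n, p i = point x y i)
    {q a c : Fin n} (ha : a ≠ q) (hc : c ≠ q) :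
    slope x y q c = slope x y q a ↔ orient (p q) (p a) (p c) = 0 := by
  have key : ∀ i : Fin n, i ≠ q → x i - x q ≠ 0 ∨ y i - y q ≠ 0 := by
    intro i hi
    by_contra! h
    refine hi (hp ?_)
    rw [hxy, hxy, point, point, sub_eq_zero.1 h.1, sub_eq_zero.1 h.2]
  rw [eq_comm, slope, slope, dirKey_eq_iff (key a ha) (key c hc), orient]
  simp [hxy]

theorem reportsMaximalCollinear (hp : Function.Injective p)
    (hxy : ∀ i : Fin n, p i = point x y i) (σ : ℕ → List ℕ)
    (hσ : ∀ q < n, (σ q).Nodup ∧ (∀ i, i ∈ σ q ↔ i < n ∧ i ≠ q) ∧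
      (σ q).Pairwise fun a b => slope x y q a ≤ slope x y q b) :
    CollinearPoints.ReportsMaximalCollinear p (encodeNat ((List.range n).flatMap fun q =>
      reports (slope x y q) q (σ q))) := by
  classical
  set L₀ := (List.range n).flatMap fun q => reports (slope x y q) q (σ q) with hL₀
  have hmem : ∀ r, r ∈ L₀ ↔ ∃ q a : Fin n, a ≠ q ∧
      r = (q : ℕ) :: ((σ q).filter fun b : ℕ => slope x y q b = slope x y q a) ∧
      (∀ b ∈ (σ q).filter fun b : ℕ => slope x y q b = slope x y q a, (q : ℕ) ≤ b) ∧
      1 < ((σ q).filter fun b : ℕ => slope x y q b = slope x y q a).length := by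
    intro r
    rw [hL₀, List.mem_flatMap]
    constructor
    · rintro ⟨q, hq, hr⟩
      have hq := List.mem_range.1 hq
      obtain ⟨a, ha, h⟩ := (mem_reports (hσ q hq).2.2).1 hr
      obtain ⟨han, haq⟩ := ((hσ q hq).2.1 a).1 ha
      exact ⟨⟨q, hq⟩, ⟨a, han⟩, fun h => haq (congrArg Fin.val h), h⟩
    · rintro ⟨q, a, haq, h⟩
      refine ⟨q, List.mem_range.2 q.2, (mem_reports (hσ q q.2).2.2).2 ⟨a, ?_, h⟩⟩
      exact ((hσ q q.2).2.1 a).2 ⟨a.2, fun h => haq (Fin.ext h)⟩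
  obtain ⟨L, hL⟩ := exists_map_val_eq (n := n) (L := L₀) (by
    intro r hr i hi
    obtain ⟨q, a, -, rfl, -⟩ := (hmem r).1 hr
    rcases List.mem_cons.1 hi with rfl | hi
    · exact q.2
    · exact (((hσ q q.2).2.1 i).1 (List.mem_of_mem_filter hi)).1)
  have hline : ∀ (l : List (Fin n)) (q a : Fin n), a ≠ q →
      l.map Fin.val = (q : ℕ) :: ((σ q).filter fun b : ℕ => slope x y q b = slope x y q a) →
      l.Nodup ∧ ∀ c, c ∈ l ↔ orient (p q) (p a) (p c) = 0 := by
    intro l q a haq hl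
    have hnd : (l.map Fin.val).Nodup := by
      rw [hl, List.nodup_cons]
      refine ⟨fun h => ?_, (hσ q q.2).1.filter _⟩
      exact (((hσ q q.2).2.1 q).1 (List.mem_of_mem_filter h)).2 rfl
    refine ⟨hnd.of_map _, fun c => ?_⟩
    have : c ∈ l ↔ (c : ℕ) ∈ l.map Fin.val := by simp [Fin.val_inj]
    rw [this, hl, List.mem_cons, List.mem_filter, (hσ q q.2).2.1, decide_eq_true_eq, Fin.val_inj]
    by_cases hcq : c = q
    · simp [hcq, orient]
    · rw [slope_eq_iff hp hxy haq hcq]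
      simp [hcq, Fin.val_inj]
  have hLmem : ∀ l, l ∈ L ↔ l.map Fin.val ∈ L₀ := by
    intro l
    rw [← hL, List.mem_map_of_injective (List.map_injective_iff.2 Fin.val_injective)]
  refine ⟨L, by rw [encode_eq, hL], fun l hl => ?_, ?_, fun S => ?_⟩
  · obtain ⟨q, a, haq, h, -⟩ := (hmem _).1 ((hLmem l).1 hl)
    exact (hline l q a haq h).1
  · have hpw : L₀.Pairwise fun r r' => ¬ r ⊆ r' := by
      rw [hL₀, List.pairwise_flatMap]
      refine ⟨fun q hq => ?_, ?_⟩
      · have hq := List.mem_range.1 hq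
        exact reports_pairwise (hσ q hq).2.2 fun h => (((hσ q hq).2.1 q).1 h).2 rfl
      -- A report of the pivot `q` contains `q`, while those of a larger pivot `q'` contain only
      -- numbers that are at least `q'`.
      · refine List.pairwise_lt_range.imp_of_mem ?_
        intro q q' hq hq' hqq r hr r' hr' hrr
        have hq := List.mem_range.1 hq
        have hq' := List.mem_range.1 hq'
        obtain ⟨a, -, rfl, -⟩ := (mem_reports (hσ q hq).2.2).1 hr
        obtain ⟨a', -, rfl, h, -⟩ := (mem_reports (hσ q' hq').2.2).1 hr'
        rcases List.mem_cons.1 (hrr (show q ∈ _ by simp)) with h' | h'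
        · omega
        · exact absurd (h q h') (by omega)
    rw [← hL, List.pairwise_map] at hpw
    rw [List.Nodup, List.pairwise_map]
    refine hpw.imp fun {l l'} h h' => h (List.map_subset _ fun c hc => ?_)
    rwa [← List.mem_toFinset, ← h', List.mem_toFinset]
  · rw [List.mem_map]
    constructor
    · rintro ⟨l, hl, rfl⟩
      obtain ⟨q, a, haq, h, -, hlen⟩ := (hmem _).1 ((hLmem l).1 hl)
      obtain ⟨hnd, hc⟩ := hline l q a haq h
      refine ⟨(CollinearPoints.isMaximalCollinear_iff hp (a := q) (b := a) ?_ ?_ haq.symm).2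
        fun c => ?_, ?_⟩
      · simp [hc, orient]
      · rw [List.mem_toFinset, hc, orient]
        ring
      · rw [List.mem_toFinset, hc]
      · rw [List.toFinset_card_of_nodup hnd, ← List.length_map Fin.val, h, List.length_cons]
        omega
    · rintro ⟨hS, hcard⟩
      have hne : S.Nonempty := Finset.card_pos.1 (by omega)
      -- The subset is found at its point of smallest index; any further point `a` of it determines
      -- the line.
      set q := S.min' hne with hq
      obtain ⟨a, ha, haq⟩ := Finset.exists_mem_ne (by omega : 1 < S.card) q
      have hSc := (CollinearPoints.isMaximalCollinear_iff hp (S.min'_mem hne) ha haq.symm).1 hS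
      set r := (q : ℕ) :: ((σ q).filter fun b : ℕ => slope x y q b = slope x y q a) with hr
      obtain ⟨l, hl⟩ : ∃ l : List (Fin n), l.map Fin.val = r := exists_map_eq _ fun i hi => by
        rcases List.mem_cons.1 hi with rfl | hi
        · exact ⟨q, rfl⟩
        · exact ⟨⟨i, (((hσ q q.2).2.1 i).1 (List.mem_of_mem_filter hi)).1⟩, rfl⟩
      obtain ⟨hnd, hc⟩ := hline l q a haq hl
      have hlS : l.toFinset = S := by
        ext c
        rw [List.mem_toFinset, hc, hSc]
      refine ⟨l, (hLmem l).2 ((hmem _).2 ⟨q, a, haq, hl, fun b hb => ?_, ?_⟩), hlS⟩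
      · have hb' : b ∈ l.map Fin.val := by
          rw [hl]
          exact List.mem_cons_of_mem _ hb
        obtain ⟨c, hcl, rfl⟩ := List.mem_map.1 hb'
        exact Fin.val_le_of_le (S.min'_le c (hlS ▸ List.mem_toFinset.2 hcl))
      · have := congrArg List.length hl
        rw [List.length_map, ← List.toFinset_card_of_nodup hnd, hlS, hr, List.length_cons] at this
        omega

end RealRAM

/-! ### The two programs on the input -/

namespace RealRAM

theorem QRep.seg_flatten {B Q : ℕ → ℕ} {h : ℕ} {R : List (List ℕ)} (H : QRep B Q h R) :
    seg Q (B h) R.flatten.length = R.flatten := by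
  induction R generalizing h with
  | nil => simp
  | cons r R ih =>
    obtain ⟨h₁, h₂, h₃⟩ := H
    have := ih h₃
    rw [h₁] at this
    rw [List.flatten_cons, List.length_append, seg_add, h₂, this]

/-! ### Estimates of the costs by natural logarithms. -/

section Bounds

theorem log_two_le {n : ℕ} (hn : 1 ≤ n) : (0.69 : ℝ) ≤ Real.log (n + 1) := by
  have h₁ := Real.log_two_gt_d9
  have h₂ : Real.log 2 ≤ Real.log (n + 1) := Real.log_le_log (by norm_num) (by
    have : (1 : ℝ) ≤ n := by exact_mod_cast hn
    linarith)
  linarith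

/-- With `c = Nat.clog 2 (n + 1) - 1` one has `2 ^ c < n + 1`, so `c` is at most `log (n + 1) / log
2`. The lost unit is at most the same quantity, and `2 / 0.69 < 3`. -/
theorem clog_le_log {n : ℕ} (hn : 1 ≤ n) : (Nat.clog 2 (n + 1) : ℝ) ≤ 3 * Real.log (n + 1) := by
  have h₁ := Real.log_two_gt_d9
  have h₂ := log_two_le hn
  have hpos := Nat.clog_pos one_lt_two (show 1 < n + 1 by omega)
  have hlt : 2 ^ (Nat.clog 2 (n + 1)).pred < n + 1 :=
    Nat.pow_pred_clog_lt_self one_lt_two (by omega)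
  obtain ⟨c, hc⟩ : ∃ c, Nat.clog 2 (n + 1) = c + 1 := ⟨Nat.clog 2 (n + 1) - 1, by omega⟩
  rw [hc, Nat.pred_succ] at hlt
  have h₃ : (2 : ℝ) ^ c ≤ (n : ℝ) + 1 := by exact_mod_cast hlt.le
  have h₄ := Real.log_le_log (by positivity) h₃
  rw [Real.log_pow] at h₄
  rw [hc]
  push_cast
  have h₅ : (c : ℝ) * 0.69 ≤ c * Real.log 2 :=
    mul_le_mul_of_nonneg_left (by linarith) (Nat.cast_nonneg c)
  linarith

theorem sortCost_le {n m : ℕ} (hm : 1 ≤ m) (hmn : m ≤ n) :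
    (sortCost n (16 * m + 1) : ℝ) ≤ 90000 * (n * Real.log (m + 1)) := by
  have hm' : (1 : ℝ) ≤ m := by exact_mod_cast hm
  have hmn' : (m : ℝ) ≤ n := by exact_mod_cast hmn
  have hlog := log_two_le hm
  have h₁ := clog_le_log (show 1 ≤ 16 * m + 1 by omega)
  -- Because `(m + 1) ^ 4 ≥ 16`, the fifth power of `m + 1` exceeds `16 * m + 2`; the constant
  -- factor 16 only multiplies the logarithm by a constant.
  have h₂ : Real.log (((16 * m + 1 : ℕ) : ℝ) + 1) ≤ 5 * Real.log (m + 1) := by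
    rw [show 5 * Real.log ((m : ℝ) + 1) = Real.log (((m : ℝ) + 1) ^ 5) by
      rw [Real.log_pow]; norm_num]
    refine Real.log_le_log (by positivity) ?_
    push_cast
    have : (2 : ℝ) ^ 4 ≤ ((m : ℝ) + 1) ^ 4 := pow_le_pow_left₀ (by norm_num) (by linarith) 4
    nlinarith
  have h₃ : (Nat.clog 2 (16 * m + 1 + 1) : ℝ) ≤ 15 * Real.log (m + 1) := by linarith
  unfold sortCost
  push_cast
  set c : ℝ := ((Nat.clog 2 (16 * m + 1 + 1) : ℕ) : ℝ)
  set μ := Real.log ((m : ℝ) + 1)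
  have h₄ : ((n : ℝ) + (16 * m + 1) + 1) * c ≤ (19 * n) * (15 * μ) :=
    mul_le_mul (by linarith) h₃ (Nat.cast_nonneg _) (by linarith)
  have h₅ : (n : ℝ) * 0.69 ≤ n * μ := mul_le_mul_of_nonneg_left hlog (by linarith)
  linarith

theorem layersCost_le {n m : ℕ} (hm : 1 ≤ m) (hn : 1 ≤ n) :
    (layersCost n m : ℝ) ≤ 9000 * (m * n * Real.log (n + 1)) := by
  have hm' : (1 : ℝ) ≤ m := by exact_mod_cast hm
  have hn' : (1 : ℝ) ≤ n := by exact_mod_cast hn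
  have hlog := log_two_le hn
  have h₁ := clog_le_log hn
  unfold layersCost sortCost
  push_cast
  set c : ℝ := ((Nat.clog 2 (n + 1) : ℕ) : ℝ)
  set μ := Real.log ((n : ℝ) + 1)
  have h₄ : ((n : ℝ) + n + 1) * c ≤ (3 * n) * (3 * μ) :=
    mul_le_mul (by linarith) h₁ (Nat.cast_nonneg _) (by linarith)
  have h₅ : (n : ℝ) * 0.69 ≤ n * μ := mul_le_mul_of_nonneg_left hlog (by linarith)
  have h₆ : 1 * ((n : ℝ) * μ) ≤ m * (n * μ) := mul_le_mul_of_nonneg_right hm' (by linarith)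
  have h₇ : (m : ℝ) * (n * 0.69) ≤ m * (n * μ) := mul_le_mul_of_nonneg_left h₅ (by linarith)
  have h₈ : (m : ℝ) * 1 ≤ m * n := mul_le_mul_of_nonneg_left hn' (by linarith)
  linarith

/-- Bounding the logarithm in the sorting cost by `n`, and `m` by `n`, makes the whole cost
quadratic; `log (m + 1) ≥ 0.69` does the rest. This covers `m = 1` too. -/
theorem layersCost_le' {n m : ℕ} (hm : 1 ≤ m) (hmn : m ≤ n) :
    (layersCost n m : ℝ) ≤ 9000 * (n ^ 2 * Real.log (m + 1)) := by
  have hm' : (1 : ℝ) ≤ m := by exact_mod_cast hm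
  have hmn' : (m : ℝ) ≤ n := by exact_mod_cast hmn
  have hlog := log_two_le hm
  have h₁ : (Nat.clog 2 (n + 1) : ℝ) ≤ n := by
    exact_mod_cast Nat.clog_le_of_le_pow Nat.lt_two_pow_self
  unfold layersCost sortCost
  push_cast
  set c : ℝ := ((Nat.clog 2 (n + 1) : ℕ) : ℝ)
  set μ := Real.log ((m : ℝ) + 1)
  have h₄ : ((n : ℝ) + n + 1) * c ≤ (3 * n) * n :=
    mul_le_mul (by linarith) h₁ (Nat.cast_nonneg _) (by linarith)
  have h₅ : (n : ℝ) ^ 2 * 0.69 ≤ n ^ 2 * μ := mul_le_mul_of_nonneg_left hlog (by positivity)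
  have h₆ : ((n : ℝ) + 1) * m ≤ (2 * n) * n :=
    mul_le_mul (by linarith) hmn' (by linarith) (by linarith)
  have h₇ : (n : ℝ) * 1 ≤ n * n := mul_le_mul_of_nonneg_left (by linarith) (by linarith)
  nlinarith

/-- From `log (n / m) ≤ n / m - 1` one gets `m log n ≤ m log m + n - m`, and `n` is at most `n log m
/ log 2`, as `m ≥ 2`. -/
theorem mul_log_le {m n : ℕ} (hm : 2 ≤ m) (hmn : m ≤ n) :
    (m : ℝ) * Real.log n ≤ 3 * (n * Real.log m) := by
  have hm' : (2 : ℝ) ≤ m := by exact_mod_cast hm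
  have hmn' : (m : ℝ) ≤ n := by exact_mod_cast hmn
  have h₁ := Real.log_two_gt_d9
  have h₂ : Real.log 2 ≤ Real.log m := Real.log_le_log (by norm_num) hm'
  have hm₀ : (0 : ℝ) < m := by linarith
  have hn₀ : (0 : ℝ) < n := by linarith
  have h₃ := Real.log_le_sub_one_of_pos (div_pos hn₀ hm₀)
  rw [Real.log_div hn₀.ne' hm₀.ne'] at h₃
  have h₄ : (m : ℝ) * Real.log n ≤ m * (Real.log m + n / m - 1) :=
    mul_le_mul_of_nonneg_left (by linarith) (by linarith)
  have h₅ : (m : ℝ) * (Real.log m + n / m - 1) = m * Real.log m + n - m := by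
    field_simp
  have h₆ : (m : ℝ) * Real.log m ≤ n * Real.log m :=
    mul_le_mul_of_nonneg_right hmn' (by linarith)
  have h₇ : (n : ℝ) * 0.69 ≤ n * Real.log m := mul_le_mul_of_nonneg_left (by linarith) (by linarith)
  nlinarith

end Bounds

open CollinearPoints (Plane orient input peelingDepth)

/-! ### Running the programs on a given point set. -/

section Input

variable {n : ℕ} (p : Fin n → Plane)

theorem input_point (i : Fin n) : p i = point ((input p).real 0) ((input p).real 1) i := by
  ext j
  fin_cases j <;> simp [input]

variable {p} {x y : ℕ → ℝ}

theorem eq_of_pos_eq (hp : Function.Injective p) (hxy : ∀ i : Fin n, p i = point x y i)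
    {i j : ℕ} (hi : i < n) (hj : j < n) (h : pos x y i = pos x y j) : i = j := by
  have h' : p ⟨i, hi⟩ = p ⟨j, hj⟩ := by
    rw [pos, pos, toLex_inj, Prod.mk.injEq] at h
    rw [hxy, hxy, point, point, h.1, h.2]
  exact congrArg Fin.val (hp h')

theorem range_eq_image_point (hxy : ∀ i : Fin n, p i = point x y i) {l : List ℕ}
    (hl : l.Perm (List.range n)) : Set.range p = point x y '' {i | i ∈ l} := by
  ext q
  constructor
  · rintro ⟨i, rfl⟩
    exact ⟨i, hl.symm.subset (List.mem_range.2 i.2), (hxy i).symm⟩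
  · rintro ⟨i, hi, rfl⟩
    exact ⟨⟨i, List.mem_range.1 (hl.subset hi)⟩, hxy _⟩

theorem layers_length_bounds (hn : 1 ≤ n) {l : List ℕ} (hl : l.Perm (List.range n))
    (hs : l.Pairwise fun a b => pos x y a < pos x y b) :
    1 ≤ (layers x y l).length ∧ (layers x y l).length ≤ n ∧
      (layers x y l).flatten.length = n := by
  have hnd : l.Nodup := hl.nodup_iff.2 List.nodup_range
  have hlen := (flatten_layers_perm x y hnd).length_eq
  rw [hl.length_eq, List.length_range] at hlen
  refine ⟨?_, ?_, hlen⟩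
  · rw [layers_of_ne_nil x y (by rintro rfl; simp at hl; omega)]
    simp
  · rw [← hlen, List.length_flatten, ← List.length_map List.length]
    refine List.length_le_sum_of_one_le _ fun i hi => ?_
    obtain ⟨r, hr, rfl⟩ := List.mem_map.1 hi
    exact List.length_pos_iff.2 (layers_spec hs r hr).1

/-- A list of the points in lexicographic order. -/
theorem exists_sorted (hp : Function.Injective p) (hxy : ∀ i : Fin n, p i = point x y i) :
    ∃ l : List ℕ, l.Perm (List.range n) ∧ l.Pairwise fun a b => pos x y a < pos x y b := by
  refine ⟨(List.range n).mergeSort fun a b => pos x y a ≤ pos x y b,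
    List.mergeSort_perm _ _, ?_⟩
  have hperm := List.mergeSort_perm (List.range n) fun a b => decide (pos x y a ≤ pos x y b)
  have hpw := List.pairwise_mergeSort (le := fun a b => decide (pos x y a ≤ pos x y b))
    (by simpa using fun a b c h h' => le_trans h h') (by simpa using fun a b => le_total _ _)
    (List.range n)
  have hnd := hperm.nodup_iff.2 List.nodup_range
  refine (hpw.and hnd).imp_of_mem fun {a b} ha hb h => ?_
  refine lt_of_le_of_ne (by simpa using h.1) fun h' => h.2 ?_
  exact eq_of_pos_eq hp hxy (List.mem_range.1 (hperm.subset ha))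
    (List.mem_range.1 (hperm.subset hb)) h'

theorem reportsConvexLayers (hxy : ∀ i : Fin n, p i = point x y i) {l : List ℕ}
    (hl : l.Perm (List.range n)) (hs : l.Pairwise fun a b => pos x y a < pos x y b) :
    CollinearPoints.ReportsConvexLayers p (encodeNat (layers x y l)) := by
  have hspec := layers_spec hs
  obtain ⟨L, hL⟩ := exists_map_val_eq (n := n) (L := layers x y l) fun r hr i hi =>
    List.mem_range.1 (hl.subset ((hspec r hr).2.2.1 hi))
  refine ⟨L, by rw [encode_eq, hL], fun r hr => ?_, ?_, fun j => ?_⟩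
  · obtain ⟨-, hnd, -, htr⟩ := hspec (r.map Fin.val) (hL ▸ List.mem_map_of_mem hr)
    refine ⟨hnd.of_map _, fun i j k hij hjk => ?_⟩
    rw [List.triplewise_map, List.triplewise_iff_getElem] at htr
    have := htr i j k hij hjk k.2
    simpa [hxy, orient, ori] using this
  · rw [range_eq_image_point hxy hl, peelingDepth_point hs, ← hL, List.length_map]
  · have hj : (j : ℕ) < (layers x y l).length := by
      rw [← hL, List.length_map]
      exact j.2
    rw [range_eq_image_point hxy hl, convexLayer_point hs j hj]
    have : (layers x y l)[(j : ℕ)] = (L.get j).map Fin.val := by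
      simp only [← hL, List.getElem_map, List.get_eq_getElem]
    rw [this]
    ext q
    constructor
    · rintro ⟨i, hi, rfl⟩
      exact ⟨i, List.mem_map_of_mem hi, (hxy i).symm⟩
    · rintro ⟨i, hi, rfl⟩
      obtain ⟨i, hi', rfl⟩ := List.mem_map.1 hi
      exact ⟨i, hi', hxy i⟩

theorem layersProg_input_runs (hp : Function.Injective p) (k : ℕ)
    (hk : layersCost n (peelingDepth (Set.range p)) ≤ k) :
    Runs layersProg (input p) k fun s' k' => ∃ l : List ℕ, l.Perm (List.range n) ∧
      l.Pairwise (fun a b => pos ((input p).real 0) ((input p).real 1) a <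
        pos ((input p).real 0) ((input p).real 1) b) ∧
      QRep (s'.nat 14) (s'.nat 12) 0 (layers ((input p).real 0) ((input p).real 1) l) ∧
      s'.nat 14 0 = 0 ∧ s'.nat 15 0 = peelingDepth (Set.range p) ∧
      k ≤ k' + layersCost n (peelingDepth (Set.range p)) := by
  refine (layersProg_runs (input p) k n (peelingDepth (Set.range p)) ?_ ?_ ?_ ?_ hk).mono ?_
  · simp [input]
  · intro a i ha
    simp [input, ha]
  · exact fun i hi j hj => eq_of_pos_eq hp (input_point p) hi hj
  · intro l hs hl
    rw [range_eq_image_point (input_point p) hl, peelingDepth_point hs]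
  · rintro s' k' - ⟨l, hs, hl, h⟩
    exact ⟨l, hl, hs, h⟩

theorem peelingDepth_bounds (hp : Function.Injective p) (hn : 1 ≤ n) :
    1 ≤ peelingDepth (Set.range p) ∧ peelingDepth (Set.range p) ≤ n := by
  obtain ⟨l, hl, hs⟩ := exists_sorted hp (input_point p)
  have := layers_length_bounds hn hl hs
  rw [range_eq_image_point (input_point p) hl, peelingDepth_point hs]
  exact ⟨this.1, this.2.1⟩

theorem convexLayers_runs (hp : Function.Injective p) (hn : 1 ≤ n) :
    Runs (block [layersProg, emitProg]) (input p)
      (layersCost n (peelingDepth (Set.range p)) + 200 * (peelingDepth (Set.range p) + n + 1) + 1)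
      fun s' _ => CollinearPoints.ReportsConvexLayers p s'.out := by
  set m := peelingDepth (Set.range p) with hm
  simp only [runs_block_cons, runs_block_nil]
  refine (layersProg_input_runs hp _ (by rw [← hm]; omega)).mono ?_
  rintro s₁ k₁ hf₁ ⟨l, hl, hs, hQ, h14, h15, hk₁⟩
  have hlen := layers_length_bounds hn hl hs
  have hlm : m = (layers ((input p).real 0) ((input p).real 1) l).length := by
    rw [hm, range_eq_image_point (input_point p) hl, peelingDepth_point hs]
  rw [← hm] at h15 hk₁
  refine (emitProg_runs s₁ k₁ _ hQ h14 (h15.trans hlm) ?_).mono ?_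
  · rw [← hlm, hlen.2.2]
    omega
  · rintro s₂ k₂ - ⟨ho, hk₂⟩
    rw [← hlm, hlen.2.2] at hk₂
    refine ⟨by omega, ?_⟩
    have ho₁ : s₁.out = [] := hf₁.out (by decide)
    rw [ho, ho₁, List.nil_append]
    exact reportsConvexLayers (input_point p) hl hs

/-- The `4 * m` unimodal pieces of the layer order give `4 * (4 * m) + 1 = 16 * m + 1` descents for
every pivot. -/
theorem maximalCollinear_runs (hp : Function.Injective p) (hn : 1 ≤ n) :
    Runs (block [layersProg, pivotsProg]) (input p)
      (layersCost n (peelingDepth (Set.range p)) +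
        (n * (sortCost n (16 * peelingDepth (Set.range p) + 1) + 1200 * (n + 1)) + 20) + 1)
      fun s' _ => CollinearPoints.ReportsMaximalCollinear p s'.out := by
  set m := peelingDepth (Set.range p) with hm
  set x := (input p).real 0 with hx
  set y := (input p).real 1 with hy
  have hxy : ∀ i : Fin n, p i = point x y i := input_point p
  simp only [runs_block_cons, runs_block_nil]
  refine (layersProg_input_runs hp _ (by rw [← hm]; omega)).mono ?_
  rintro s₁ k₁ hf₁ ⟨l, hl, hs, hQ, h14, h15, hk₁⟩
  rw [← hx, ← hy] at hs hQ
  have hlen := layers_length_bounds hn hl hs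
  have hlm : m = (layers x y l).length := by
    rw [hm, range_eq_image_point hxy hl, peelingDepth_point hs]
  have hx₁ : s₁.real 0 = x := hf₁.real 0 (by decide)
  have hy₁ : s₁.real 1 = y := hf₁.real 1 (by decide)
  have hnd : l.Nodup := hl.nodup_iff.2 List.nodup_range
  have hflat : seg (s₁.nat 12) 0 n = (layers x y l).flatten := by
    have := hQ.seg_flatten
    rwa [h14, hlen.2.2] at this
  have hperm : (layers x y l).flatten.Perm (List.range n) := (flatten_layers_perm x y hnd).trans hl
  rw [← hm] at hk₁
  refine (pivotsProg_runs s₁ k₁ n (16 * m + 1) ?_ ?_ (by omega)).mono ?_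
  · rw [hf₁.nat 0 (by decide)]
    simp [input]
  · intro q hq a
    rw [hx₁, hy₁, hflat]
    obtain ⟨Cs, h₁, h₂, h₃⟩ := layers_exists_unimodal hs (p := q) fun a ha h =>
      eq_of_pos_eq hp hxy (List.mem_range.1 (hl.subset ha)) hq h
    rw [h₂]
    refine (descents_rearrange_le _ h₃ a).trans ?_
    rw [h₁, hlm]
    omega
  · rintro s₂ k₂ - ⟨σ, hσ, ho, hk₂⟩
    rw [hx₁, hy₁] at hσ ho
    rw [hflat] at hσ
    refine ⟨by omega, ?_⟩
    have ho₁ : s₁.out = [] := hf₁.out (by decide)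
    rw [ho, ho₁, List.nil_append]
    refine reportsMaximalCollinear hp hxy σ fun q hq => ⟨?_, fun i => ?_, (hσ q hq).2⟩
    · exact (hσ q hq).1.nodup_iff.2 ((hperm.nodup_iff.2 List.nodup_range).filter _)
    · rw [(hσ q hq).1.mem_iff, List.mem_filter, hperm.mem_iff, List.mem_range, decide_eq_true_eq]

end Input

end RealRAM

theorem mainTheorem3 :
    (∃ (prog : RealRAM.Prog) (C : ℝ), ∀ (n : ℕ) (p : Fin n → CollinearPoints.Plane),
      1 ≤ n → Function.Injective p →
      ∃ (t : ℕ) (s : RealRAM.State), RealRAM.Exec prog (CollinearPoints.input p) t s ∧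
        CollinearPoints.ReportsMaximalCollinear p s.out ∧
        (t : ℝ) ≤ C * ((n : ℝ) ^ 2 *
          Real.log ((CollinearPoints.peelingDepth (Set.range p) : ℝ) + 1))) ∧
    (∃ (prog : RealRAM.Prog) (C : ℝ), ∀ (n : ℕ) (p : Fin n → CollinearPoints.Plane),
      1 ≤ n → Function.Injective p →
      ∃ (t : ℕ) (s : RealRAM.State), RealRAM.Exec prog (CollinearPoints.input p) t s ∧
        CollinearPoints.ReportsConvexLayers p s.out ∧
        (t : ℝ) ≤ C * ((CollinearPoints.peelingDepth (Set.range p) : ℝ) * (n : ℝ) *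
          Real.log ((n : ℝ) + 1))) ∧
    (∃ C : ℝ, ∀ m n : ℕ, 2 ≤ m → m ≤ n →
      (m : ℝ) * Real.log (n : ℝ) ≤ C * ((n : ℝ) * Real.log (m : ℝ))) := by
  refine ⟨⟨RealRAM.block [RealRAM.layersProg, RealRAM.pivotsProg], 200000, fun n p hn hp => ?_⟩, ⟨RealRAM.block [RealRAM.layersProg, RealRAM.emitProg], 20000, fun n p hn hp => ?_⟩,
    3, fun m n hm hmn => RealRAM.mul_log_le hm hmn⟩
  · obtain ⟨t, s, he, ht, hs⟩ := RealRAM.maximalCollinear_runs hp hn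
    refine ⟨t, s, he, hs, ?_⟩
    obtain ⟨h₁, h₂⟩ := RealRAM.peelingDepth_bounds hp hn
    set m := CollinearPoints.peelingDepth (Set.range p)
    have ht' : (t : ℝ) ≤ _ := Nat.cast_le.2 ht
    have h₃ := RealRAM.layersCost_le' h₁ h₂
    have h₄ := RealRAM.sortCost_le h₁ h₂
    have hlog := RealRAM.log_two_le h₁
    have hn' : (1 : ℝ) ≤ n := by exact_mod_cast hn
    push_cast at ht'
    set μ := Real.log ((m : ℝ) + 1)
    have h₅ : (n : ℝ) ^ 2 * 0.69 ≤ n ^ 2 * μ := mul_le_mul_of_nonneg_left hlog (by positivity)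
    have h₆ : (n : ℝ) * RealRAM.sortCost n (16 * m + 1) ≤ n * (90000 * (n * μ)) :=
      mul_le_mul_of_nonneg_left h₄ (by linarith)
    -- Apart from the `9000` for the layers and the `90000` for the sorting, only terms of size `n ^
    -- 2` remain, and `h₅` bounds these by a multiple of `n ^ 2 * μ`.
    nlinarith
  · obtain ⟨t, s, he, ht, hs⟩ := RealRAM.convexLayers_runs hp hn
    refine ⟨t, s, he, hs, ?_⟩
    obtain ⟨h₁, h₂⟩ := RealRAM.peelingDepth_bounds hp hn
    set m := CollinearPoints.peelingDepth (Set.range p)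
    have ht' : (t : ℝ) ≤ _ := Nat.cast_le.2 ht
    have h₃ := RealRAM.layersCost_le h₁ hn
    have hlog := RealRAM.log_two_le hn
    have hn' : (1 : ℝ) ≤ n := by exact_mod_cast hn
    have hm' : (1 : ℝ) ≤ m := by exact_mod_cast h₁
    push_cast at ht'
    set μ := Real.log ((n : ℝ) + 1)
    have h₅ : (m : ℝ) * n * 0.69 ≤ m * n * μ := mul_le_mul_of_nonneg_left hlog (by positivity)
    have h₆ : (m : ℝ) * 1 ≤ m * n := mul_le_mul_of_nonneg_left hn' (by linarith)
    have h₇ : 1 * (n : ℝ) ≤ m * n := mul_le_mul_of_nonneg_right hm' (by linarith)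
    linarith
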